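/- **Setting.** Let $(X_t)_{t\in\mathbb Z}$ be a strictly stationary, $\alpha$-mixing sequence in $\mathbb R^p$ with marginal distribution $F$, let $\|\cdot\|$ be any norm on $\mathbb R^k$ ($k\ge 1$), and let $\theta=T(F)\in\mathbb R^k$ for a functional $T$ of distributions. For a block of length $m$ starting at time $j$, let $\hat\theta_{j,j+m-1}=T(\rho_{j,j+m-1})$, where $\rho_{j,j+m-1}=m^{-1}\sum_{h=j}^{j+m-1}\delta_{X_h}$, and $\hat\theta_n=\hat\theta_{1,n}$ (all these are measurable functions of the data). Let $IF(x)=\lim_{\epsilon\downarrow0}\epsilon^{-1}\{T((1-\epsilon)F+\epsilon\delta_x)-T(F)\}$ be the influence function (existing for $F$-almost every $x$) and define remainders by $\hat\theta_{j,j+m-1}=\theta+m^{-1}\sum_{h=j}^{j+m-1}IF(X_h)+R_{j,j+m-1}$. Fix $b\in(0,1]$; put $l=\lceil nb\rceil$, $N=n-l+1$, and $l'=\lceil n'b\rceil$, $N'=n'-l'+1$ for a second window width $n'=n'_n$. Assume: (A.1) $IF$ is $F$-integrable, $E\{IF(X_1)\}=0$ and $n^{-1/2}\sum_{j=1}^{\lfloor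 nr\rfloor}IF(X_j)\Rightarrow\Sigma^{1/2}W_k(r)$ weakly in the Skorokhod space of $\mathbb R^k$-valued càdlàg functions on $[0,1]$, with $\Sigma$ positive definite and $W_k$ a vector of $k$ independent standard Brownian motions; (A.2) $\sqrt n\,\|R_{1,n}\|=o_p(1)$ and $\sqrt l\,\max_{1\le j\le N}\|R_{j,j+l-1}\|=o_p(1)$; (A.3) $1/n'+n'/n\to0$ as $n\to\infty$. Define $$\widetilde G(b;k)=(1-b)^{-1}\int_0^{1-b}\mathbf 1\Big[\|\Sigma^{1/2}W_k(1)\|\le\|\Sigma^{1/2}\{W_k(b+t)-W_k(t)-bW_k(1)\}\|/\sqrt b\Big]dt$$ (with $\widetilde G(1;k)=0$), the first-stage p-value $$\mathrm{pval}_n(\vartheta)=N^{-1}\sum_{j=1}^N\mathbf 1\{\|\sqrt n(\hat\theta_n-\vartheta)\|\le\|\sqrt l(\hat\theta_{j,j+l-1}-\hat\theta_n)\|\},$$ its subsampling counterparts, for $t=1,\dots,n-n'+1$, $$q_{n',t}=(N')^{-1}\sum_{j=t}^{t+N'-1}\mathbf 1\{\|\sqrt{l'}(\hat\theta_{j,j+l'-1}-\hat\theta_{t,t+n'-1})\|\ge\|\sqrt{n'}(\hat\theta_{t,t+n'-1}-\hat\theta_n)\|\},$$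 and $Q_{n,n'}(x)=(n-n'+1)^{-1}\sum_{t=1}^{n-n'+1}\mathbf 1(q_{n',t}\le x)$. **Theorem.** Under these assumptions $$\sup_{x\in\mathbb R}\big|Q_{n,n'}(x)-P(\widetilde G(b;k)\le x)\big|=o_p(1).$$ Consequently, let $\alpha\in(0,1)$, $c_{n,n'}(\alpha)=\inf\{x:Q_{n,n'}(x)\ge\alpha\}$ and $\widetilde G_\alpha(b;k)=\inf\{x:P(\widetilde G(b;k)\le x)\ge\alpha\}$. If $P(\widetilde G(b;k)=\widetilde G_\alpha(b;k))=0$ (which holds for every $\alpha$ if $\widetilde G(b;k)$ is a continuous random variable), then the calibrated confidence region $\{\vartheta\in\mathbb R^k:\mathrm{pval}_n(\vartheta)\ge c_{n,n'}(\alpha)\}$ has asymptotic coverage $1-\alpha$: $$P\{\mathrm{pval}_n(\theta)\ge c_{n,n'}(\alpha)\}\to1-\alpha .$$ -/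

import Mathlib

open MeasureTheory ProbabilityTheory Filter Topology
open scoped NNReal ENNReal MatrixOrder

namespace DoubleSubsampling

noncomputable section

/-! ### Stationary and strongly mixing sequences -/

/-- Strict stationarity of a two-sided sequence: the law of the whole sequence is invariant
under time shifts. -/
def IsStrictlyStationary {Ω E : Type*} [MeasurableSpace Ω] [MeasurableSpace E]
    (P : Measure Ω) (X : ℤ → Ω → E) : Prop :=
  ∀ h : ℤ, P.map (fun ω (t : ℤ) => X (t + h) ω) = P.map (fun ω (t : ℤ) => X t ω)

/-- The `σ`-algebra generated by `X t`, `t ∈ S`. -/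
abbrev sigmaOf {Ω E : Type*} [MeasurableSpace E] (X : ℤ → Ω → E) (S : Set ℤ) : MeasurableSpace Ω :=
  ⨆ t ∈ S, MeasurableSpace.comap (X t) inferInstance

/-- Rosenblatt's coefficient `α(m) = sup |P(A ∩ B) - P(A) P(B)|` over all times `s`, all events
`A` of the past up to `s` and all events `B` of the future from `s + m` on. -/
def alphaCoeff {Ω E : Type*} [MeasurableSpace Ω] [MeasurableSpace E]
    (P : Measure Ω) (X : ℤ → Ω → E) (m : ℕ) : ℝ :=
  sSup {r : ℝ | ∃ (s : ℤ) (A B : Set Ω),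
    MeasurableSet[sigmaOf X (Set.Iic s)] A ∧ MeasurableSet[sigmaOf X (Set.Ici (s + m))] B ∧
    r = |P.real (A ∩ B) - P.real A * P.real B|}

/-- `α`-mixing (strong mixing): `α(m) → 0`. -/
def IsAlphaMixing {Ω E : Type*} [MeasurableSpace Ω] [MeasurableSpace E]
    (P : Measure Ω) (X : ℤ → Ω → E) : Prop :=
  Tendsto (alphaCoeff P X) atTop (𝓝 0)

/-! ### Weak convergence in the Skorokhod space `D^k[0,1]` -/

/-- Right continuous functions on `[0,1]` with left limits. -/
def IsCadlag {V : Type*} [TopologicalSpace V] (x : unitInterval → V) : Prop :=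
  ∀ t, ContinuousWithinAt x (Set.Ici t) t ∧ ∃ v, Tendsto x (𝓝[<] t) (𝓝 v)

/-- Convergence of sequences in the (metrizable) Skorokhod `J₁` topology: there are increasing
bijections `τ m` of `[0,1]` with `τ m → id` and `x m ∘ τ m → y` uniformly. -/
def SkorokhodTendsto {V : Type*} [UniformSpace V] (x : ℕ → unitInterval → V)
    (y : unitInterval → V) : Prop :=
  ∃ τ : ℕ → (unitInterval ≃o unitInterval),
    TendstoUniformly (fun m t => τ m t) (fun t => t) atTop ∧
    TendstoUniformly (fun m t => x m (τ m t)) y atTop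

/-- Continuity of a functional on the Skorokhod space (its values at functions which are not
càdlàg are irrelevant). -/
def SkorokhodContinuous {V : Type*} [UniformSpace V] (f : (unitInterval → V) → ℝ) : Prop :=
  ∀ (x : ℕ → unitInterval → V) (y : unitInterval → V),
    (∀ m, IsCadlag (x m)) → IsCadlag y → SkorokhodTendsto x y →
      Tendsto (fun m => f (x m)) atTop (𝓝 (f y))

/-- Weak convergence `Z n ⇒ Z'` in the Skorokhod space of `V`-valued functions, for processes with
(almost surely) càdlàg paths: `E f(Z n) → E f(Z')` for all bounded Skorokhod continuous `f`. -/
def SkorokhodWeakConv {Ω Ω' V : Type*} [MeasurableSpace Ω] [MeasurableSpace Ω'] [UniformSpace V]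
    (P : Measure Ω) (Z : ℕ → Ω → unitInterval → V)
    (P' : Measure Ω') (Z' : Ω' → unitInterval → V) : Prop :=
  ∀ f : (unitInterval → V) → ℝ, (∃ C : ℝ, ∀ x, |f x| ≤ C) → SkorokhodContinuous f →
    Tendsto (fun n => ∫ ω, f (Z n ω) ∂P) atTop (𝓝 (∫ ω', f (Z' ω') ∂P'))

/-! ### Statistical functionals -/

/-- The empirical distribution of `m` points. -/
def empirical {E : Type*} [MeasurableSpace E] {m : ℕ} (x : Fin m → E) : Measure E :=
  (m : ℝ≥0∞)⁻¹ • ∑ i, Measure.dirac (x i)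

/-- The estimator `T(ρ)`, where `ρ` is the empirical distribution of the block
`X j, …, X (j + m - 1)` of length `m` starting at time `j`. -/
def blockEst {Ω E V : Type*} [MeasurableSpace E] (T : Measure E → V) (X : ℤ → Ω → E)
    (j : ℤ) (m : ℕ) (ω : Ω) : V :=
  T (empirical fun i : Fin m => X (j + (i : ℕ)) ω)

/-- `φ` is the influence function of `T` at the distribution `F`:
`φ(x) = lim_{ε ↓ 0} (T((1 - ε) F + ε δ_x) - T(F)) / ε`, for `F`-almost every `x`. -/
def IsInfluenceFunction {E : Type*} [MeasurableSpace E] {k : ℕ}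
    (T : Measure E → Fin k → ℝ) (F : Measure E) (φ : E → Fin k → ℝ) : Prop :=
  ∀ᵐ x ∂F, Tendsto
    (fun ε : ℝ => ε⁻¹ •
      (T (ENNReal.ofReal (1 - ε) • F + ENNReal.ofReal ε • Measure.dirac x) - T F))
    (𝓝[>] 0) (𝓝 (φ x))

/-- The remainder `R` of the expansion of the block estimator:
`T(ρ) = T(F) + m⁻¹ ∑ φ(X h) + R`, the sum being over the `m` times `h` of the block. -/
def remainder {Ω E : Type*} [MeasurableSpace E] {k : ℕ} (T : Measure E → Fin k → ℝ)
    (F : Measure E) (φ : E → Fin k → ℝ) (X : ℤ → Ω → E) (j : ℤ) (m : ℕ) (ω : Ω) : Fin k → ℝ :=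
  blockEst T X j m ω - T F - (m : ℝ)⁻¹ • ∑ i : Fin m, φ (X (j + (i : ℕ)) ω)

/-- The partial sum process `r ↦ n^{-1/2} ∑_{j=1}^{⌊n r⌋} φ(X j)`. -/
def partialSumProcess {Ω E : Type*} {k : ℕ} (φ : E → Fin k → ℝ) (X : ℤ → Ω → E) (n : ℕ) (ω : Ω)
    (r : unitInterval) : Fin k → ℝ :=
  (√(n : ℝ))⁻¹ • ∑ j ∈ Finset.Icc 1 ⌊(n : ℝ) * (r : ℝ)⌋₊, φ (X (j : ℤ) ω)

/-! ### The limit distribution -/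

/-- `W` is a vector of `k` independent standard Brownian motions. -/
structure IsVectorBrownian {Ω' : Type*} [MeasurableSpace Ω'] {k : ℕ} (P' : Measure Ω')
    (W : Fin k → ℝ≥0 → Ω' → ℝ) : Prop where
  isBrownian : ∀ i, IsBrownianReal (W i) P'
  indep : iIndepFun (fun (i : Fin k) (ω' : Ω') (t : ℝ≥0) => W i t ω') P'

/-- The process `Σ^{1/2} W(t)`, `t ≥ 0`. -/
def scaledBM {Ω' : Type*} {k : ℕ} (S : Matrix (Fin k) (Fin k) ℝ) (W : Fin k → ℝ≥0 → Ω' → ℝ)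
    (ω' : Ω') (t : ℝ) : Fin k → ℝ :=
  (CFC.sqrt S).mulVec fun i => W i t.toNNReal ω'

open Classical in
/-- The random variable `G̃(b;k)`, that is
`(1-b)⁻¹ ∫_0^{1-b} 1{‖Σ^{1/2} W(1)‖ ≤ ‖Σ^{1/2} (W(b+t) - W(t) - b W(1))‖ / √b} dt`. -/
def limitG {Ω' : Type*} {k : ℕ} (ν : Seminorm ℝ (Fin k → ℝ)) (S : Matrix (Fin k) (Fin k) ℝ)
    (W : Fin k → ℝ≥0 → Ω' → ℝ) (b : ℝ) (ω' : Ω') : ℝ :=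
  (1 - b)⁻¹ * ∫ t in (0 : ℝ)..(1 - b),
    if ν (scaledBM S W ω' 1) ≤
        ν (scaledBM S W ω' (b + t) - scaledBM S W ω' t - b • scaledBM S W ω' 1) / √b
      then (1 : ℝ) else 0

/-- The distribution function `P(G ≤ x)`. -/
def distFun {Ω' : Type*} [MeasurableSpace Ω'] (P' : Measure Ω') (G : Ω' → ℝ) (x : ℝ) : ℝ :=
  P'.real {ω' | G ω' ≤ x}

/-- The (lower) `a`-quantile `inf {x : H x ≥ a}` of a distribution function. -/
def quantile (H : ℝ → ℝ) (a : ℝ) : ℝ :=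
  sInf {x : ℝ | a ≤ H x}

/-! ### First stage: the subsampling p-value -/

/-- The block length `⌈n b⌉`. -/
def blockLen (b : ℝ) (n : ℕ) : ℕ := ⌈(n : ℝ) * b⌉₊

/-- The number `n - ⌈n b⌉ + 1` of blocks of length `⌈n b⌉` in a sample of size `n`. -/
def numBlocks (b : ℝ) (n : ℕ) : ℕ := n - blockLen b n + 1

section

variable {Ω E : Type*} [MeasurableSpace E] {k : ℕ}

open Classical in
/-- The subsampling p-value for the hypothesis that the parameter is `θ`, from `X 1, …, X n`. -/
def pval (ν : Seminorm ℝ (Fin k → ℝ)) (T : Measure E → Fin k → ℝ) (X : ℤ → Ω → E) (b : ℝ)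
    (n : ℕ) (θ : Fin k → ℝ) (ω : Ω) : ℝ :=
  (numBlocks b n : ℝ)⁻¹ * ∑ j ∈ Finset.Icc 1 (numBlocks b n),
    if ν (√(n : ℝ) • (blockEst T X 1 n ω - θ)) ≤
        ν (√(blockLen b n : ℝ) • (blockEst T X (j : ℤ) (blockLen b n) ω - blockEst T X 1 n ω))
      then (1 : ℝ) else 0

/-! ### Second stage: subsampling the p-value -/

open Classical in
/-- The subsample p-value `q_{n',t}`, from `X t, …, X (t + n' - 1)`, centered at the estimator
from the full sample. -/
def subPval (ν : Seminorm ℝ (Fin k → ℝ)) (T : Measure E → Fin k → ℝ) (X : ℤ → Ω → E) (b : ℝ)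
    (n n' t : ℕ) (ω : Ω) : ℝ :=
  (numBlocks b n' : ℝ)⁻¹ * ∑ j ∈ Finset.Icc t (t + numBlocks b n' - 1),
    if ν (√(n' : ℝ) • (blockEst T X (t : ℤ) n' ω - blockEst T X 1 n ω)) ≤
        ν (√(blockLen b n' : ℝ) •
          (blockEst T X (j : ℤ) (blockLen b n') ω - blockEst T X (t : ℤ) n' ω))
      then (1 : ℝ) else 0

open Classical in
/-- The empirical distribution function `Q_{n,n'}` of the `q_{n',t}`, `t = 1, …, n - n' + 1`. -/
def subDist (ν : Seminorm ℝ (Fin k → ℝ)) (T : Measure E → Fin k → ℝ) (X : ℤ → Ω → E) (b : ℝ)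
    (n n' : ℕ) (ω : Ω) (x : ℝ) : ℝ :=
  ((n - n' + 1 : ℕ) : ℝ)⁻¹ * ∑ t ∈ Finset.Icc 1 (n - n' + 1),
    if subPval ν T X b n n' t ω ≤ x then (1 : ℝ) else 0

/-- The calibrated confidence region of nominal level `1 - a`: the parameter values whose p-value
is at least the `a`-quantile of `Q_{n,n'}`. -/
def confRegion (ν : Seminorm ℝ (Fin k → ℝ)) (T : Measure E → Fin k → ℝ) (X : ℤ → Ω → E) (b : ℝ)
    (n n' : ℕ) (a : ℝ) (ω : Ω) : Set (Fin k → ℝ) :=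
  {θ | quantile (subDist ν T X b n n' ω) a ≤ pval ν T X b n θ ω}

end

end

end DoubleSubsampling

open DoubleSubsampling

/-!
Write `A = ‖Σ^{1/2} W(1)‖` and `D(u) = ‖Σ^{1/2}(W(b + t) - W(t) - b W(1))‖ / √b`, `t = (1 - b) u`,
so that the limit variable is the Lebesgue measure `levelFrac D A` of `{u ∈ [0,1] : A ≤ D(u)}`. The
process `D` is a functional of the Brownian bridge, which is independent of `W(1)`
(`IsVectorBrownian.indepFun_bridge`), and `A` has no atoms. Generalized quantiles of `D`
(`crossLevel`) are Lipschitz functionals of the path, hence real random variables independent of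
`A`, and `A` almost surely avoids any given countable family of them. This has two consequences.
Almost surely `A` is neither the maximum nor the minimum of `D` and `{D = A}` is a null set
(`IsVectorBrownian.ae_crossFree`), so that fractions of windows with `A ≤ D`, computed from
discretizations of a nearby path, converge to the limit variable, and are *equal* to it from some
index on if the limit variable is `0` or `1`. Moreover the law of the limit variable has no atom in
the open interval `(0,1)` (`IsVectorBrownian.ae_levelFrac_ne`). It can have atoms at `0` and `1`,
which is why plain convergence in law of the p-values would not suffice for uniform convergence of
distribution functions.

The functional limit theorem enters through a portmanteau inequality for sets of paths that vary
with `n` (`eventually_measureReal_le`), obtained by testing weak convergence on powers of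
`1 - skorDist C`, where `skorDist C` is the truncated Skorokhod distance to a set `C`; since the
limit paths are continuous, Skorokhod limits are uniform limits. Applied to the set of paths for
which a small perturbation gives a p-value in `B`, it yields `P(p-value ∈ B) → P(limit ∈ B)` for
every half line `B`, without continuity assumption (`tendsto_windowPval`).

In the second stage the centre `θ̂_n` may be replaced by `θ` up to a deterministic tolerance tending
to `0` (`tendsto_sqrt_smul_blockEst_sub`, `exists_tolerance`). The resulting frequencies are averages
of a stationary mixing sequence of events, and concentrate by Chebyshev's inequality
(`tendsto_freq_windowPval`). Pólya's argument at finitely many quantiles gives uniform convergence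
(`exists_finset_forall_abs_sub_cdf_le`). For the coverage, `c_n ≤ pval_n` means
`a ≤ Q_n(pval_n)`, and `Q_n` may be replaced by the limiting distribution function
(`tendsto_coverage`).
-/

namespace DoubleSubsampling

noncomputable section

/-! ### Exceedance fractions and crossing levels -/

/-- The fraction of the `j < N` with `a ≤ d j`. -/
def exceed (N : ℕ) (a : ℝ) (d : ℕ → ℝ) : ℝ :=
  open Classical in (N : ℝ)⁻¹ * ∑ j ∈ Finset.range N, if a ≤ d j then (1 : ℝ) else 0

/-- The Lebesgue measure of the superlevel set `{a ≤ D}` of a function `D` on `[0,1]`. -/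
def levelFrac (D : unitInterval → ℝ) (a : ℝ) : ℝ := volume.real {u | a ≤ D u}

/-- The generalized quantile `sup {a : levelFrac D a ∈ U}` of a function `D` on `[0,1]`; it is of
interest for upper sets `U` with `0 ∉ U` and `1 ∈ U`. -/
def crossLevel (U : Set ℝ) (D : unitInterval → ℝ) : ℝ := sSup {a | levelFrac D a ∈ U}

lemma levelFrac_nonneg (D : unitInterval → ℝ) (a : ℝ) : 0 ≤ levelFrac D a := measureReal_nonneg

lemma levelFrac_le_one (D : unitInterval → ℝ) (a : ℝ) : levelFrac D a ≤ 1 := measureReal_le_one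

lemma levelFrac_mono {D D' : unitInterval → ℝ} {a a' : ℝ} (h : ∀ u, a ≤ D u → a' ≤ D' u) :
    levelFrac D a ≤ levelFrac D' a' := measureReal_mono fun u hu => h u hu

lemma levelFrac_anti (D : unitInterval → ℝ) : Antitone (levelFrac D) :=
  fun _ _ h => levelFrac_mono fun _ hu => h.trans hu

lemma levelFrac_eq_one {D : unitInterval → ℝ} {a : ℝ} (h : ∀ u, a ≤ D u) : levelFrac D a = 1 := by
  have : {u | a ≤ D u} = Set.univ := Set.eq_univ_of_forall h
  simp [levelFrac, this]

lemma levelFrac_eq_zero {D : unitInterval → ℝ} {a : ℝ} (h : ∀ u, D u < a) :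
    levelFrac D a = 0 := by
  have : {u | a ≤ D u} = ∅ := Set.eq_empty_of_forall_notMem fun u hu => not_le.2 (h u) hu
  simp [levelFrac, this]

lemma unitInterval_volume_pos {U : Set unitInterval} (hU : IsOpen U) (hne : U.Nonempty) :
    0 < volume.real U := by
  obtain ⟨V, hV, rfl⟩ := isOpen_induced_iff.1 hU
  obtain ⟨u, hu⟩ := hne
  have hcl : (u : ℝ) ∈ closure (Set.Ioo (0 : ℝ) 1) := by
    rw [closure_Ioo zero_ne_one]; exact u.2
  have h1 : (V ∩ Set.Ioo (0 : ℝ) 1).Nonempty := mem_closure_iff.1 hcl V hV hu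
  have h2 : 0 < volume (V ∩ Set.Ioo (0 : ℝ) 1) := (hV.inter isOpen_Ioo).measure_pos _ h1
  refine ENNReal.toReal_pos ?_ (measure_ne_top _ _)
  rw [unitInterval.volume_apply]
  refine (h2.trans_le (measure_mono ?_)).ne'
  rintro x ⟨hx, hx1⟩
  exact ⟨⟨x, hx1.1.le, hx1.2.le⟩, hx, rfl⟩

section crossLevel

variable {U : Set ℝ} {D D' : unitInterval → ℝ} {A : ℝ}

lemma crossLevel_bddAbove (h0 : (0 : ℝ) ∉ U) {c : ℝ} (hD : ∀ u, D u ≤ c) :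
    BddAbove {a | levelFrac D a ∈ U} := by
  refine ⟨c, fun a ha => ?_⟩
  by_contra! hca
  have ha' : levelFrac D a ∈ U := ha
  rw [levelFrac_eq_zero fun u => (hD u).trans_lt hca] at ha'
  exact h0 ha'

lemma crossLevel_nonempty (h1 : (1 : ℝ) ∈ U) {c : ℝ} (hD : ∀ u, c ≤ D u) :
    {a | levelFrac D a ∈ U}.Nonempty :=
  ⟨c, by rw [Set.mem_ofPred_eq, levelFrac_eq_one hD]; exact h1⟩

/-- Generalized quantiles are monotone and commute with translations, so they are `1`-Lipschitz
for the uniform distance. -/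
lemma crossLevel_le_add (hU : IsUpperSet U) (h0 : (0 : ℝ) ∉ U) (h1 : (1 : ℝ) ∈ U) {c ε : ℝ}
    (hD : ∀ u, |D u| ≤ c) (hD' : ∀ u, |D' u| ≤ c) (h : ∀ u, D u ≤ D' u + ε) :
    crossLevel U D ≤ crossLevel U D' + ε := by
  refine csSup_le (crossLevel_nonempty h1 fun u => (abs_le.1 (hD u)).1) fun a ha => ?_
  have : a - ε ≤ crossLevel U D' := by
    refine le_csSup (crossLevel_bddAbove h0 fun u => (abs_le.1 (hD' u)).2) ?_
    exact hU (levelFrac_mono fun u hu => by linarith [h u]) ha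
  linarith

/-- `A` is the generalized quantile if lower levels are in `U` and higher ones are not. -/
lemma crossLevel_eq (hlo : ∀ a < A, levelFrac D a ∈ U) (hhi : ∀ a > A, levelFrac D a ∉ U) :
    crossLevel U D = A := by
  refine csSup_eq_of_forall_le_of_forall_lt_exists_gt ⟨A - 1, hlo _ (by linarith)⟩
    (fun a ha => not_lt.1 fun h => hhi a h ha) fun w hw => ?_
  obtain ⟨a, ha, ha'⟩ := exists_between hw
  exact ⟨a, hlo a ha', ha⟩

/-- The level `A` avoids the minimum, the maximum and the rational quantiles of `D`. -/
def CrossFree (A : ℝ) (D : unitInterval → ℝ) : Prop :=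
  (∀ q : ℚ, 0 ≤ q → q < 1 → A ≠ crossLevel (Set.Ioi (q : ℝ)) D) ∧
    A ≠ crossLevel (Set.Ici 1) D

lemma CrossFree.volume_eq (h : CrossFree A D) (hD : Continuous D) :
    volume {u | D u = A} = 0 := by
  by_contra hne
  have hpos : 0 < volume.real {u | D u = A} :=
    ENNReal.toReal_pos hne (measure_ne_top _ _)
  have hsplit : levelFrac D A = volume.real {u | A < D u} + volume.real {u | D u = A} := by
    rw [← measureReal_union]
    · rw [levelFrac]
      congr 1 with u
      simp only [Set.mem_ofPred_eq, Set.mem_union, le_iff_lt_or_eq, eq_comm (a := A)]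
    · exact Set.disjoint_left.2 fun u hu hu' => hu.ne' hu'
    · exact (isClosed_eq hD continuous_const).measurableSet
  obtain ⟨q, hq1, hq2⟩ := exists_rat_btwn
    (show volume.real {u | A < D u} < levelFrac D A by linarith)
  have hq0 : (0 : ℝ) ≤ q := measureReal_nonneg.trans hq1.le
  have hq1' : (q : ℝ) < 1 := hq2.trans_le (levelFrac_le_one _ _)
  refine h.1 q (by exact_mod_cast hq0) (by exact_mod_cast hq1') (crossLevel_eq ?_ ?_).symm
  · intro a ha
    exact hq2.trans_le (levelFrac_anti D ha.le)
  · intro a ha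
    refine not_lt.2 (le_trans ?_ hq1.le)
    exact measureReal_mono fun u hu => lt_of_lt_of_le ha hu

lemma CrossFree.lt_of_levelFrac_eq_zero (h : CrossFree A D) (hD : Continuous D)
    (h0 : levelFrac D A = 0) (u : unitInterval) : D u < A := by
  have hle : ∀ u, D u ≤ A := by
    by_contra! hne
    have := unitInterval_volume_pos (isOpen_lt continuous_const hD) hne
    have h2 : volume.real {u | A < D u} ≤ levelFrac D A :=
      measureReal_mono fun u hu => LT.lt.le (α := ℝ) hu
    linarith
  refine lt_of_le_of_ne (hle u) fun hu => ?_
  refine h.1 0 le_rfl zero_lt_one (crossLevel_eq (fun a ha => ?_) fun a ha => ?_).symm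
  · have := unitInterval_volume_pos (isOpen_lt continuous_const hD) ⟨u, (ha.trans_eq hu.symm)⟩
    have h2 : volume.real {u | a < D u} ≤ levelFrac D a :=
      measureReal_mono fun u hu => LT.lt.le (α := ℝ) hu
    simpa using this.trans_le h2
  · rw [levelFrac_eq_zero fun v => (hle v).trans_lt ha]
    simp

lemma CrossFree.lt_of_levelFrac_eq_one (h : CrossFree A D) (hD : Continuous D)
    (h1 : levelFrac D A = 1) (u : unitInterval) : A < D u := by
  have key : ∀ a, (∃ u, D u < a) → levelFrac D a < 1 := by
    intro a hne
    have := unitInterval_volume_pos (isOpen_lt hD continuous_const) hne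
    have h2 : levelFrac D a + volume.real {u | D u < a} = 1 := by
      rw [levelFrac, ← measureReal_union]
      · have : {u | a ≤ D u} ∪ {u | D u < a} = Set.univ :=
          Set.eq_univ_of_forall fun u => le_or_gt a (D u)
        rw [this, probReal_univ]
      · exact Set.disjoint_left.2 fun u hu hu' => not_lt.2 (show a ≤ D u from hu) hu'
      · exact (isOpen_lt hD continuous_const).measurableSet
    linarith
  have hle : ∀ u, A ≤ D u := by
    by_contra! hne
    exact (key A hne).ne h1
  refine lt_of_le_of_ne (hle u) fun hu => ?_
  refine h.2 (crossLevel_eq (fun a ha => ?_) fun a ha => ?_).symm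
  · rw [levelFrac_eq_one fun v => ha.le.trans (hle v)]
    simp
  · exact not_le.2 (key a ⟨u, hu.symm.trans_lt ha⟩)

/-- A continuous function on `[0,1]` has no gap in its distribution: a level that is exceeded on a
set of measure `y`, `0 < y < 1`, is the `y`-quantile. -/
lemma crossLevel_levelFrac_eq (hD : Continuous D) (h0 : 0 < levelFrac D A)
    (h1 : levelFrac D A < 1) : crossLevel (Set.Ioi (levelFrac D A)) D = A := by
  refine crossLevel_eq (fun a ha => ?_) fun a ha => not_lt.2 (levelFrac_anti D ha.le)
  have hopen : IsOpen {u | a < D u ∧ D u < A} :=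
    (isOpen_lt continuous_const hD).inter (isOpen_lt hD continuous_const)
  have hne : {u | a < D u ∧ D u < A}.Nonempty := by
    -- otherwise, by connectedness, `D ≤ a` everywhere or `A ≤ D` everywhere
    have hlow : ∃ u, D u < A := by
      by_contra! hh
      exact h1.ne (levelFrac_eq_one hh)
    have hhigh : ∃ u, A ≤ D u := by
      by_contra! hh
      exact h0.ne' (levelFrac_eq_zero hh)
    obtain ⟨u, hu⟩ := hlow
    obtain ⟨v, hv⟩ := hhigh
    by_cases hau : a < D u
    · exact ⟨u, hau, hu⟩
    · obtain ⟨w, hw⟩ := mem_range_of_exists_le_of_exists_ge hD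
        (c := (a + A) / 2) ⟨u, by linarith⟩ ⟨v, by linarith⟩
      exact ⟨w, by rw [hw]; linarith, by rw [hw]; linarith⟩
  have hpos := unitInterval_volume_pos hopen hne
  have : levelFrac D A + volume.real {u | a < D u ∧ D u < A} ≤ levelFrac D a := by
    rw [levelFrac, ← measureReal_union _ hopen.measurableSet]
    · refine measureReal_mono ?_
      rintro u (hu | hu)
      · exact ha.le.trans hu
      · exact hu.1.le
    · exact Set.disjoint_left.2 fun u hu hu' => not_lt.2 hu hu'.2
  exact Set.mem_Ioi.2 (by linarith)

end crossLevel

/-! ### Limits of exceedance fractions -/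

lemma exceed_nonneg (N : ℕ) (a : ℝ) (d : ℕ → ℝ) : 0 ≤ exceed N a d := by
  unfold exceed
  exact mul_nonneg (by positivity) (Finset.sum_nonneg fun j _ => by split_ifs <;> norm_num)

lemma exceed_le_one (N : ℕ) (a : ℝ) (d : ℕ → ℝ) : exceed N a d ≤ 1 := by
  unfold exceed
  rcases Nat.eq_zero_or_pos N with rfl | hN
  · simp
  rw [inv_mul_le_iff₀ (by positivity), mul_one]
  refine (Finset.sum_le_sum (g := fun _ => (1 : ℝ)) fun j _ => by
    split_ifs <;> norm_num).trans ?_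
  simp

lemma exceed_mono {N : ℕ} {a a' : ℝ} {d d' : ℕ → ℝ} (h : ∀ j < N, a ≤ d j → a' ≤ d' j) :
    exceed N a d ≤ exceed N a' d' := by
  unfold exceed
  refine mul_le_mul_of_nonneg_left (Finset.sum_le_sum fun j hj => ?_) (by positivity)
  have := h j (Finset.mem_range.1 hj)
  split_ifs with h1 h2 <;> first | exact absurd (this h1) h2 | norm_num

lemma exceed_eq_one {N : ℕ} (hN : 0 < N) {a : ℝ} {d : ℕ → ℝ} (h : ∀ j < N, a ≤ d j) :
    exceed N a d = 1 := by
  unfold exceed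
  rw [Finset.sum_congr rfl fun j hj => if_pos (h j (Finset.mem_range.1 hj))]
  have : (N : ℝ) ≠ 0 := by positivity
  simp [this]

lemma exceed_eq_zero {N : ℕ} {a : ℝ} {d : ℕ → ℝ} (h : ∀ j < N, d j < a) :
    exceed N a d = 0 := by
  unfold exceed
  rw [Finset.sum_congr rfl fun j hj => if_neg (not_le.2 (h j (Finset.mem_range.1 hj)))]
  simp

lemma integral_floor_eq_sum {N : ℕ} (hN : 0 < N) (f : ℕ → ℝ) :
    ∫ u : unitInterval, f ⌊(N : ℝ) * (u : ℝ)⌋₊ = (N : ℝ)⁻¹ * ∑ j ∈ Finset.range N, f j := by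
  have hN' : (0 : ℝ) < N := by exact_mod_cast hN
  have hmeas : Measurable fun v : ℝ => f ⌊v⌋₊ := measurable_from_nat.comp Nat.measurable_floor
  have h1 : ∫ u : unitInterval, f ⌊(N : ℝ) * (u : ℝ)⌋₊ = ∫ u in (0 : ℝ)..1, f ⌊(N : ℝ) * u⌋₊ := by
    rw [intervalIntegral.integral_of_le zero_le_one, ← integral_Icc_eq_integral_Ioc]
    exact unitInterval.measurePreserving_coe.integral_comp unitInterval.measurableEmbedding_coe
      (fun u : ℝ => f ⌊(N : ℝ) * u⌋₊)
  have hpiece : ∀ j : ℕ, Set.EqOn (fun _ => f j) (fun v : ℝ => f ⌊v⌋₊)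
      (Set.Ioo (j : ℝ) ((j + 1 : ℕ) : ℝ)) := by
    intro j v hv
    have : ⌊v⌋₊ = j := by
      rw [Nat.floor_eq_iff (by linarith [hv.1, (Nat.cast_nonneg j : (0 : ℝ) ≤ j)])]
      exact ⟨hv.1.le, by simpa using hv.2⟩
    simp [this]
  have hint : ∀ j : ℕ, IntervalIntegrable (fun v : ℝ => f ⌊v⌋₊) volume (j : ℝ) ((j + 1 : ℕ) : ℝ) := by
    intro j
    have hle : (j : ℝ) ≤ ((j + 1 : ℕ) : ℝ) := by push_cast; linarith
    rw [intervalIntegrable_iff_integrableOn_Ioo_of_le hle]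
    exact (integrableOn_const (by simp)).congr_fun (hpiece j) measurableSet_Ioo
  have h2 : ∑ j ∈ Finset.range N, ∫ v in (j : ℝ)..((j + 1 : ℕ) : ℝ), f ⌊v⌋₊
      = ∫ v in ((0 : ℕ) : ℝ)..(N : ℝ), f ⌊v⌋₊ :=
    intervalIntegral.sum_integral_adjacent_intervals (a := fun j : ℕ => (j : ℝ)) fun j _ => hint j
  have h3 : ∀ j : ℕ, ∫ v in (j : ℝ)..((j + 1 : ℕ) : ℝ), f ⌊v⌋₊ = f j := by
    intro j
    have hle : (j : ℝ) ≤ ((j + 1 : ℕ) : ℝ) := by push_cast; linarith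
    rw [intervalIntegral.integral_of_le hle, integral_Ioc_eq_integral_Ioo,
      ← setIntegral_congr_fun measurableSet_Ioo (hpiece j)]
    simp
  rw [h1, intervalIntegral.integral_comp_mul_left (fun v => f ⌊v⌋₊) hN'.ne']
  simp only [h3] at h2
  rw [h2]
  simp

lemma exceed_eq_integral {N : ℕ} (hN : 0 < N) (a : ℝ) (d : ℕ → ℝ) :
    exceed N a d = ∫ u : unitInterval,
      open Classical in if a ≤ d ⌊(N : ℝ) * (u : ℝ)⌋₊ then (1 : ℝ) else 0 := by
  classical
  rw [integral_floor_eq_sum hN (fun j => if a ≤ d j then (1 : ℝ) else 0)]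
  simp only [exceed]

lemma levelFrac_eq_integral {D : unitInterval → ℝ} (hD : Continuous D) (a : ℝ) :
    levelFrac D a = ∫ u, open Classical in if a ≤ D u then (1 : ℝ) else 0 := by
  classical
  have hm : MeasurableSet {u | a ≤ D u} := (isClosed_le continuous_const hD).measurableSet
  rw [levelFrac, ← integral_indicator_one hm]
  congr 1

section limits

variable {A : ℝ} {D : unitInterval → ℝ} {N : ℕ → ℕ} {a : ℕ → ℝ} {d : ℕ → ℕ → ℝ}

/-- If the level `A` is not attained on a set of positive measure, exceedance fractions of
discretizations converge to the measure of the superlevel set. -/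
lemma CrossFree.tendsto_exceed (h : CrossFree A D) (hD : Continuous D) (hN : ∀ i, 0 < N i)
    (ha : Tendsto a atTop (𝓝 A))
    (hd : ∀ ε > 0, ∀ᶠ i in atTop, ∀ u : unitInterval, u < 1 →
      |d i ⌊(N i : ℝ) * (u : ℝ)⌋₊ - D u| ≤ ε) :
    Tendsto (fun i => exceed (N i) (a i) (d i)) atTop (𝓝 (levelFrac D A)) := by
  classical
  simp only [exceed_eq_integral (hN _), levelFrac_eq_integral hD]
  refine tendsto_integral_of_dominated_convergence (fun _ => 1) (fun i => ?_)
    (integrable_const _) (fun i => ?_) ?_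
  · have : Measurable fun u : unitInterval =>
        if a i ≤ d i ⌊(N i : ℝ) * (u : ℝ)⌋₊ then (1 : ℝ) else 0 :=
      (measurable_from_nat (f := fun j => if a i ≤ d i j then (1 : ℝ) else 0)).comp
        (Nat.measurable_floor.comp (measurable_subtype_coe.const_mul _))
    exact this.aestronglyMeasurable
  · filter_upwards with u
    split_ifs <;> simp
  · have h1 : ∀ᵐ u : unitInterval, u ≠ 1 := by
      simp [ae_iff]
    have h2 : ∀ᵐ u : unitInterval, D u ≠ A := by
      rw [ae_iff]
      simpa using h.volume_eq hD
    filter_upwards [h1, h2] with u hu1 huA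
    have hu : u < 1 := lt_of_le_of_ne unitInterval.le_one' hu1
    have hdu : Tendsto (fun i => d i ⌊(N i : ℝ) * (u : ℝ)⌋₊) atTop (𝓝 (D u)) := by
      rw [Metric.tendsto_nhds]
      intro ε hε
      filter_upwards [hd (ε / 2) (half_pos hε)] with i hi
      rw [Real.dist_eq]
      exact (hi u hu).trans_lt (half_lt_self hε)
    refine tendsto_const_nhds.congr' ?_
    rcases lt_or_gt_of_ne huA with hlt | hgt
    · filter_upwards [hdu.eventually_lt ha hlt] with i hi
      rw [if_neg (not_le.2 hi), if_neg (not_le.2 hlt)]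
    · filter_upwards [ha.eventually_lt hdu hgt] with i hi
      rw [if_pos hi.le, if_pos hgt.le]

lemma exists_unitInterval_floor {N j : ℕ} (hj : j < N) :
    ∃ u : unitInterval, u < 1 ∧ ⌊(N : ℝ) * (u : ℝ)⌋₊ = j := by
  have hN : (0 : ℝ) < N := by exact_mod_cast (Nat.zero_le j).trans_lt hj
  have hj' : (j : ℝ) < N := by exact_mod_cast hj
  refine ⟨⟨j / N, by positivity, (div_le_one hN).2 hj'.le⟩, ?_, ?_⟩
  · rw [← Subtype.coe_lt_coe]
    exact (div_lt_one hN).2 hj'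
  · simp only
    rw [mul_div_cancel₀ _ hN.ne', Nat.floor_natCast]

/-- At the boundary values `0` and `1` the exceedance fractions are eventually equal to their
limit. -/
lemma CrossFree.eventually_exceed_eq (h : CrossFree A D) (hD : Continuous D) (hN : ∀ i, 0 < N i)
    (ha : Tendsto a atTop (𝓝 A))
    (hd : ∀ ε > 0, ∀ᶠ i in atTop, ∀ u : unitInterval, u < 1 →
      |d i ⌊(N i : ℝ) * (u : ℝ)⌋₊ - D u| ≤ ε)
    (h01 : levelFrac D A = 0 ∨ levelFrac D A = 1) :
    ∀ᶠ i in atTop, exceed (N i) (a i) (d i) = levelFrac D A := by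
  rcases h01 with h0 | h1
  · obtain ⟨u₀, hu₀⟩ := isCompact_univ.exists_isMaxOn (Set.univ_nonempty) hD.continuousOn
    have hlt := h.lt_of_levelFrac_eq_zero hD h0 u₀
    have hε : 0 < (A - D u₀) / 3 := by linarith
    filter_upwards [hd _ hε, ha.eventually (lt_mem_nhds (show A - (A - D u₀) / 3 < A by linarith))]
      with i hi hai
    rw [h0]
    refine exceed_eq_zero fun j hj => ?_
    obtain ⟨u, hu1, hu⟩ := exists_unitInterval_floor hj
    have h3 := abs_le.1 (hi u hu1)
    rw [hu] at h3
    have h4 : D u ≤ D u₀ := hu₀.2 (Set.mem_univ u)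
    linarith [h3.2]
  · obtain ⟨u₀, hu₀⟩ := isCompact_univ.exists_isMinOn (Set.univ_nonempty) hD.continuousOn
    have hlt := h.lt_of_levelFrac_eq_one hD h1 u₀
    have hε : 0 < (D u₀ - A) / 3 := by linarith
    filter_upwards [hd _ hε, ha.eventually (gt_mem_nhds (show A < A + (D u₀ - A) / 3 by linarith))]
      with i hi hai
    rw [h1]
    refine exceed_eq_one (hN i) fun j hj => ?_
    obtain ⟨u, hu1, hu⟩ := exists_unitInterval_floor hj
    have h3 := abs_le.1 (hi u hu1)
    rw [hu] at h3
    have h4 : D u₀ ≤ D u := hu₀.2 (Set.mem_univ u)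
    linarith [h3.1]

/-- If all the exceedance fractions are in `B`, then so is their limit, provided it is not an
interior point of `[0,1]` in the frontier of `B`. -/
lemma CrossFree.levelFrac_mem (h : CrossFree A D) (hD : Continuous D) (hN : ∀ i, 0 < N i)
    (ha : Tendsto a atTop (𝓝 A))
    (hd : ∀ ε > 0, ∀ᶠ i in atTop, ∀ u : unitInterval, u < 1 →
      |d i ⌊(N i : ℝ) * (u : ℝ)⌋₊ - D u| ≤ ε)
    {B : Set ℝ} (hB : ∀ i, exceed (N i) (a i) (d i) ∈ B)
    (hfr : levelFrac D A ∈ Set.Ioo (0 : ℝ) 1 → levelFrac D A ∉ frontier B) :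
    levelFrac D A ∈ B := by
  by_cases hmem : levelFrac D A ∈ Set.Ioo (0 : ℝ) 1
  · have hcl : levelFrac D A ∈ closure B :=
      mem_closure_of_tendsto (h.tendsto_exceed hD hN ha hd) (Eventually.of_forall hB)
    by_contra hnB
    exact hfr hmem ⟨hcl, fun hi => hnB (interior_subset hi)⟩
  · have h01 : levelFrac D A = 0 ∨ levelFrac D A = 1 := by
      rw [Set.mem_Ioo, not_and_or, not_lt, not_lt] at hmem
      exact hmem.imp (fun h => le_antisymm h (levelFrac_nonneg _ _))
        fun h => le_antisymm (levelFrac_le_one _ _) h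
    obtain ⟨i, hi⟩ := (h.eventually_exceed_eq hD hN ha hd h01).exists
    exact hi ▸ hB i

end limits

/-! ### Functionals that are Lipschitz for the uniform distance -/

section functionals

variable {V : Type*} [PseudoMetricSpace V]

/-- Lipschitz continuity, for the uniform distance, of a functional of bounded paths. -/
def SupLipschitz (Ψ : (unitInterval → V) → ℝ) : Prop :=
  ∃ K : ℝ, ∀ x y : unitInterval → V, Bornology.IsBounded (Set.range x) →
    Bornology.IsBounded (Set.range y) → ∀ ε ≥ 0, (∀ t, dist (x t) (y t) ≤ ε) →
      |Ψ x - Ψ y| ≤ K * ε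

lemma SupLipschitz.continuous_comp {Ψ : (unitInterval → V) → ℝ} (hΨ : SupLipschitz Ψ) {ι : Type*}
    [Fintype ι] (c : unitInterval → ι) : Continuous fun y : ι → V => Ψ fun t => y (c t) := by
  obtain ⟨K, hK⟩ := hΨ
  have hb : ∀ y : ι → V, Bornology.IsBounded (Set.range fun t => y (c t)) := fun y =>
    (Set.finite_range y).isBounded.subset (Set.range_comp_subset_range c y)
  refine (LipschitzWith.of_dist_le_mul (K := K.toNNReal) fun y y' => ?_).continuous
  rw [Real.dist_eq]
  refine (hK _ _ (hb y) (hb y') (dist y y') dist_nonneg fun t => dist_le_pi_dist y y' (c t)).trans ?_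
  gcongr
  exact Real.le_coe_toNNReal K

/-- The index `⌊n t⌋` of the grid cell of `t`. -/
def gridIndex (n : ℕ) (t : unitInterval) : Fin (n + 1) :=
  ⟨⌊(n : ℝ) * (t : ℝ)⌋₊, by
    refine Nat.lt_succ_of_le (Nat.floor_le_of_le ?_)
    exact mul_le_of_le_one_right (Nat.cast_nonneg n) t.2.2⟩

/-- The grid point `i / n` in `[0,1]`. -/
def gridPoint (n : ℕ) (i : Fin (n + 1)) : unitInterval :=
  Set.projIcc 0 1 zero_le_one ((i : ℝ) / n)

lemma abs_gridPoint_sub_le {n : ℕ} (hn : 0 < n) (t : unitInterval) :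
    |(gridPoint n (gridIndex n t) : ℝ) - t| ≤ 1 / n := by
  have hn' : (0 : ℝ) < n := by exact_mod_cast hn
  have hnt : 0 ≤ (n : ℝ) * t := mul_nonneg hn'.le t.2.1
  have h1 : ((⌊(n : ℝ) * (t : ℝ)⌋₊ : ℝ)) / n ≤ t := by
    rw [div_le_iff₀' hn']
    exact Nat.floor_le hnt
  have h2 : (t : ℝ) < (⌊(n : ℝ) * (t : ℝ)⌋₊ : ℝ) / n + 1 / n := by
    rw [← add_div, lt_div_iff₀' hn']
    exact Nat.lt_floor_add_one _
  have h3 : (gridPoint n (gridIndex n t) : ℝ) = (⌊(n : ℝ) * (t : ℝ)⌋₊ : ℝ) / n := by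
    have hmem : (⌊(n : ℝ) * (t : ℝ)⌋₊ : ℝ) / n ∈ Set.Icc (0 : ℝ) 1 :=
      ⟨by positivity, h1.trans t.2.2⟩
    exact congrArg Subtype.val (Set.projIcc_of_mem zero_le_one hmem)
  rw [h3, abs_le]
  constructor <;> linarith

/-- On continuous paths, a Lipschitz functional is the limit of its values at step functions, hence
a measurable function of countably many coordinates. -/
lemma SupLipschitz.exists_measurable [MeasurableSpace V] [BorelSpace V] [SecondCountableTopology V]
    {Ψ : (unitInterval → V) → ℝ} (hΨ : SupLipschitz Ψ) :
    ∃ Ψ' : ((Σ n, Fin (n + 1)) → V) → ℝ, Measurable Ψ' ∧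
      ∀ x : unitInterval → V, Continuous x → Ψ' (fun i => x (gridPoint i.1 i.2)) = Ψ x := by
  let Φ : ℕ → ((Σ n, Fin (n + 1)) → V) → ℝ := fun n z => Ψ fun t => z ⟨n, gridIndex n t⟩
  have hΦ : ∀ n, Measurable (Φ n) := by
    intro n
    have h1 : Measurable fun (z : (Σ n, Fin (n + 1)) → V) (i : Fin (n + 1)) => z ⟨n, i⟩ := by
      fun_prop
    exact (hΨ.continuous_comp (gridIndex n)).measurable.comp h1
  refine ⟨fun x => limsup (fun n => Φ n x) atTop, .limsup hΦ, fun x hx => ?_⟩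
  let z : (Σ n, Fin (n + 1)) → V := fun i => x (gridPoint i.1 i.2)
  refine Tendsto.limsup_eq ?_
  obtain ⟨K, hK⟩ := hΨ
  have hbd : Bornology.IsBounded (Set.range x) := (isCompact_range hx).isBounded
  have huc : UniformContinuous x := CompactSpace.uniformContinuous_of_continuous hx
  rw [Metric.tendsto_nhds]
  intro ε hε
  have hK0 : 0 < |K| + 1 := by positivity
  obtain ⟨δ, hδ, hδε⟩ := Metric.uniformContinuous_iff.1 huc (ε / (|K| + 1)) (by positivity)
  obtain ⟨n₀, hn₀⟩ := exists_nat_one_div_lt hδ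
  filter_upwards [eventually_ge_atTop (n₀ + 1)] with n hn
  have hgrid : ∀ t, dist (x (gridPoint n (gridIndex n t))) (x t) ≤ ε / (|K| + 1) := by
    intro t
    refine (hδε ?_).le
    rw [Subtype.dist_eq, Real.dist_eq]
    refine (abs_gridPoint_sub_le (by omega) t).trans_lt (lt_of_le_of_lt ?_ hn₀)
    refine one_div_le_one_div_of_le (by positivity) ?_
    exact_mod_cast hn
  have h := hK _ x (hbd.subset (Set.range_comp_subset_range
    (fun t => gridPoint n (gridIndex n t)) x)) hbd _ (by positivity) hgrid
  rw [Real.dist_eq]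
  calc |Φ n z - Ψ x| ≤ K * (ε / (|K| + 1)) := h
    _ ≤ |K| * (ε / (|K| + 1)) := by gcongr; exact le_abs_self K
    _ < (|K| + 1) * (ε / (|K| + 1)) := by gcongr; linarith
    _ = ε := by field_simp

lemma SupLipschitz.aemeasurable [MeasurableSpace V] [BorelSpace V] [SecondCountableTopology V]
    {Ψ : (unitInterval → V) → ℝ} (hΨ : SupLipschitz Ψ) {Ω' : Type*} [MeasurableSpace Ω']
    {P' : Measure Ω'} {Z' : Ω' → unitInterval → V} (hZ' : ∀ t, AEMeasurable (fun ω' => Z' ω' t) P')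
    (hcont : ∀ᵐ ω' ∂P', Continuous (Z' ω')) : AEMeasurable (fun ω' => Ψ (Z' ω')) P' := by
  obtain ⟨Ψ', hΨ', heq⟩ := hΨ.exists_measurable
  exact (hΨ'.comp_aemeasurable (aemeasurable_pi_lambda _ fun i => hZ' _)).congr
    (hcont.mono fun ω' h => heq _ h)

end functionals

/-! ### The Skorokhod distance to a set of paths, and a portmanteau inequality -/

section portmanteau

variable {V : Type*} [PseudoMetricSpace V]

/-- The distance of the path `s` to the set `C`, truncated at `1`, for the Skorokhod distance
`inf {ε : ∃ τ, ‖τ - id‖ ≤ ε, ‖x ∘ τ - y‖ ≤ ε}`. -/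
def skorDist (C : Set (unitInterval → V)) (s : unitInterval → V) : ℝ :=
  sInf (insert 1 {ε : ℝ | 0 ≤ ε ∧ ∃ y ∈ C, ∃ τ : unitInterval ≃o unitInterval,
    (∀ t, dist (τ t) t ≤ ε) ∧ ∀ t, dist (s (τ t)) (y t) ≤ ε})

variable {C C' : Set (unitInterval → V)} {x y s : unitInterval → V} {δ ε : ℝ}

lemma skorDist_set_nonneg : ∀ r ∈ insert (1 : ℝ) {ε : ℝ | 0 ≤ ε ∧ ∃ y ∈ C,
    ∃ τ : unitInterval ≃o unitInterval,
      (∀ t, dist (τ t) t ≤ ε) ∧ ∀ t, dist (s (τ t)) (y t) ≤ ε}, 0 ≤ r := by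
  rintro r (rfl | hr)
  · exact zero_le_one
  · exact hr.1

lemma skorDist_nonneg (C : Set (unitInterval → V)) (s : unitInterval → V) : 0 ≤ skorDist C s :=
  Real.sInf_nonneg skorDist_set_nonneg

lemma skorDist_le_one (C : Set (unitInterval → V)) (s : unitInterval → V) : skorDist C s ≤ 1 :=
  csInf_le ⟨0, skorDist_set_nonneg⟩ (Set.mem_insert _ _)

lemma skorDist_le (hε : 0 ≤ ε) (hy : y ∈ C) (τ : unitInterval ≃o unitInterval)
    (hτ : ∀ t, dist (τ t) t ≤ ε) (h : ∀ t, dist (s (τ t)) (y t) ≤ ε) : skorDist C s ≤ ε :=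
  csInf_le ⟨0, skorDist_set_nonneg⟩ (Set.mem_insert_of_mem _ ⟨hε, y, hy, τ, hτ, h⟩)

lemma skorDist_eq_zero (hs : s ∈ C) : skorDist C s = 0 :=
  le_antisymm (skorDist_le le_rfl hs (OrderIso.refl _) (by simp) (by simp)) (skorDist_nonneg _ _)

lemma exists_of_skorDist_lt (hδ : δ ≤ 1) (h : skorDist C s < δ) : ∃ ε < δ, ∃ y ∈ C,
    ∃ τ : unitInterval ≃o unitInterval,
      (∀ t, dist (τ t) t ≤ ε) ∧ ∀ t, dist (s (τ t)) (y t) ≤ ε := by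
  obtain ⟨r, hr, hrδ⟩ := exists_lt_of_csInf_lt ⟨1, Set.mem_insert _ _⟩ h
  rcases hr with rfl | ⟨-, hr⟩
  · exact absurd hrδ (not_lt.2 hδ)
  · exact ⟨r, hrδ, hr⟩

lemma skorDist_anti (h : C ⊆ C') : skorDist C' s ≤ skorDist C s := by
  refine csInf_le_csInf ⟨0, skorDist_set_nonneg⟩ ⟨1, Set.mem_insert _ _⟩ ?_
  rintro r (rfl | ⟨h0, y, hy, hr⟩)
  · exact Set.mem_insert _ _
  · exact Set.mem_insert_of_mem _ ⟨h0, y, h hy, hr⟩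

lemma skorDist_le_add (hδ : 0 ≤ δ) (σ : unitInterval ≃o unitInterval)
    (hσ : ∀ t, dist (σ t) t ≤ δ) (h : ∀ t, dist (x (σ t)) (y t) ≤ δ) :
    skorDist C x ≤ skorDist C y + δ := by
  rw [← sub_le_iff_le_add]
  refine le_csInf ⟨1, Set.mem_insert _ _⟩ ?_
  rintro r (rfl | ⟨h0, z, hz, τ, hτ, hr⟩)
  · linarith [skorDist_le_one C x]
  · rw [sub_le_iff_le_add]
    refine skorDist_le (by positivity) hz (τ.trans σ) (fun t => ?_) fun t => ?_
    · calc dist (σ (τ t)) t ≤ dist (σ (τ t)) (τ t) + dist (τ t) t := dist_triangle _ _ _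
        _ ≤ r + δ := by linarith [hσ (τ t), hτ t]
    · calc dist (x (σ (τ t))) (z t) ≤ dist (x (σ (τ t))) (y (τ t)) + dist (y (τ t)) (z t) :=
          dist_triangle _ _ _
        _ ≤ r + δ := by linarith [h (τ t), hr t]

lemma abs_skorDist_sub_le (hδ : 0 ≤ δ) (σ : unitInterval ≃o unitInterval)
    (hσ : ∀ t, dist (σ t) t ≤ δ) (h : ∀ t, dist (x (σ t)) (y t) ≤ δ) :
    |skorDist C x - skorDist C y| ≤ δ := by
  have h1 := skorDist_le_add (C := C) hδ σ hσ h
  have h2 : skorDist C y ≤ skorDist C x + δ := by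
    refine skorDist_le_add hδ σ.symm (fun t => ?_) fun t => ?_
    · simpa [dist_comm] using hσ (σ.symm t)
    · simpa [dist_comm] using h (σ.symm t)
  rw [abs_le]
  constructor <;> linarith

lemma skorDist_supLipschitz (C : Set (unitInterval → V)) : SupLipschitz (skorDist C) :=
  ⟨1, fun x y _ _ ε hε h => by
    rw [one_mul]
    exact abs_skorDist_sub_le hε (OrderIso.refl _) (by simpa using hε) h⟩

lemma skorDist_skorokhodContinuous (C : Set (unitInterval → V)) :
    SkorokhodContinuous (skorDist C) := by
  rintro x y - - ⟨τ, hτ, hx⟩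
  rw [Metric.tendsto_nhds]
  intro ε hε
  rw [Metric.tendstoUniformly_iff] at hτ hx
  filter_upwards [hτ (ε / 2) (half_pos hε), hx (ε / 2) (half_pos hε)] with m h1 h2
  rw [Real.dist_eq]
  refine (abs_skorDist_sub_le (half_pos hε).le (τ m) (fun t => ?_) fun t => ?_).trans_lt
    (half_lt_self hε)
  · rw [dist_comm]; exact (h1 t).le
  · rw [dist_comm]; exact (h2 t).le

/-- At a continuous path, the Skorokhod closure and the uniform closure of a set agree. -/
lemma exists_dist_le_of_skorDist_eq_zero (hs : Continuous s) (h : skorDist C s = 0) (hε : 0 < ε) :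
    ∃ y ∈ C, ∀ t, dist (y t) (s t) ≤ ε := by
  have huc : UniformContinuous s := CompactSpace.uniformContinuous_of_continuous hs
  obtain ⟨δ, hδ, hδε⟩ := Metric.uniformContinuous_iff.1 huc (ε / 2) (by positivity)
  have hlt : skorDist C s < min 1 (min δ (ε / 2)) := by
    rw [h]; positivity
  obtain ⟨r, hr, y, hy, τ, hτ, hd⟩ := exists_of_skorDist_lt (min_le_left _ _) hlt
  refine ⟨y, hy, fun t => ?_⟩
  have hr1 : r < δ := hr.trans_le ((min_le_right _ _).trans (min_le_left _ _))
  have hr2 : r < ε / 2 := hr.trans_le ((min_le_right _ _).trans (min_le_right _ _))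
  have h1 : dist (s (τ t)) (s t) < ε / 2 := hδε ((hτ t).trans_lt hr1)
  have h2 := hd t
  rw [dist_comm] at h2
  linarith [dist_triangle (y t) (s (τ t)) (s t)]

/-- **Portmanteau inequality** for sets `C n` that vary with `n`. If the events `E n` force the
path `Z (m n)` to be in `C n`, then `limsup P(E n)` is at most the probability that `Z'` is a
uniform limit of paths from infinitely many of the sets `C n`. -/
theorem eventually_measureReal_le {Ω Ω' : Type*} [MeasurableSpace Ω] [MeasurableSpace Ω']
    {P : Measure Ω} [IsProbabilityMeasure P] {P' : Measure Ω'} [IsProbabilityMeasure P']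
    [MeasurableSpace V] [BorelSpace V] [SecondCountableTopology V]
    {Z : ℕ → Ω → unitInterval → V} {Z' : Ω' → unitInterval → V}
    (hZZ' : SkorokhodWeakConv P Z P' Z')
    (hZ : ∀ Ψ : (unitInterval → V) → ℝ, SupLipschitz Ψ → ∀ n, AEMeasurable (fun ω => Ψ (Z n ω)) P)
    (hZ' : ∀ t, AEMeasurable (fun ω' => Z' ω' t) P') (hcont : ∀ᵐ ω' ∂P', Continuous (Z' ω'))
    {m : ℕ → ℕ} (hm : Tendsto m atTop atTop) {C : ℕ → Set (unitInterval → V)} {E : ℕ → Set Ω}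
    (hE : ∀ n, ∀ ω ∈ E n, Z (m n) ω ∈ C n) {H : Set Ω'}
    (hH : ∀ᵐ ω' ∂P', (∀ ε > 0, ∀ n₀, ∃ n ≥ n₀, ∃ s ∈ C n, ∀ t, dist (s t) (Z' ω' t) ≤ ε) →
      ω' ∈ H) {ε : ℝ} (hε : 0 < ε) :
    ∀ᶠ n in atTop, P.real (E n) ≤ P'.real H + ε := by
  classical
  let U : ℕ → Set (unitInterval → V) := fun j => ⋃ n ≥ j, C n
  let f : ℕ → (unitInterval → V) → ℝ := fun j s => (1 - skorDist (U j) s) ^ j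
  have hf0 : ∀ j s, 0 ≤ f j s := fun j s =>
    pow_nonneg (by linarith [skorDist_le_one (U j) s]) j
  have hf1 : ∀ j s, f j s ≤ 1 := fun j s =>
    pow_le_one₀ (by linarith [skorDist_le_one (U j) s]) (by linarith [skorDist_nonneg (U j) s])
  have hfZ' : ∀ j, AEMeasurable (fun ω' => f j (Z' ω')) P' := by
    intro j
    exact (((skorDist_supLipschitz (U j)).aemeasurable hZ' hcont).const_sub 1).pow_const j
  let Λ : Set Ω' := {ω' | ∀ j, skorDist (U j) (Z' ω') = 0}
  have hlim : ∀ ω', Tendsto (fun j => f j (Z' ω')) atTop (𝓝 (Λ.indicator (fun _ => 1) ω')) := by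
    intro ω'
    by_cases hω : ω' ∈ Λ
    · rw [Set.indicator_of_mem hω]
      refine tendsto_const_nhds.congr fun j => ?_
      simp [f, hω j]
    · rw [Set.indicator_of_notMem hω]
      obtain ⟨j₀, hj₀⟩ := not_forall.1 hω
      have hpos : 0 < skorDist (U j₀) (Z' ω') := lt_of_le_of_ne (skorDist_nonneg _ _) (Ne.symm hj₀)
      refine tendsto_of_tendsto_of_tendsto_of_le_of_le' tendsto_const_nhds
        (tendsto_pow_atTop_nhds_zero_of_lt_one (r := 1 - skorDist (U j₀) (Z' ω'))
          (by linarith [skorDist_le_one (U j₀) (Z' ω')]) (by linarith))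
        (Eventually.of_forall fun j => hf0 j _) ?_
      filter_upwards [eventually_ge_atTop j₀] with j hj
      have hsub : U j ⊆ U j₀ := Set.biUnion_mono (fun n hn => hj.trans hn) fun _ _ => subset_rfl
      have := skorDist_anti (s := Z' ω') hsub
      exact pow_le_pow_left₀ (by linarith [skorDist_le_one (U j) (Z' ω')]) (by linarith) j
  have hΛmeas : AEMeasurable (Λ.indicator fun _ => (1 : ℝ)) P' :=
    aemeasurable_of_tendsto_metrizable_ae atTop hfZ' (Eventually.of_forall hlim)
  have hΛnull : NullMeasurableSet Λ P' := by
    have h1 := hΛmeas.nullMeasurableSet_preimage (measurableSet_singleton (1 : ℝ))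
    convert h1 using 1
    ext ω'
    by_cases hω : ω' ∈ Λ <;> simp [hω]
  have hint : Tendsto (fun j => ∫ ω', f j (Z' ω') ∂P') atTop (𝓝 (P'.real Λ)) := by
    have h1 : ∫ ω', Λ.indicator (fun _ => (1 : ℝ)) ω' ∂P' = P'.real Λ := by
      rw [integral_indicator₀ hΛnull]
      simp
    rw [← h1]
    refine tendsto_integral_of_dominated_convergence (fun _ => 1)
      (fun j => (hfZ' j).aestronglyMeasurable) (integrable_const _)
      (fun j => Eventually.of_forall fun ω' => ?_) (Eventually.of_forall hlim)
    rw [Real.norm_of_nonneg (hf0 j _)]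
    exact hf1 j _
  have hΛH : P'.real Λ ≤ P'.real H := by
    refine ENNReal.toReal_mono (measure_ne_top _ _) (measure_mono_ae ?_)
    filter_upwards [hH, hcont] with ω' h1 h2 hω
    refine h1 fun ε hε n₀ => ?_
    obtain ⟨s, hs, hd⟩ := exists_dist_le_of_skorDist_eq_zero h2 (hω n₀) hε
    obtain ⟨n, hn, hsn⟩ := Set.mem_iUnion₂.1 hs
    exact ⟨n, hn, s, hsn, hd⟩
  obtain ⟨j, hj⟩ := (hint.eventually (gt_mem_nhds (show P'.real Λ < P'.real H + ε by linarith))).exists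
  have hfcont : SkorokhodContinuous (f j) := fun x y hx hy hxy =>
    ((skorDist_skorokhodContinuous (U j) x y hx hy hxy).const_sub 1).pow j
  have hconv := (hZZ' (f j) ⟨1, fun s => by rw [abs_of_nonneg (hf0 j s)]; exact hf1 j s⟩
    hfcont).comp hm
  filter_upwards [hconv.eventually (gt_mem_nhds hj), eventually_ge_atTop j] with n hn hnj
  refine le_trans ?_ hn.le
  have hfm : AEMeasurable (fun ω => f j (Z (m n) ω)) P :=
    ((hZ _ (skorDist_supLipschitz (U j)) (m n)).const_sub 1).pow_const j
  have hfi : Integrable (fun ω => f j (Z (m n) ω)) P :=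
    Integrable.of_bound hfm.aestronglyMeasurable 1 (Eventually.of_forall fun ω => by
      rw [Real.norm_of_nonneg (hf0 j _)]; exact hf1 j _)
  have hmarkov := mul_meas_ge_le_integral_of_nonneg
    (Eventually.of_forall fun ω => hf0 j (Z (m n) ω)) hfi 1
  rw [one_mul] at hmarkov
  refine le_trans (measureReal_mono fun ω hω => ?_) hmarkov
  have hmem : Z (m n) ω ∈ U j := Set.mem_biUnion (show n ≥ j from hnj) (hE n ω hω)
  simp [f, skorDist_eq_zero hmem]

end portmanteau

/-! ### Seminorms on `ℝ^k` -/

section seminorm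

variable {k : ℕ} (ν : Seminorm ℝ (Fin k → ℝ))

lemma seminorm_bound : ∃ K > 0, ∀ v, ν v ≤ K * ‖v‖ := by
  refine ⟨∑ i, ν (Pi.single i 1) + 1, by positivity, fun v => ?_⟩
  have h1 : v = ∑ i, v i • (Pi.single i (1 : ℝ) : Fin k → ℝ) := by
    ext j
    simp [Finset.sum_apply, Pi.single_apply]
  have h2 : ν v ≤ ∑ i, ν (v i • (Pi.single i (1 : ℝ) : Fin k → ℝ)) := by
    conv_lhs => rw [h1]
    exact Finset.le_sum_of_subadditive ν (map_zero ν).le (map_add_le_add ν) _ _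
  refine h2.trans ?_
  rw [add_mul, Finset.sum_mul]
  refine le_add_of_le_of_nonneg (Finset.sum_le_sum fun i _ => ?_) (by positivity)
  rw [map_smul_eq_mul, mul_comm]
  gcongr
  exact norm_le_pi_norm v i

lemma abs_seminorm_sub_le {K : ℝ} (hK : ∀ v, ν v ≤ K * ‖v‖) (v w : Fin k → ℝ) :
    |ν v - ν w| ≤ K * ‖v - w‖ :=
  (abs_sub_map_le_sub ν v w).trans (hK _)

lemma seminorm_continuous : Continuous ν := by
  obtain ⟨K, hK0, hK⟩ := seminorm_bound ν
  refine (LipschitzWith.of_dist_le_mul (K := K.toNNReal) fun v w => ?_).continuous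
  rw [Real.dist_eq, dist_eq_norm, Real.coe_toNNReal K hK0.le]
  exact abs_seminorm_sub_le ν hK v w

/-- Spheres of a norm are Lebesgue null sets. -/
lemma volume_seminorm_sphere (hk : 1 ≤ k) (hν : ∀ v, ν v = 0 → v = 0) (c : ℝ) :
    volume {v | ν v = c} = 0 := by
  have : Nonempty (Fin k) := ⟨⟨0, hk⟩⟩
  rcases lt_trichotomy c 0 with hc | rfl | hc
  · have : {v | ν v = c} = ∅ :=
      Set.eq_empty_of_forall_notMem fun v hv => by
        have h1 : ν v = c := hv
        linarith [apply_nonneg ν v]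
    simp [this]
  · refine measure_mono_null (t := {0}) (fun v hv => hν v hv) (measure_singleton _)
  · refine measure_mono_null ?_ ((ν.convex_closedBall 0 c).addHaar_frontier volume)
    intro v hv
    have hv : ν v = c := hv
    refine ⟨subset_closure (by simp [Seminorm.mem_closedBall, hv]), fun hint => ?_⟩
    have hlim : Tendsto (fun r : ℝ => r • v) (𝓝[>] 1) (𝓝 v) := by
      have : Tendsto (fun r : ℝ => r • v) (𝓝 1) (𝓝 ((1 : ℝ) • v)) :=
        (continuous_id.smul continuous_const).tendsto 1
      rw [one_smul] at this
      exact this.mono_left nhdsWithin_le_nhds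
    have hev := hlim.eventually (mem_interior_iff_mem_nhds.1 hint)
    obtain ⟨r, hr, hr1⟩ := (hev.and self_mem_nhdsWithin).exists
    have hr1 : 1 < r := hr1
    have hr : ν (r • v - 0) ≤ c := hr
    rw [sub_zero, map_smul_eq_mul, hv,
      Real.norm_of_nonneg (by linarith)] at hr
    nlinarith

end seminorm

/-! ### The path statistic -/

section pathStat

variable {k : ℕ} (ν : Seminorm ℝ (Fin k → ℝ)) (b : ℝ)

/-- The left end point `(1 - b) u` of the window with index `u ∈ [0,1]`. -/
def winLeft (u : unitInterval) : unitInterval := Set.projIcc 0 1 zero_le_one ((1 - b) * u)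

/-- The right end point `b + (1 - b) u` of the window with index `u ∈ [0,1]`. -/
def winRight (u : unitInterval) : unitInterval := Set.projIcc 0 1 zero_le_one (b + (1 - b) * u)

/-- The process `u ↦ ‖x(b + t) - x(t) - b x(1)‖ / √b`, `t = (1 - b) u`, of a path `x`. The windows
are indexed by `[0,1]`, so that `b = 1` needs no special treatment. -/
def pathStat (x : unitInterval → Fin k → ℝ) (u : unitInterval) : ℝ :=
  ν (x (winRight b u) - x (winLeft b u) - b • x 1) / √b

variable {b}

lemma coe_winLeft (hb0 : 0 < b) (hb1 : b ≤ 1) (u : unitInterval) :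
    (winLeft b u : ℝ) = (1 - b) * u := by
  have h1 : (1 - b) * (u : ℝ) ≤ 1 - b := mul_le_of_le_one_right (by linarith) u.2.2
  exact congrArg Subtype.val (Set.projIcc_of_mem zero_le_one
    (⟨mul_nonneg (by linarith) u.2.1, by linarith⟩ : (1 - b) * (u : ℝ) ∈ Set.Icc (0 : ℝ) 1))

lemma coe_winRight (hb0 : 0 < b) (hb1 : b ≤ 1) (u : unitInterval) :
    (winRight b u : ℝ) = b + (1 - b) * u := by
  have h1 : (1 - b) * (u : ℝ) ≤ 1 - b := mul_le_of_le_one_right (by linarith) u.2.2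
  have h2 : 0 ≤ (1 - b) * (u : ℝ) := mul_nonneg (by linarith) u.2.1
  exact congrArg Subtype.val (Set.projIcc_of_mem zero_le_one
    (⟨by linarith, by linarith⟩ : b + (1 - b) * (u : ℝ) ∈ Set.Icc (0 : ℝ) 1))

lemma continuous_pathStat {x : unitInterval → Fin k → ℝ} (hx : Continuous x) :
    Continuous (pathStat ν b x) := by
  have h1 : Continuous (winLeft b) := continuous_projIcc.comp (by fun_prop)
  have h2 : Continuous (winRight b) := continuous_projIcc.comp (by fun_prop)
  exact ((seminorm_continuous ν).comp
    (((hx.comp h2).sub (hx.comp h1)).sub continuous_const)).div_const _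

/-- The path statistic depends only on the bridge `x(r) - r x(1)`. -/
lemma pathStat_bridge (hb0 : 0 < b) (hb1 : b ≤ 1) (x : unitInterval → Fin k → ℝ) :
    pathStat ν b (fun r => x r - (r : ℝ) • x 1) = pathStat ν b x := by
  ext u
  simp only [pathStat, coe_winLeft hb0 hb1, coe_winRight hb0 hb1]
  congr 2
  simp only [Set.Icc.coe_one, one_smul, sub_self, smul_zero]
  module

lemma abs_pathStat_sub_le (hb0 : 0 < b) (hb1 : b ≤ 1) {K : ℝ} (hK0 : 0 < K)
    (hK : ∀ v, ν v ≤ K * ‖v‖) {x y : unitInterval → Fin k → ℝ} {ε : ℝ}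
    (h : ∀ t, dist (x t) (y t) ≤ ε) (u : unitInterval) :
    |pathStat ν b x u - pathStat ν b y u| ≤ K * 3 / √b * ε := by
  have h1 := abs_seminorm_sub_le ν hK (x (winRight b u) - x (winLeft b u) - b • x 1)
    (y (winRight b u) - y (winLeft b u) - b • y 1)
  have h2 : ‖(x (winRight b u) - x (winLeft b u) - b • x 1) -
      (y (winRight b u) - y (winLeft b u) - b • y 1)‖ ≤ 3 * ε := by
    have e : (x (winRight b u) - x (winLeft b u) - b • x 1) -
        (y (winRight b u) - y (winLeft b u) - b • y 1) =
        (x (winRight b u) - y (winRight b u)) - (x (winLeft b u) - y (winLeft b u)) -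
          b • (x 1 - y 1) := by module
    rw [e]
    simp only [dist_eq_norm] at h
    have h3 : ‖b • (x 1 - y 1)‖ ≤ ε := by
      rw [norm_smul, Real.norm_of_nonneg hb0.le]
      exact (mul_le_of_le_one_left (norm_nonneg _) hb1).trans (h 1)
    calc _ ≤ ‖x (winRight b u) - y (winRight b u)‖ + ‖x (winLeft b u) - y (winLeft b u)‖ +
          ‖b • (x 1 - y 1)‖ := (norm_sub_le _ _).trans (by gcongr; exact norm_sub_le _ _)
      _ ≤ 3 * ε := by linarith [h (winRight b u), h (winLeft b u)]
  have hsb : 0 < √b := Real.sqrt_pos.2 hb0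
  rw [pathStat, pathStat, ← sub_div, abs_div, abs_of_pos hsb, div_le_iff₀ hsb]
  calc _ ≤ K * (3 * ε) := h1.trans (by gcongr)
    _ = K * 3 / √b * ε * √b := by field_simp

lemma exists_abs_pathStat_le {x : unitInterval → Fin k → ℝ} (hb0 : 0 < b) (hb1 : b ≤ 1)
    (hx : Bornology.IsBounded (Set.range x)) : ∃ c, ∀ u, |pathStat ν b x u| ≤ c := by
  obtain ⟨K, hK0, hK⟩ := seminorm_bound ν
  obtain ⟨R, hR⟩ := hx.exists_norm_le
  refine ⟨K * 3 / √b * R, fun u => ?_⟩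
  have h := abs_pathStat_sub_le ν hb0 hb1 hK0 hK (x := x) (y := fun _ => 0) (ε := R)
    (fun t => by simpa using hR _ (Set.mem_range_self t)) u
  simpa [pathStat] using h

lemma crossLevel_pathStat_supLipschitz (hb0 : 0 < b) (hb1 : b ≤ 1) {U : Set ℝ}
    (hU : IsUpperSet U) (h0 : (0 : ℝ) ∉ U) (h1 : (1 : ℝ) ∈ U) :
    SupLipschitz fun x => crossLevel U (pathStat ν b x) := by
  obtain ⟨K, hK0, hK⟩ := seminorm_bound ν
  refine ⟨K * 3 / √b, fun x y hx hy ε hε h => ?_⟩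
  obtain ⟨c, hc⟩ := exists_abs_pathStat_le ν hb0 hb1 hx
  obtain ⟨c', hc'⟩ := exists_abs_pathStat_le ν hb0 hb1 hy
  have hc1 := fun u => (hc u).trans (le_max_left c c')
  have hc1' := fun u => (hc' u).trans (le_max_right c c')
  have hd := abs_pathStat_sub_le ν hb0 hb1 hK0 hK h
  rw [abs_le]
  have e1 := crossLevel_le_add hU h0 h1 hc1 hc1' (ε := K * 3 / √b * ε)
    fun u => by linarith [(abs_le.1 (hd u)).2]
  have e2 := crossLevel_le_add hU h0 h1 hc1' hc1 (ε := K * 3 / √b * ε)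
    fun u => by linarith [(abs_le.1 (hd u)).1]
  constructor <;> linarith

end pathStat

/-! ### Brownian motion: the end point and the bridge -/

lemma measure_pi_absolutelyContinuous : ∀ {k : ℕ} {μ μ' : Fin k → Measure ℝ}
    [∀ i, SigmaFinite (μ i)] [∀ i, SigmaFinite (μ' i)], (∀ i, μ i ≪ μ' i) →
    Measure.pi μ ≪ Measure.pi μ' := by
  intro k
  induction k with
  | zero =>
    intro μ μ' _ _ _
    rw [Measure.pi_of_empty μ, Measure.pi_of_empty μ']
  | succ k ih =>
    intro μ μ' _ _ h
    have h1 := (measurePreserving_piFinSuccAbove μ 0).symm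
    have h2 := (measurePreserving_piFinSuccAbove μ' 0).symm
    rw [← h1.map_eq, ← h2.map_eq]
    exact ((h 0).prod (ih fun i => h _)).map (MeasurableEquiv.measurable _)

lemma measure_eq_indepFun_eq_zero {Ω' : Type*} [MeasurableSpace Ω'] {P' : Measure Ω'}
    [IsProbabilityMeasure P'] {A R : Ω' → ℝ} (hA : AEMeasurable A P') (hR : AEMeasurable R P')
    (hind : IndepFun A R P') (hatom : ∀ c, P' {ω' | A ω' = c} = 0) :
    P' {ω' | A ω' = R ω'} = 0 := by
  have h1 := (indepFun_iff_map_prod_eq_prod_map_map hA hR).1 hind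
  have hm : MeasurableSet {z : ℝ × ℝ | z.1 = z.2} := measurableSet_eq_fun measurable_fst measurable_snd
  have h2 : P' {ω' | A ω' = R ω'} = P'.map (fun ω' => (A ω', R ω')) {z : ℝ × ℝ | z.1 = z.2} := by
    rw [Measure.map_apply_of_aemeasurable (hA.prodMk hR) hm]
    rfl
  have : IsProbabilityMeasure (P'.map A) := Measure.isProbabilityMeasure_map hA
  have : IsProbabilityMeasure (P'.map R) := Measure.isProbabilityMeasure_map hR
  rw [h2, h1, Measure.prod_apply_symm hm, lintegral_eq_zero_iff (measurable_measure_prodMk_right hm)]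
  refine Eventually.of_forall fun r => ?_
  have : (fun a => (a, r)) ⁻¹' {z : ℝ × ℝ | z.1 = z.2} = {r} := by
    ext a; simp
  simp only [this, Pi.zero_apply]
  rw [Measure.map_apply_of_aemeasurable hA (measurableSet_singleton r)]
  exact hatom r

section brownian

variable {Ω' : Type*} [MeasurableSpace Ω'] {P' : Measure Ω'} {k : ℕ}
  {W : Fin k → ℝ≥0 → Ω' → ℝ}

/-- The path of `Σ^{1/2} W` on `[0,1]`. -/
def bmPath (S : Matrix (Fin k) (Fin k) ℝ) (W : Fin k → ℝ≥0 → Ω' → ℝ) (ω' : Ω')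
    (r : unitInterval) : Fin k → ℝ := scaledBM S W ω' (r : ℝ)

lemma IsVectorBrownian.aemeasurable_bmPath (hW : IsVectorBrownian P' W)
    (S : Matrix (Fin k) (Fin k) ℝ) (r : unitInterval) :
    AEMeasurable (fun ω' => bmPath S W ω' r) P' := by
  have h1 : Continuous fun v : Fin k → ℝ => (CFC.sqrt S).mulVec v := by fun_prop
  exact h1.measurable.comp_aemeasurable (aemeasurable_pi_lambda _ fun i =>
    (hW.isBrownian i).toIsPreBrownianReal.aemeasurable _)

lemma IsVectorBrownian.continuous_bmPath (hW : IsVectorBrownian P' W)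
    (S : Matrix (Fin k) (Fin k) ℝ) : ∀ᵐ ω' ∂P', Continuous (bmPath S W ω') := by
  have h : ∀ᵐ ω' ∂P', ∀ i, Continuous fun t => W i t ω' :=
    ae_all_iff.2 fun i => (hW.isBrownian i).cont
  filter_upwards [h] with ω' hω
  have h1 : Continuous fun v : Fin k → ℝ => (CFC.sqrt S).mulVec v := by fun_prop
  exact h1.comp (continuous_pi fun i =>
    (hω i).comp (continuous_real_toNNReal.comp continuous_subtype_val))

lemma IsVectorBrownian.bmPath_zero (hW : IsVectorBrownian P' W)
    (S : Matrix (Fin k) (Fin k) ℝ) : ∀ᵐ ω' ∂P', bmPath S W ω' 0 = 0 := by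
  have h : ∀ᵐ ω' ∂P', ∀ i, W i 0 ω' = 0 :=
    ae_all_iff.2 fun i => (hW.isBrownian i).toIsPreBrownianReal.eval_zero_ae_eq_zero
  filter_upwards [h] with ω' hω
  simp only [bmPath, scaledBM, Set.Icc.coe_zero, Real.toNNReal_zero, hω]
  exact Matrix.mulVec_zero _

lemma IsVectorBrownian.measure_norm_eq (hW : IsVectorBrownian P' W) (hk : 1 ≤ k)
    {S : Matrix (Fin k) (Fin k) ℝ} (hS : S.PosDef) {ν : Seminorm ℝ (Fin k → ℝ)}
    (hν : ∀ v, ν v = 0 → v = 0) (c : ℝ) : P' {ω' | ν (bmPath S W ω' 1) = c} = 0 := by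
  have hlaw : ∀ i, P'.map (W i 1) = gaussianReal 0 1 := fun i =>
    ((hW.isBrownian i).toIsPreBrownianReal.hasLaw_eval 1).map_eq
  have hae : ∀ i, AEMeasurable (W i 1) P' := fun i =>
    (hW.isBrownian i).toIsPreBrownianReal.aemeasurable 1
  have hind : iIndepFun (fun i => W i 1) P' :=
    hW.indep.comp (fun _ x => x 1) fun _ => measurable_pi_apply 1
  have hmap := hind.map_fun_eq_pi_map hae
  simp only [hlaw] at hmap
  have hac : P'.map (fun ω' i => W i 1 ω') ≪ volume := by
    rw [hmap]
    exact measure_pi_absolutelyContinuous fun _ => gaussianReal_absolutelyContinuous 0 one_ne_zero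
  -- the norm of the image under `Σ^{1/2}` is again a norm
  let ν' : Seminorm ℝ (Fin k → ℝ) := ν.comp (CFC.sqrt S).mulVecLin
  have hunit : IsUnit (CFC.sqrt S) := by
    rw [CFC.isUnit_sqrt_iff S hS.posSemidef.nonneg]
    exact hS.isUnit
  have hν' : ∀ v, ν' v = 0 → v = 0 := fun v hv =>
    Matrix.mulVec_injective_of_isUnit hunit ((hν _ hv).trans (Matrix.mulVec_zero _).symm)
  have hnull := hac (volume_seminorm_sphere ν' hk hν' c)
  have hmeas : MeasurableSet {v | ν' v = c} :=
    (isClosed_eq (seminorm_continuous ν') continuous_const).measurableSet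
  rw [Measure.map_apply_of_aemeasurable (aemeasurable_pi_lambda _ hae) hmeas] at hnull
  refine measure_mono_null (fun ω' hω => ?_) hnull
  have hω : ν (bmPath S W ω' 1) = c := hω
  simpa [ν', bmPath, scaledBM] using hω

/-- All coordinates of a vector of independent Brownian motions are jointly Gaussian. -/
lemma IsVectorBrownian.jointly_gaussian (hW : IsVectorBrownian P' W) :
    IsGaussianProcess (fun (s : Fin k × ℝ≥0) ω' => W s.1 s.2 ω') P' where
  hasGaussianLaw J := by
    classical
    let I : Finset ℝ≥0 := J.image Prod.snd
    have h1 : ∀ i, HasGaussianLaw (fun ω' => I.restrict (W i · ω')) P' := fun i =>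
      ((hW.isBrownian i).toIsPreBrownianReal.hasLaw I).hasGaussianLaw
    have h2 : iIndepFun (fun i ω' => I.restrict (W i · ω')) P' :=
      hW.indep.comp (fun _ x => I.restrict x) fun _ => Finset.measurable_restrict I
    let L : (Fin k → I → ℝ) →L[ℝ] (J → ℝ) :=
      { toFun x s := x s.1.1 ⟨s.1.2, Finset.mem_image_of_mem _ s.2⟩
        map_add' x y := by ext; simp
        map_smul' c x := by ext; simp
        cont := by fun_prop }
    exact (h2.hasGaussianLaw h1).map L

/-- The end point and the bridge of a Brownian motion are independent. -/
lemma IsVectorBrownian.indepFun_bridge [IsProbabilityMeasure P'] (hW : IsVectorBrownian P' W) :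
    IndepFun (fun ω' i => W i 1 ω')
      (fun ω' (s : Fin k × unitInterval) =>
        W s.1 (Real.toNNReal s.2) ω' - (s.2 : ℝ) * W s.1 1 ω') P' := by
  have mW : ∀ i t, AEMeasurable (W i t) P' := fun i t =>
    (hW.isBrownian i).toIsPreBrownianReal.aemeasurable t
  have lW : ∀ i t, MemLp (W i t) 2 P' := fun i t =>
    ((hW.isBrownian i).toIsPreBrownianReal.hasLaw_eval t).hasGaussianLaw.memLp_two
  refine IsGaussianProcess.indepFun_of_covariance_eq_zero
    (X := fun i => W i 1) (Y := fun (s : Fin k × unitInterval) ω' =>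
        W s.1 (Real.toNNReal s.2) ω' - (s.2 : ℝ) * W s.1 1 ω') ?_ (fun i => mW i 1)
    (fun s => (mW _ _).sub ((mW _ _).const_mul _)) ?_
  · classical
    refine IsGaussianProcess.of_isGaussianProcess hW.jointly_gaussian ?_
    rintro (i | ⟨i, t⟩)
    · exact ⟨{(i, 1)},
        { toFun x := x ⟨(i, 1), by simp⟩
          map_add' x y := by simp
          map_smul' c x := by simp
          cont := by fun_prop }, by simp⟩
    · exact ⟨{(i, Real.toNNReal t), (i, 1)},
        { toFun x := x ⟨(i, Real.toNNReal t), by simp⟩ - (t : ℝ) * x ⟨(i, 1), by simp⟩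
          map_add' x y := by simp; ring
          map_smul' c x := by simp; ring
          cont := by fun_prop }, by simp⟩
  · rintro i ⟨j, t⟩
    change cov[W i 1, fun ω' => W j (Real.toNNReal t) ω' - (t : ℝ) * W j 1 ω'; P'] = 0
    rw [covariance_fun_sub_right (lW _ _) (lW _ _) ((lW _ _).const_mul _),
      covariance_const_mul_right]
    rcases eq_or_ne i j with rfl | hij
    · have e1 := (hW.isBrownian i).toIsPreBrownianReal.covariance_fun_eval 1 (Real.toNNReal t)
      have e2 := (hW.isBrownian i).toIsPreBrownianReal.covariance_fun_eval 1 1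
      have e3 : min 1 (Real.toNNReal t) = Real.toNNReal t :=
        min_eq_right (by simpa using t.2.2)
      rw [e3, Real.coe_toNNReal _ t.2.1] at e1
      erw [e1, e2]
      simp
    · have hind : ∀ s, IndepFun (W i 1) (W j s) P' := fun s =>
        (hW.indep.indepFun hij).comp (measurable_pi_apply 1) (measurable_pi_apply s)
      have e1 := (hind (Real.toNNReal t)).covariance_eq_zero (lW _ _) (lW _ _)
      have e2 := (hind 1).covariance_eq_zero (lW _ _) (lW _ _)
      erw [e1, e2]
      simp

/-- The norm of the end point avoids every Lipschitz functional of the bridge. -/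
lemma IsVectorBrownian.ae_norm_ne [IsProbabilityMeasure P'] (hW : IsVectorBrownian P' W)
    (hk : 1 ≤ k)
    {S : Matrix (Fin k) (Fin k) ℝ} (hS : S.PosDef) {ν : Seminorm ℝ (Fin k → ℝ)}
    (hν : ∀ v, ν v = 0 → v = 0) {Ψ : (unitInterval → Fin k → ℝ) → ℝ} (hΨ : SupLipschitz Ψ) :
    ∀ᵐ ω' ∂P', ν (bmPath S W ω' 1) ≠ Ψ fun r => bmPath S W ω' r - (r : ℝ) • bmPath S W ω' 1 := by
  obtain ⟨Ψ', hΨ', heq⟩ := hΨ.exists_measurable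
  let R : Ω' → ℝ := fun ω' => Ψ' fun i => bmPath S W ω' (gridPoint i.1 i.2) -
    (gridPoint i.1 i.2 : ℝ) • bmPath S W ω' 1
  have hmul : Continuous fun v : Fin k → ℝ => (CFC.sqrt S).mulVec v := by fun_prop
  have mA : AEMeasurable (fun ω' => ν (bmPath S W ω' 1)) P' :=
    (seminorm_continuous ν).measurable.comp_aemeasurable (hW.aemeasurable_bmPath S 1)
  have mR : AEMeasurable R P' := hΨ'.comp_aemeasurable (aemeasurable_pi_lambda _ fun i =>
    (hW.aemeasurable_bmPath S _).sub ((hW.aemeasurable_bmPath S 1).const_smul (gridPoint i.1 i.2 : ℝ)))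
  have hind : IndepFun (fun ω' => ν (bmPath S W ω' 1)) R P' := by
    have h1 : Measurable fun v : Fin k → ℝ => ν ((CFC.sqrt S).mulVec v) :=
      ((seminorm_continuous ν).comp hmul).measurable
    have h2 : Measurable fun (y : Fin k × unitInterval → ℝ) =>
        Ψ' fun i => (CFC.sqrt S).mulVec fun j => y (j, gridPoint i.1 i.2) := by
      refine hΨ'.comp (measurable_pi_lambda _ fun i => hmul.measurable.comp ?_)
      exact measurable_pi_lambda _ fun j => measurable_pi_apply _
    convert hW.indepFun_bridge.comp h1 h2 using 1
    · ext ω'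
      simp [bmPath, scaledBM]
    · ext ω'
      simp only [R, Function.comp]
      congr 1
      ext i : 1
      simp only [bmPath, scaledBM, Set.Icc.coe_one, Real.toNNReal_one]
      rw [← Matrix.mulVec_smul, ← Matrix.mulVec_sub]
      rfl
  have hzero := measure_eq_indepFun_eq_zero mA mR hind (hW.measure_norm_eq hk hS hν)
  have hne : ∀ᵐ ω' ∂P', ν (bmPath S W ω' 1) ≠ R ω' := by
    rw [ae_iff]
    simpa using hzero
  filter_upwards [hne, hW.continuous_bmPath S] with ω' h1 h2
  have h3 : Continuous fun r : unitInterval => bmPath S W ω' r - (r : ℝ) • bmPath S W ω' 1 :=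
    h2.sub (continuous_subtype_val.smul continuous_const)
  rwa [← heq _ h3]

lemma IsVectorBrownian.ae_norm_ne_crossLevel [IsProbabilityMeasure P'] (hW : IsVectorBrownian P' W)
    (hk : 1 ≤ k)
    {S : Matrix (Fin k) (Fin k) ℝ} (hS : S.PosDef) {ν : Seminorm ℝ (Fin k → ℝ)}
    (hν : ∀ v, ν v = 0 → v = 0) {b : ℝ} (hb0 : 0 < b) (hb1 : b ≤ 1) {U : Set ℝ}
    (hU : IsUpperSet U) (h0 : (0 : ℝ) ∉ U) (h1 : (1 : ℝ) ∈ U) :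
    ∀ᵐ ω' ∂P', ν (bmPath S W ω' 1) ≠ crossLevel U (pathStat ν b (bmPath S W ω')) := by
  filter_upwards [hW.ae_norm_ne hk hS hν
    (crossLevel_pathStat_supLipschitz ν hb0 hb1 hU h0 h1)] with ω' h
  rwa [pathStat_bridge ν hb0 hb1] at h

lemma IsVectorBrownian.ae_crossFree [IsProbabilityMeasure P'] (hW : IsVectorBrownian P' W)
    (hk : 1 ≤ k)
    {S : Matrix (Fin k) (Fin k) ℝ} (hS : S.PosDef) {ν : Seminorm ℝ (Fin k → ℝ)}
    (hν : ∀ v, ν v = 0 → v = 0) {b : ℝ} (hb0 : 0 < b) (hb1 : b ≤ 1) :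
    ∀ᵐ ω' ∂P', CrossFree (ν (bmPath S W ω' 1)) (pathStat ν b (bmPath S W ω')) := by
  have h1 : ∀ᵐ ω' ∂P', ∀ q : ℚ, 0 ≤ q → q < 1 → ν (bmPath S W ω' 1) ≠
      crossLevel (Set.Ioi (q : ℝ)) (pathStat ν b (bmPath S W ω')) := by
    refine ae_all_iff.2 fun q => ?_
    by_cases hq : 0 ≤ q ∧ q < 1
    · have hq0 : (0 : ℝ) ≤ q := by exact_mod_cast hq.1
      have hq1 : (q : ℝ) < 1 := by exact_mod_cast hq.2
      exact (hW.ae_norm_ne_crossLevel hk hS hν hb0 hb1 (isUpperSet_Ioi _) (by simpa using hq.1)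
        hq1).mono fun ω' h _ _ => h
    · exact Eventually.of_forall fun ω' h0 h1 => absurd ⟨h0, h1⟩ hq
  have h2 := hW.ae_norm_ne_crossLevel hk hS hν hb0 hb1 (isUpperSet_Ici (1 : ℝ)) (by simp) (by simp)
  filter_upwards [h1, h2] with ω' h1 h2 using ⟨h1, h2⟩

/-- The measure of the superlevel set has no atom in the open interval `(0,1)`. -/
lemma IsVectorBrownian.ae_levelFrac_ne [IsProbabilityMeasure P'] (hW : IsVectorBrownian P' W)
    (hk : 1 ≤ k)
    {S : Matrix (Fin k) (Fin k) ℝ} (hS : S.PosDef) {ν : Seminorm ℝ (Fin k → ℝ)}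
    (hν : ∀ v, ν v = 0 → v = 0) {b : ℝ} (hb0 : 0 < b) (hb1 : b ≤ 1) (y : ℝ) :
    ∀ᵐ ω' ∂P', levelFrac (pathStat ν b (bmPath S W ω')) (ν (bmPath S W ω' 1)) ∈ Set.Ioo (0 : ℝ) 1 →
      levelFrac (pathStat ν b (bmPath S W ω')) (ν (bmPath S W ω' 1)) ≠ y := by
  by_cases hy : y ∈ Set.Ioo (0 : ℝ) 1
  · filter_upwards [hW.ae_norm_ne_crossLevel hk hS hν hb0 hb1 (isUpperSet_Ioi y)
      (by simpa using hy.1.le) hy.2, hW.continuous_bmPath S] with ω' h1 h2 h3 h4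
    have h5 := crossLevel_levelFrac_eq (continuous_pathStat ν (b := b) h2) h3.1 h3.2
    rw [h4] at h5
    exact h1 h5.symm
  · exact Eventually.of_forall fun ω' h h' => hy (h' ▸ h)

end brownian

/-! ### Block lengths -/

section blocks

variable {b : ℝ} {m : ℕ}

lemma blockLen_le (hb1 : b ≤ 1) (m : ℕ) : blockLen b m ≤ m := by
  refine Nat.ceil_le.2 ?_
  exact mul_le_of_le_one_right (Nat.cast_nonneg m) hb1

lemma le_blockLen (b : ℝ) (m : ℕ) : (m : ℝ) * b ≤ blockLen b m := Nat.le_ceil _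

lemma blockLen_lt (hb0 : 0 < b) (m : ℕ) : (blockLen b m : ℝ) < m * b + 1 :=
  Nat.ceil_lt_add_one (by positivity)

lemma blockLen_pos (hb0 : 0 < b) (hm : 0 < m) : 0 < blockLen b m :=
  Nat.ceil_pos.2 (by positivity)

lemma numBlocks_pos (b : ℝ) (m : ℕ) : 0 < numBlocks b m := Nat.succ_pos _

lemma numBlocks_eq (hb1 : b ≤ 1) (m : ℕ) : (numBlocks b m : ℝ) = m - blockLen b m + 1 := by
  rw [numBlocks, Nat.cast_add, Nat.cast_sub (blockLen_le hb1 m), Nat.cast_one]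

lemma tendsto_blockLen_div (hb0 : 0 < b) :
    Tendsto (fun m : ℕ => (blockLen b m : ℝ) / m) atTop (𝓝 b) := by
  have h1 : Tendsto (fun m : ℕ => b + 1 / (m : ℝ)) atTop (𝓝 b) := by
    simpa using tendsto_const_nhds.add (tendsto_one_div_atTop_nhds_zero_nat (𝕜 := ℝ))
  refine tendsto_of_tendsto_of_tendsto_of_le_of_le' tendsto_const_nhds h1 ?_ ?_
  · filter_upwards [eventually_gt_atTop 0] with m hm
    have hm' : (0 : ℝ) < m := by exact_mod_cast hm
    rw [le_div_iff₀ hm', mul_comm]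
    exact le_blockLen b m
  · filter_upwards [eventually_gt_atTop 0] with m hm
    have hm' : (0 : ℝ) < m := by exact_mod_cast hm
    rw [div_le_iff₀ hm', add_mul, one_div_mul_cancel hm'.ne', mul_comm b]
    exact (blockLen_lt hb0 m).le

/-- The time `j / m`, as a point of `[0,1]`. -/
def gridTime (m j : ℕ) : unitInterval := Set.projIcc 0 1 zero_le_one ((j : ℝ) / m)

lemma coe_gridTime {m j : ℕ} (hm : 0 < m) (hj : j ≤ m) : (gridTime m j : ℝ) = j / m := by
  have hm' : (0 : ℝ) < m := by exact_mod_cast hm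
  have hj' : (j : ℝ) ≤ m := by exact_mod_cast hj
  have hmem : (j : ℝ) / m ∈ Set.Icc (0 : ℝ) 1 := ⟨by positivity, (div_le_one hm').2 hj'⟩
  exact congrArg Subtype.val (Set.projIcc_of_mem zero_le_one hmem)

lemma floor_window (hb0 : 0 < b) (hb1 : b ≤ 1) (hm : 0 < m) {u : unitInterval} (hu : u < 1) :
    ⌊(numBlocks b m : ℝ) * (u : ℝ)⌋₊ < numBlocks b m ∧
    ⌊(numBlocks b m : ℝ) * (u : ℝ)⌋₊ + blockLen b m ≤ m ∧
    dist (gridTime m ⌊(numBlocks b m : ℝ) * (u : ℝ)⌋₊) (winLeft b u) ≤ 2 / m ∧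
    dist (gridTime m (⌊(numBlocks b m : ℝ) * (u : ℝ)⌋₊ + blockLen b m)) (winRight b u) ≤ 2 / m := by
  have hm' : (0 : ℝ) < m := by exact_mod_cast hm
  have hu0 : (0 : ℝ) ≤ u := u.2.1
  have hu1 : (u : ℝ) < 1 := hu
  have hN : (0 : ℝ) < numBlocks b m := by exact_mod_cast numBlocks_pos b m
  set j := ⌊(numBlocks b m : ℝ) * (u : ℝ)⌋₊ with hj
  have hj1 : (j : ℝ) ≤ numBlocks b m * u := Nat.floor_le (by positivity)
  have hj2 : (numBlocks b m : ℝ) * u < j + 1 := Nat.lt_floor_add_one _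
  have hjN : j < numBlocks b m := by
    have : (j : ℝ) < numBlocks b m := by nlinarith
    exact_mod_cast this
  have hl := blockLen_le hb1 m
  have hjm : j + blockLen b m ≤ m := by
    unfold numBlocks at hjN
    omega
  have hNe := numBlocks_eq hb1 m
  have hl1 := le_blockLen b m
  have hl2 := blockLen_lt hb0 m
  -- `m (1 - b) < N ≤ m (1 - b) + 1`, hence `|j - m (1 - b) u| ≤ 1`
  have e1 : (numBlocks b m : ℝ) * u ≤ m * ((1 - b) * u) + 1 := by
    have : ((numBlocks b m : ℝ) - m * (1 - b)) * u ≤ 1 * 1 :=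
      mul_le_mul (by rw [hNe]; linarith) hu1.le hu0 zero_le_one
    linarith
  have e2 : m * ((1 - b) * u) ≤ (numBlocks b m : ℝ) * u := by
    have : 0 ≤ ((numBlocks b m : ℝ) - m * (1 - b)) * u :=
      mul_nonneg (by rw [hNe]; linarith) hu0
    linarith
  have hdiv : ∀ y z : ℝ, |y - m * z| ≤ 2 → |y / m - z| ≤ 2 / m := by
    intro y z h
    rwa [le_div_iff₀ hm', ← abs_of_pos hm', ← abs_mul, abs_of_pos hm', sub_mul,
      div_mul_cancel₀ _ hm'.ne', mul_comm z]
  refine ⟨hjN, hjm, ?_, ?_⟩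
  · rw [Subtype.dist_eq, Real.dist_eq, coe_gridTime hm (by omega), coe_winLeft hb0 hb1]
    refine hdiv _ _ (abs_le.2 ⟨by linarith, by linarith⟩)
  · rw [Subtype.dist_eq, Real.dist_eq, coe_gridTime hm hjm, coe_winRight hb0 hb1]
    push_cast
    refine hdiv _ _ (abs_le.2 ⟨by linarith, by linarith⟩)

end blocks

/-! ### Discretized path statistics -/

section blockStat

variable {k : ℕ} (ν : Seminorm ℝ (Fin k → ℝ)) (b : ℝ)

/-- The discretization of `pathStat` at the window from `j / m` to `(j + l) / m`, where `l` is the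
block length for the sample size `m`. -/
def blockStat (x : unitInterval → Fin k → ℝ) (m j : ℕ) : ℝ :=
  ν (√((m : ℝ) / blockLen b m) • (x (gridTime m (j + blockLen b m)) - x (gridTime m j)) -
    √((blockLen b m : ℝ) / m) • x 1)

variable {b}

lemma pathStat_eq (hb0 : 0 < b) (x : unitInterval → Fin k → ℝ) (u : unitInterval) :
    pathStat ν b x u = ν (√(1 / b) • (x (winRight b u) - x (winLeft b u)) - √b • x 1) := by
  have hsb : 0 < √b := Real.sqrt_pos.2 hb0
  have e : √(1 / b) • (x (winRight b u) - x (winLeft b u)) - √b • x 1 =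
      (√b)⁻¹ • (x (winRight b u) - x (winLeft b u) - b • x 1) := by
    rw [smul_sub _ _ (b • x 1), smul_smul, one_div, Real.sqrt_inv]
    congr 2
    rw [eq_inv_mul_iff_mul_eq₀ hsb.ne', Real.mul_self_sqrt hb0.le]
  rw [e, map_smul_eq_mul, Real.norm_of_nonneg (by positivity), pathStat, div_eq_inv_mul]

/-- Uniform convergence of the block statistics along uniformly convergent paths. -/
lemma eventually_abs_blockStat_sub_le (hb0 : 0 < b) (hb1 : b ≤ 1) {m : ℕ → ℕ}
    (hm : Tendsto m atTop atTop) {s : ℕ → unitInterval → Fin k → ℝ} {w : unitInterval → Fin k → ℝ}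
    (hw : Continuous w) (hs : ∀ η > 0, ∀ᶠ i in atTop, ∀ t, dist (s i t) (w t) ≤ η) {ε : ℝ}
    (hε : 0 < ε) : ∀ᶠ i in atTop, ∀ u : unitInterval, u < 1 →
      |blockStat ν b (s i) (m i) ⌊(numBlocks b (m i) : ℝ) * (u : ℝ)⌋₊ - pathStat ν b w u| ≤ ε := by
  obtain ⟨K, hK0, hK⟩ := seminorm_bound ν
  obtain ⟨M, hM⟩ := (isCompact_range hw).isBounded.exists_norm_le
  have hM' : ∀ t, ‖w t‖ ≤ M := fun t => hM _ (Set.mem_range_self t)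
  set c := √(1 / b)
  set e := √b
  have he : Tendsto (fun i => √((blockLen b (m i) : ℝ) / m i)) atTop (𝓝 e) :=
    ((tendsto_blockLen_div hb0).comp hm).sqrt
  have hc : Tendsto (fun i => √((m i : ℝ) / blockLen b (m i))) atTop (𝓝 c) := by
    have := (((tendsto_blockLen_div hb0).comp hm).inv₀ hb0.ne').sqrt
    simpa [c, Function.comp_def] using this
  have hc0 : 0 ≤ c := Real.sqrt_nonneg _
  have he0 : 0 ≤ e := Real.sqrt_nonneg _
  obtain ⟨η, hη, hηε⟩ : ∃ η > 0, K * (c * (4 * η) + e * η) < ε := by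
    refine ⟨ε / (2 * (K * (4 * c + e) + 1)), by positivity, ?_⟩
    have h1 : 0 < K * (4 * c + e) + 1 := by positivity
    have : K * (c * (4 * (ε / (2 * (K * (4 * c + e) + 1)))) + e * (ε / (2 * (K * (4 * c + e) + 1))))
        = (K * (4 * c + e)) / (K * (4 * c + e) + 1) * (ε / 2) := by
      field_simp
    rw [this]
    have h2 : (K * (4 * c + e)) / (K * (4 * c + e) + 1) ≤ 1 := (div_le_one h1).2 (by linarith)
    nlinarith
  have hbound : Tendsto (fun i => K * (√((m i : ℝ) / blockLen b (m i)) * (4 * η) +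
      |√((m i : ℝ) / blockLen b (m i)) - c| * (2 * M) + √((blockLen b (m i) : ℝ) / m i) * η +
      |√((blockLen b (m i) : ℝ) / m i) - e| * M)) atTop
      (𝓝 (K * (c * (4 * η) + |c - c| * (2 * M) + e * η + |e - e| * M))) :=
    ((((hc.mul_const _).add ((hc.sub_const c).abs.mul_const _)).add (he.mul_const _)).add
      ((he.sub_const e).abs.mul_const _)).const_mul K
  have hbε := hbound.eventually (gt_mem_nhds
    (show K * (c * (4 * η) + |c - c| * (2 * M) + e * η + |e - e| * M) < ε by simpa using hηε))
  have huc : UniformContinuous w := CompactSpace.uniformContinuous_of_continuous hw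
  obtain ⟨δ, hδ, hδη⟩ := Metric.uniformContinuous_iff.1 huc η hη
  have hsmall : ∀ᶠ i in atTop, 2 / (m i : ℝ) < δ :=
    ((tendsto_const_nhds.div_atTop (tendsto_natCast_atTop_atTop.comp hm) :
      Tendsto (fun i => 2 / (m i : ℝ)) atTop (𝓝 0))).eventually (gt_mem_nhds hδ)
  filter_upwards [hbε, hsmall, hs η hη, hm.eventually_gt_atTop 0] with i h1 h2 h3 h4 u hu
  obtain ⟨-, -, hL, hR⟩ := floor_window hb0 hb1 h4 hu
  set j := ⌊(numBlocks b (m i) : ℝ) * (u : ℝ)⌋₊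
  set ci := √((m i : ℝ) / blockLen b (m i)) with hci
  set ei := √((blockLen b (m i) : ℝ) / m i) with hei
  have hci0 : 0 ≤ ci := Real.sqrt_nonneg _
  have hei0 : 0 ≤ ei := Real.sqrt_nonneg _
  have key : ∀ t t', dist t t' ≤ 2 / (m i : ℝ) → ‖s i t - w t'‖ ≤ 2 * η := by
    intro t t' htt
    have e1 := h3 t
    have e2 := (hδη (htt.trans_lt h2)).le
    rw [← dist_eq_norm]
    linarith [dist_triangle (s i t) (w t) (w t')]
  have k1 := key _ _ hL
  have k2 := key _ _ hR
  have k3 : ‖s i 1 - w 1‖ ≤ η := by rw [← dist_eq_norm]; exact h3 1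
  rw [pathStat_eq ν hb0, blockStat, ← hci, ← hei]
  refine (abs_seminorm_sub_le ν hK _ _).trans (le_trans ?_ h1.le)
  refine mul_le_mul_of_nonneg_left ?_ hK0.le
  set sR := s i (gridTime (m i) (j + blockLen b (m i)))
  set sL := s i (gridTime (m i) j)
  have dec : (ci • (sR - sL) - ei • s i 1) -
      (c • (w (winRight b u) - w (winLeft b u)) - e • w 1) =
      ci • ((sR - w (winRight b u)) - (sL - w (winLeft b u))) +
      (ci - c) • (w (winRight b u) - w (winLeft b u)) - ei • (s i 1 - w 1) - (ei - e) • w 1 := by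
    module
  rw [dec]
  have n1 : ‖ci • ((sR - w (winRight b u)) - (sL - w (winLeft b u)))‖ ≤ ci * (4 * η) := by
    rw [norm_smul, Real.norm_of_nonneg hci0]
    refine mul_le_mul_of_nonneg_left ((norm_sub_le _ _).trans (by linarith)) hci0
  have n2 : ‖(ci - c) • (w (winRight b u) - w (winLeft b u))‖ ≤ |ci - c| * (2 * M) := by
    rw [norm_smul, Real.norm_eq_abs]
    refine mul_le_mul_of_nonneg_left ((norm_sub_le _ _).trans ?_) (abs_nonneg _)
    linarith [hM' (winRight b u), hM' (winLeft b u)]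
  have n3 : ‖ei • (s i 1 - w 1)‖ ≤ ei * η := by
    rw [norm_smul, Real.norm_of_nonneg hei0]
    exact mul_le_mul_of_nonneg_left k3 hei0
  have n4 : ‖(ei - e) • w 1‖ ≤ |ei - e| * M := by
    rw [norm_smul, Real.norm_eq_abs]
    exact mul_le_mul_of_nonneg_left (hM' 1) (abs_nonneg _)
  calc _ ≤ _ + _ := norm_sub_le _ _
    _ ≤ _ + _ + _ := by gcongr; exact norm_sub_le _ _
    _ ≤ _ + _ + _ + _ := by gcongr; exact norm_add_le _ _
    _ ≤ _ := by linarith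

/-- Paths for which small perturbations of the norm of the end point and of the block statistics
have an exceedance fraction in `B`. -/
def exceedSet (ν : Seminorm ℝ (Fin k → ℝ)) (b : ℝ) (B : Set ℝ) (m : ℕ) (η : ℝ) :
    Set (unitInterval → Fin k → ℝ) :=
  {x | ∃ (a : ℝ) (d : ℕ → ℝ), |a - ν (x 1)| ≤ η ∧
    (∀ j < numBlocks b m, |d j - blockStat ν b x m j| ≤ η) ∧ exceed (numBlocks b m) a d ∈ B}

/-- If a path `w` is a uniform limit of paths of `exceedSet ν b B (m n) (η n)` with `m n → ∞` and
`η n → 0`, then the limiting exceedance fraction of `w` is in `B`. -/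
lemma levelFrac_mem_of_exceedSet (hb0 : 0 < b) (hb1 : b ≤ 1) {m : ℕ → ℕ}
    (hm : Tendsto m atTop atTop) {η : ℕ → ℝ} (hη : Tendsto η atTop (𝓝 0)) {B : Set ℝ}
    {w : unitInterval → Fin k → ℝ} (hw : Continuous w)
    (hfree : CrossFree (ν (w 1)) (pathStat ν b w))
    (hfr : levelFrac (pathStat ν b w) (ν (w 1)) ∈ Set.Ioo (0 : ℝ) 1 →
      levelFrac (pathStat ν b w) (ν (w 1)) ∉ frontier B)
    (h : ∀ ε > 0, ∀ n₀, ∃ n ≥ n₀, ∃ s ∈ exceedSet ν b B (m n) (η n), ∀ t, dist (s t) (w t) ≤ ε) :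
    levelFrac (pathStat ν b w) (ν (w 1)) ∈ B := by
  have hpos : ∀ i : ℕ, (0 : ℝ) < 1 / ((i : ℝ) + 1) := fun i => by positivity
  choose n hn s hs hsw using fun i : ℕ => h (1 / ((i : ℝ) + 1)) (hpos i) i
  have hn' : Tendsto n atTop atTop := tendsto_atTop_mono hn tendsto_id
  choose a d ha hd hB using hs
  have hηn := hη.comp hn'
  have hlim : ∀ ε > 0, ∀ᶠ i in atTop, ∀ t, dist (s i t) (w t) ≤ ε := by
    intro ε hε
    filter_upwards [(tendsto_one_div_add_atTop_nhds_zero_nat (𝕜 := ℝ)).eventually (gt_mem_nhds hε)]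
      with i hi t
    exact (hsw i t).trans hi.le
  obtain ⟨K, hK0, hK⟩ := seminorm_bound ν
  refine hfree.levelFrac_mem (continuous_pathStat ν hw) (N := fun i => numBlocks b (m (n i)))
    (fun i => numBlocks_pos _ _) (a := a) (d := d) ?_ ?_ hB hfr
  · have h1 : Tendsto (fun i => ν (s i 1)) atTop (𝓝 (ν (w 1))) := by
      refine ((seminorm_continuous ν).tendsto (w 1)).comp ?_
      rw [Metric.tendsto_nhds]
      intro ε hε
      filter_upwards [hlim (ε / 2) (half_pos hε)] with i hi
      exact (hi 1).trans_lt (half_lt_self hε)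
    have h2 : Tendsto (fun i => a i - ν (s i 1)) atTop (𝓝 0) :=
      squeeze_zero_norm ha hηn
    simpa using h2.add h1
  · intro ε hε
    filter_upwards [eventually_abs_blockStat_sub_le ν hb0 hb1 (hm.comp hn') hw hlim (half_pos hε),
      hηn.eventually (gt_mem_nhds (half_pos hε)), (hm.comp hn').eventually_gt_atTop 0]
      with i h1 h2 h3 u hu
    have e1 := h1 u hu
    have e2 := (hd i _ (floor_window hb0 hb1 h3 hu).1).trans h2.le
    simp only [Function.comp] at e1 e2
    calc _ = |(d i ⌊(numBlocks b (m (n i)) : ℝ) * (u : ℝ)⌋₊ -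
          blockStat ν b (s i) (m (n i)) ⌊(numBlocks b (m (n i)) : ℝ) * (u : ℝ)⌋₊) +
          (blockStat ν b (s i) (m (n i)) ⌊(numBlocks b (m (n i)) : ℝ) * (u : ℝ)⌋₊ -
          pathStat ν b w u)| := by congr 1; ring
      _ ≤ ε / 2 + ε / 2 := (abs_add_le _ _).trans (add_le_add e2 e1)
      _ = ε := add_halves ε

lemma tendsto_exceed_blockStat (hb0 : 0 < b) (hb1 : b ≤ 1) {w : unitInterval → Fin k → ℝ}
    (hw : Continuous w) (hfree : CrossFree (ν (w 1)) (pathStat ν b w)) :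
    Tendsto (fun m => exceed (numBlocks b m) (ν (w 1)) (blockStat ν b w m)) atTop
      (𝓝 (levelFrac (pathStat ν b w) (ν (w 1)))) :=
  hfree.tendsto_exceed (continuous_pathStat ν hw) (fun _ => numBlocks_pos _ _) tendsto_const_nhds
    fun _ hε => eventually_abs_blockStat_sub_le ν hb0 hb1 tendsto_id hw
      (fun η hη => Eventually.of_forall fun _ t => by simpa using hη.le) hε

end blockStat

/-! ### The limit variable -/

section limitG

variable {Ω' : Type*} {k : ℕ}
  {W : Fin k → ℝ≥0 → Ω' → ℝ} {S : Matrix (Fin k) (Fin k) ℝ} {ν : Seminorm ℝ (Fin k → ℝ)} {b : ℝ}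

lemma limitG_eq_levelFrac (hb0 : 0 < b) (hb1 : b ≤ 1) {ω' : Ω'}
    (hcont : Continuous (bmPath S W ω')) (hzero : bmPath S W ω' 0 = 0)
    (hfree : CrossFree (ν (bmPath S W ω' 1)) (pathStat ν b (bmPath S W ω'))) :
    limitG ν S W b ω' = levelFrac (pathStat ν b (bmPath S W ω')) (ν (bmPath S W ω' 1)) := by
  classical
  have hD := continuous_pathStat ν (b := b) hcont
  rcases hb1.eq_or_lt with rfl | hb
  · -- for `b = 1` both sides vanish: the only window is the whole interval
    have hD0 : ∀ u, pathStat ν 1 (bmPath S W ω') u = 0 := by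
      intro u
      have h1 : winRight 1 u = 1 := Subtype.ext (by rw [coe_winRight hb0 le_rfl]; simp)
      have h2 : winLeft 1 u = 0 := Subtype.ext (by rw [coe_winLeft hb0 le_rfl]; simp)
      simp [pathStat, h1, h2, hzero]
    have hA : ν (bmPath S W ω' 1) ≠ 0 := by
      intro hA
      have := hfree.volume_eq hD
      simp [hD0, hA] at this
    have hA' : 0 < ν (bmPath S W ω' 1) := lt_of_le_of_ne (apply_nonneg _ _) hA.symm
    rw [levelFrac_eq_zero fun u => (hD0 u).trans_lt hA']
    simp [limitG]
  · rw [levelFrac_eq_integral hD]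
    let f : ℝ → ℝ := fun t => if ν (scaledBM S W ω' 1) ≤
        ν (scaledBM S W ω' (b + t) - scaledBM S W ω' t - b • scaledBM S W ω' 1) / √b
      then (1 : ℝ) else 0
    have h1 : limitG ν S W b ω' = ∫ u in (0 : ℝ)..1, f ((1 - b) * u) := by
      rw [intervalIntegral.integral_comp_mul_left f (by linarith : (1 - b : ℝ) ≠ 0)]
      simp [limitG, f]
    have h2 : ∫ u in (0 : ℝ)..1, f ((1 - b) * u) = ∫ u : unitInterval, f ((1 - b) * u) := by
      rw [intervalIntegral.integral_of_le zero_le_one, ← integral_Icc_eq_integral_Ioc]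
      exact (unitInterval.measurePreserving_coe.integral_comp
        unitInterval.measurableEmbedding_coe (fun u : ℝ => f ((1 - b) * u))).symm
    rw [h1, h2]
    congr 1
    ext u
    simp only [f, pathStat, bmPath, coe_winLeft hb0 hb1, coe_winRight hb0 hb1,
      Set.Icc.coe_one]

variable [MeasurableSpace Ω'] {P' : Measure Ω'} [IsProbabilityMeasure P']
  (hW : IsVectorBrownian P' W) (hk : 1 ≤ k) (hS : S.PosDef)
  (hν : ∀ v, ν v = 0 → v = 0) (hb0 : 0 < b) (hb1 : b ≤ 1)

include hW hk hS hν hb0 hb1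

lemma ae_limitG_eq : ∀ᵐ ω' ∂P', limitG ν S W b ω' =
    levelFrac (pathStat ν b (bmPath S W ω')) (ν (bmPath S W ω' 1)) := by
  filter_upwards [hW.continuous_bmPath S, hW.bmPath_zero S, hW.ae_crossFree hk hS hν hb0 hb1]
    with ω' h1 h2 h3 using limitG_eq_levelFrac hb0 hb1 h1 h2 h3

lemma aemeasurable_limitG : AEMeasurable (limitG ν S W b) P' := by
  classical
  have hA : AEMeasurable (fun ω' => ν (bmPath S W ω' 1)) P' :=
    (seminorm_continuous ν).measurable.comp_aemeasurable (hW.aemeasurable_bmPath S 1)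
  refine aemeasurable_of_tendsto_metrizable_ae (u := atTop)
    (f := fun m ω' => exceed (numBlocks b m) (ν (bmPath S W ω' 1))
      (blockStat ν b (bmPath S W ω') m)) (fun m => ?_) ?_
  · have hd : ∀ j, AEMeasurable (fun ω' => blockStat ν b (bmPath S W ω') m j) P' := fun j =>
      (seminorm_continuous ν).measurable.comp_aemeasurable
        ((((hW.aemeasurable_bmPath S _).sub (hW.aemeasurable_bmPath S _)).const_smul
          (√((m : ℝ) / blockLen b m))).sub
          ((hW.aemeasurable_bmPath S 1).const_smul (√((blockLen b m : ℝ) / m))))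
    unfold exceed
    refine AEMeasurable.const_mul (Finset.aemeasurable_fun_sum _ fun j _ => ?_) _
    exact (aemeasurable_const (b := (1 : ℝ))).indicator₀ (nullMeasurableSet_le hA (hd j))
  · filter_upwards [hW.continuous_bmPath S, hW.ae_crossFree hk hS hν hb0 hb1,
      ae_limitG_eq hW hk hS hν hb0 hb1] with ω' h1 h2 h3
    rw [h3]
    exact tendsto_exceed_blockStat ν hb0 hb1 h1 h2

end limitG

/-! ### Convergence in probability with a vanishing tolerance -/

section tolerance

variable {Ω : Type*} [MeasurableSpace Ω] {P : Measure Ω} [IsProbabilityMeasure P]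

/-- If `Z n → 0` in probability, then `P(Z n > η n) → 0` for some sequence `η n → 0`, for instance
the Ky Fan distances of `Z n` to `0`, slightly enlarged. -/
lemma exists_tolerance {Z : ℕ → Ω → ℝ}
    (hZ : ∀ ε > 0, Tendsto (fun n => P.real {ω | ε < Z n ω}) atTop (𝓝 0)) :
    ∃ η : ℕ → ℝ, (∀ n, 0 ≤ η n) ∧ Tendsto η atTop (𝓝 0) ∧
      Tendsto (fun n => P.real {ω | η n < Z n ω}) atTop (𝓝 0) := by
  let s : ℕ → Set ℝ := fun n => {ε | 0 < ε ∧ P.real {ω | ε < Z n ω} ≤ ε}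
  have hs0 : ∀ n, ∀ ε ∈ s n, 0 ≤ ε := fun n ε h => h.1.le
  have hbdd : ∀ n, BddBelow (s n) := fun n => ⟨0, hs0 n⟩
  have hne : ∀ n, (s n).Nonempty := fun n => ⟨1, one_pos, measureReal_le_one⟩
  have hpos : ∀ n : ℕ, (0 : ℝ) < 1 / ((n : ℝ) + 1) := fun n => by positivity
  let η : ℕ → ℝ := fun n => sInf (s n) + 1 / ((n : ℝ) + 1)
  have hη0 : ∀ n, 0 ≤ η n := fun n => add_nonneg (Real.sInf_nonneg (hs0 n)) (hpos n).le
  have hη : Tendsto η atTop (𝓝 0) := by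
    have h1 : Tendsto (fun n => sInf (s n)) atTop (𝓝 0) := by
      refine tendsto_order.2 ⟨fun a ha => Eventually.of_forall fun n =>
        ha.trans_le (Real.sInf_nonneg (hs0 n)), fun a ha => ?_⟩
      filter_upwards [(hZ (a / 2) (half_pos ha)).eventually (gt_mem_nhds (half_pos ha))] with n hn
      exact (csInf_le (hbdd n) ⟨half_pos ha, hn.le⟩).trans_lt (half_lt_self ha)
    have h2 := h1.add (tendsto_one_div_add_atTop_nhds_zero_nat (𝕜 := ℝ))
    rwa [add_zero] at h2
  refine ⟨η, hη0, hη, squeeze_zero (fun n => measureReal_nonneg) (fun n => ?_) hη⟩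
  obtain ⟨ε, hε, hlt⟩ := exists_lt_of_csInf_lt (hne n)
    (show sInf (s n) < η n by linarith [hpos n])
  calc P.real {ω | η n < Z n ω} ≤ P.real {ω | ε < Z n ω} :=
        measureReal_mono fun ω hω => hlt.trans hω
    _ ≤ ε := hε.2
    _ ≤ η n := hlt.le

lemma TendstoInMeasure.tendsto_measureReal_lt {Z : ℕ → Ω → ℝ}
    (hZ : TendstoInMeasure P Z atTop fun _ => 0) {ε : ℝ} (hε : 0 < ε) :
    Tendsto (fun n => P.real {ω | ε < Z n ω}) atTop (𝓝 0) := by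
  refine squeeze_zero (fun n => measureReal_nonneg) (fun n => measureReal_mono fun ω hω => ?_)
    (tendstoInMeasure_iff_measureReal_norm.1 hZ ε hε)
  have hω : ε < Z n ω := hω
  simpa using hω.le.trans (le_abs_self _)

end tolerance

/-! ### Block estimators and partial sums -/

section statistics

lemma partialSumProcess_gridTime {Ω E : Type*} {k : ℕ} {X : ℤ → Ω → E} {φ : E → Fin k → ℝ} {m j : ℕ} (hm : 0 < m) (hj : j ≤ m) (ω : Ω) :
    partialSumProcess φ X m ω (gridTime m j) =
      (√(m : ℝ))⁻¹ • ∑ i ∈ Finset.range j, φ (X (1 + (i : ℤ)) ω) := by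
  have hm' : (m : ℝ) ≠ 0 := by positivity
  rw [partialSumProcess, coe_gridTime hm hj, mul_div_cancel₀ _ hm', Nat.floor_natCast,
    ← Finset.Ico_succ_right_eq_Icc, Finset.sum_Ico_eq_sum_range]
  simp

variable {Ω E : Type*} [MeasurableSpace E] {k : ℕ}

/-- The fraction of blocks of the window `X t, …, X (t + m - 1)` whose statistic exceeds
`‖√m (θ̂ - θ)‖ - δ`, where `θ̂` is the estimator from the window. With `δ = 0` this is the
subsampling p-value of `θ` computed from the window. -/
def windowPval (ν : Seminorm ℝ (Fin k → ℝ)) (T : Measure E → Fin k → ℝ) (X : ℤ → Ω → E) (b : ℝ)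
    (m : ℕ) (t : ℤ) (δ : ℝ) (θ : Fin k → ℝ) (ω : Ω) : ℝ :=
  exceed (numBlocks b m) (ν (√(m : ℝ) • (blockEst T X t m ω - θ)) - δ)
    fun j => ν (√(blockLen b m : ℝ) •
      (blockEst T X (t + (j : ℤ)) (blockLen b m) ω - blockEst T X t m ω))

variable {ν : Seminorm ℝ (Fin k → ℝ)} {T : Measure E → Fin k → ℝ} {X : ℤ → Ω → E} {b : ℝ}

lemma pval_eq_windowPval (n : ℕ) (θ : Fin k → ℝ) (ω : Ω) :
    pval ν T X b n θ ω = windowPval ν T X b n 1 0 θ ω := by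
  classical
  unfold pval windowPval exceed
  congr 1
  rw [Finset.range_eq_Ico, Finset.sum_Ico_eq_sum_range, ← Finset.Ico_succ_right_eq_Icc,
    Finset.sum_Ico_eq_sum_range]
  simp

lemma subPval_eq_windowPval (n m t : ℕ) (ω : Ω) :
    subPval ν T X b n m t ω = windowPval ν T X b m t 0 (blockEst T X 1 n ω) ω := by
  classical
  unfold subPval windowPval exceed
  congr 1
  have h : t + numBlocks b m - 1 + 1 - t = numBlocks b m := by
    have := numBlocks_pos b m
    omega
  rw [← Finset.Ico_succ_right_eq_Icc, Finset.sum_Ico_eq_sum_range, Order.succ_eq_add_one, h]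
  simp

/-- The p-value with a wrong centre `θ'` lies between the relaxed p-values with centre `θ`. -/
lemma windowPval_le_of_center {m : ℕ} {t : ℤ} {δ δ₁ δ₂ : ℝ} {θ θ' : Fin k → ℝ} {ω : Ω}
    (h : ν (√(m : ℝ) • (θ' - θ)) ≤ δ) (hδ : δ₁ + δ ≤ δ₂) :
    windowPval ν T X b m t δ₁ θ' ω ≤ windowPval ν T X b m t δ₂ θ ω := by
  refine exceed_mono fun j _ hj => ?_
  have h1 : ν (√(m : ℝ) • (blockEst T X t m ω - θ)) ≤
      ν (√(m : ℝ) • (blockEst T X t m ω - θ')) + ν (√(m : ℝ) • (θ' - θ)) := by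
    have e : √(m : ℝ) • (blockEst T X t m ω - θ) =
      √(m : ℝ) • (blockEst T X t m ω - θ') + √(m : ℝ) • (θ' - θ) := by module
    rw [e]
    exact map_add_le_add ν _ _
  linarith

variable {F : Measure E} {φ : E → Fin k → ℝ}

lemma gridTime_self {m : ℕ} (hm : 0 < m) : gridTime m m = 1 := by
  refine Subtype.ext ?_
  rw [coe_gridTime hm le_rfl, div_self (by positivity)]
  rfl

lemma sqrt_smul_blockEst_sub {m : ℕ} (hm : 0 < m) (ω : Ω) :
    √(m : ℝ) • (blockEst T X 1 m ω - T F) =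
      partialSumProcess φ X m ω 1 + √(m : ℝ) • remainder T F φ X 1 m ω := by
  have hm' : (0 : ℝ) < m := by exact_mod_cast hm
  rw [← gridTime_self hm, partialSumProcess_gridTime hm le_rfl, remainder,
    Fin.sum_univ_eq_sum_range (fun i => φ (X (1 + (i : ℤ)) ω)) m, smul_sub _ (_ - _), smul_smul]
  have : √(m : ℝ) * (m : ℝ)⁻¹ = (√(m : ℝ))⁻¹ := by
    rw [← div_eq_mul_inv, Real.sqrt_div_self]
  rw [this]
  abel

lemma sqrt_smul_blockEst_sub_blockEst (hb0 : 0 < b) {m j : ℕ} (hm : 0 < m)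
    (hj : j + blockLen b m ≤ m) (ω : Ω) :
    √(blockLen b m : ℝ) • (blockEst T X (1 + (j : ℤ)) (blockLen b m) ω - blockEst T X 1 m ω) =
      (√((m : ℝ) / blockLen b m) • (partialSumProcess φ X m ω (gridTime m (j + blockLen b m)) -
        partialSumProcess φ X m ω (gridTime m j)) -
        √((blockLen b m : ℝ) / m) • partialSumProcess φ X m ω 1) +
      (√(blockLen b m : ℝ) • remainder T F φ X (1 + (j : ℤ)) (blockLen b m) ω -
        √(blockLen b m : ℝ) • remainder T F φ X 1 m ω) := by
  have hm' : (0 : ℝ) < m := by exact_mod_cast hm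
  have hl' : (0 : ℝ) < blockLen b m := by exact_mod_cast blockLen_pos hb0 hm
  set l := blockLen b m
  rw [← gridTime_self hm, partialSumProcess_gridTime hm le_rfl, partialSumProcess_gridTime hm hj,
    partialSumProcess_gridTime hm (by omega), Finset.sum_range_add, remainder, remainder,
    Fin.sum_univ_eq_sum_range (fun i => φ (X (1 + (i : ℤ)) ω)) m,
    Fin.sum_univ_eq_sum_range (fun i => φ (X (1 + (j : ℤ) + (i : ℤ)) ω)) l,
    ← smul_sub (√(m : ℝ))⁻¹, add_sub_cancel_left]
  have e1 : √((m : ℝ) / l) * (√(m : ℝ))⁻¹ = √(l : ℝ) * (l : ℝ)⁻¹ := by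
    rw [Real.sqrt_div hm'.le, ← div_eq_mul_inv (√(l : ℝ)), Real.sqrt_div_self]
    have := Real.sqrt_pos.2 hm'
    field_simp
  have e2 : √((l : ℝ) / m) * (√(m : ℝ))⁻¹ = √(l : ℝ) * (m : ℝ)⁻¹ := by
    have hmm : (m : ℝ)⁻¹ = (√(m : ℝ))⁻¹ * (√(m : ℝ))⁻¹ := by
      rw [← mul_inv, Real.mul_self_sqrt hm'.le]
    rw [Real.sqrt_div hl'.le, hmm, div_eq_mul_inv, mul_assoc]
  rw [smul_smul, smul_smul, e1, e2]
  push_cast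
  simp only [← add_assoc]
  module

lemma partialSumProcess_mem_exceedSet (hb0 : 0 < b) (hb1 : b ≤ 1) {m : ℕ} (hm : 0 < m)
    {δ η : ℝ} {B : Set ℝ} {ω : Ω}
    (hB : windowPval ν T X b m 1 δ (T F) ω ∈ B)
    (hη : √(m : ℝ) * ν (remainder T F φ X 1 m ω) + √(blockLen b m : ℝ) *
      (⨆ j : Fin (numBlocks b m), ν (remainder T F φ X (1 + (j : ℕ)) (blockLen b m) ω)) +
      |δ| ≤ η) :
    partialSumProcess φ X m ω ∈ exceedSet ν b B m η := by
  have hsup : ∀ j < numBlocks b m, ν (remainder T F φ X (1 + (j : ℕ)) (blockLen b m) ω) ≤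
      ⨆ j : Fin (numBlocks b m), ν (remainder T F φ X (1 + (j : ℕ)) (blockLen b m) ω) :=
    fun j hj => le_ciSup (f := fun j : Fin (numBlocks b m) =>
      ν (remainder T F φ X (1 + (j : ℕ)) (blockLen b m) ω)) (Set.finite_range _).bddAbove ⟨j, hj⟩
  have hsup0 := (apply_nonneg ν _).trans (hsup 0 (numBlocks_pos b m))
  refine ⟨_, _, ?_, fun j hj => ?_, hB⟩
  · rw [sqrt_smul_blockEst_sub (φ := φ) hm]
    have h1 := abs_sub_map_le_sub ν
      (partialSumProcess φ X m ω 1 + √(m : ℝ) • remainder T F φ X 1 m ω)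
      (partialSumProcess φ X m ω 1)
    rw [add_sub_cancel_left, map_smul_eq_mul, Real.norm_of_nonneg (Real.sqrt_nonneg _)] at h1
    have h2 : 0 ≤ √(blockLen b m : ℝ) *
      (⨆ j : Fin (numBlocks b m), ν (remainder T F φ X (1 + (j : ℕ)) (blockLen b m) ω)) := by
      positivity
    rw [sub_right_comm]
    exact (abs_sub _ _).trans (by linarith)
  · have hjl : j + blockLen b m ≤ m := by
      have := blockLen_le hb1 m
      unfold numBlocks at hj
      omega
    rw [sqrt_smul_blockEst_sub_blockEst (F := F) (φ := φ) hb0 hm hjl, blockStat]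
    refine (abs_sub_map_le_sub ν _ _).trans ?_
    rw [add_sub_cancel_left]
    refine (map_sub_le_add ν _ _).trans ?_
    rw [map_smul_eq_mul, map_smul_eq_mul, Real.norm_of_nonneg (Real.sqrt_nonneg _)]
    have h1 : √(blockLen b m : ℝ) * ν (remainder T F φ X (1 + (j : ℤ)) (blockLen b m) ω) ≤
        √(blockLen b m : ℝ) *
        (⨆ j : Fin (numBlocks b m), ν (remainder T F φ X (1 + (j : ℕ)) (blockLen b m) ω)) :=
      mul_le_mul_of_nonneg_left (hsup j hj) (Real.sqrt_nonneg _)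
    have h2 : √(blockLen b m : ℝ) * ν (remainder T F φ X 1 m ω) ≤
        √(m : ℝ) * ν (remainder T F φ X 1 m ω) := by
      refine mul_le_mul_of_nonneg_right (Real.sqrt_le_sqrt ?_) (apply_nonneg _ _)
      exact_mod_cast blockLen_le hb1 m
    linarith [abs_nonneg δ]

end statistics

/-! ### The limit law of the p-value -/

section limitLaw

variable {Ω E : Type*} [MeasurableSpace Ω] {P : Measure Ω} {k : ℕ}
  {X : ℤ → Ω → E} {φ : E → Fin k → ℝ}

lemma IsStrictlyStationary.map_eq [MeasurableSpace E] (hX : ∀ t, Measurable (X t))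
    (h : IsStrictlyStationary P X)
    (t : ℤ) : P.map (X t) = P.map (X 0) := by
  have h1 := congrArg (Measure.map fun x : ℤ → E => x 0) (h t)
  rw [Measure.map_map (measurable_pi_apply 0) (measurable_pi_lambda _ fun s => hX _),
    Measure.map_map (measurable_pi_apply 0) (measurable_pi_lambda _ fun s => hX _)] at h1
  simpa [Function.comp_def] using h1

lemma aemeasurable_functional_partialSumProcess (hφX : ∀ t, AEMeasurable (fun ω => φ (X t ω)) P)
    {Ψ : (unitInterval → Fin k → ℝ) → ℝ} (hΨ : SupLipschitz Ψ) (n : ℕ) :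
    AEMeasurable (fun ω => Ψ (partialSumProcess φ X n ω)) P := by
  have h1 : AEMeasurable (fun ω (i : Fin (n + 1)) =>
      (√(n : ℝ))⁻¹ • ∑ j ∈ Finset.Icc 1 (i : ℕ), φ (X (j : ℤ) ω)) P :=
    aemeasurable_pi_lambda _ fun i =>
      (Finset.aemeasurable_fun_sum _ fun j _ => hφX _).const_smul (√(n : ℝ))⁻¹
  exact (hΨ.continuous_comp (gridIndex n)).measurable.comp_aemeasurable h1

variable [MeasurableSpace E] [IsProbabilityMeasure P] {Ω' : Type*} [MeasurableSpace Ω'] {P' : Measure Ω'}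
  [IsProbabilityMeasure P'] {W : Fin k → ℝ≥0 → Ω' → ℝ} {S : Matrix (Fin k) (Fin k) ℝ}
  {ν : Seminorm ℝ (Fin k → ℝ)} {b : ℝ} {F : Measure E} {T : Measure E → Fin k → ℝ}
  (hk : 1 ≤ k) (hν : ∀ v, ν v = 0 → v = 0) (hb0 : 0 < b) (hb1 : b ≤ 1)
  (hφX : ∀ t, AEMeasurable (fun ω => φ (X t ω)) P)
  (hS : S.PosDef) (hW : IsVectorBrownian P' W)
  (hFCLT : SkorokhodWeakConv P (fun n ω => partialSumProcess φ X n ω)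
      P' (fun ω' (r : unitInterval) => scaledBM S W ω' (r : ℝ)))
  (hRfull : TendstoInMeasure P
      (fun (n : ℕ) ω => √(n : ℝ) * ν (remainder T F φ X 1 n ω)) atTop (fun _ => 0))
  (hRblock : TendstoInMeasure P
      (fun (n : ℕ) ω => √(blockLen b n : ℝ) *
        ⨆ j : Fin (numBlocks b n), ν (remainder T F φ X (1 + (j : ℕ)) (blockLen b n) ω))
      atTop (fun _ => 0))

include hk hν hb0 hb1 hφX hS hW hFCLT hRfull hRblock

lemma eventually_windowPval_le {m : ℕ → ℕ} (hm : Tendsto m atTop atTop) {δ : ℕ → ℝ}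
    (hδ : Tendsto δ atTop (𝓝 0)) {B : Set ℝ} {y : ℝ} (hB : frontier B ⊆ {y}) {ε : ℝ}
    (hε : 0 < ε) :
    ∀ᶠ n in atTop, P.real {ω | windowPval ν T X b (m n) 1 (δ n) (T F) ω ∈ B} ≤
      P'.real {ω' | limitG ν S W b ω' ∈ B} + ε := by
  let Z : ℕ → Ω → ℝ := fun n ω => √(n : ℝ) * ν (remainder T F φ X 1 n ω) +
    √(blockLen b n : ℝ) *
      ⨆ j : Fin (numBlocks b n), ν (remainder T F φ X (1 + (j : ℕ)) (blockLen b n) ω)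
  have hZ : ∀ ε > 0, Tendsto (fun n => P.real {ω | ε < Z n ω}) atTop (𝓝 0) := by
    intro ε hε
    have h1 := TendstoInMeasure.tendsto_measureReal_lt hRfull (half_pos hε)
    have h2 := TendstoInMeasure.tendsto_measureReal_lt hRblock (half_pos hε)
    refine squeeze_zero (fun n => measureReal_nonneg) (fun n => ?_) (by simpa using h1.add h2)
    refine (measureReal_mono ?_).trans (measureReal_union_le _ _)
    intro ω hω
    have hω : ε < Z n ω := hω
    by_contra hcon
    rw [Set.mem_union, not_or] at hcon
    have c1 : √(n : ℝ) * ν (remainder T F φ X 1 n ω) ≤ ε / 2 := not_lt.1 hcon.1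
    have c2 : √(blockLen b n : ℝ) * (⨆ j : Fin (numBlocks b n),
      ν (remainder T F φ X (1 + (j : ℕ)) (blockLen b n) ω)) ≤ ε / 2 := not_lt.1 hcon.2
    simp only [Z] at hω
    linarith
  obtain ⟨η, hη0, hη, hPη⟩ := exists_tolerance hZ
  have hηδ : Tendsto (fun n => η (m n) + |δ n|) atTop (𝓝 0) := by
    simpa using (hη.comp hm).add hδ.abs
  let G : ℕ → Set Ω := fun n => {ω | 0 < m n ∧ Z (m n) ω ≤ η (m n) ∧
    windowPval ν T X b (m n) 1 (δ n) (T F) ω ∈ B}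
  have hmain := eventually_measureReal_le hFCLT
    (fun Ψ hΨ n => aemeasurable_functional_partialSumProcess hφX hΨ n)
    (hW.aemeasurable_bmPath S) (hW.continuous_bmPath S) hm
    (C := fun n => exceedSet ν b B (m n) (η (m n) + |δ n|)) (E := G)
    (fun n ω hω => partialSumProcess_mem_exceedSet hb0 hb1 hω.1 hω.2.2
      (add_le_add_left hω.2.1 _))
    (H := {ω' | limitG ν S W b ω' ∈ B}) ?_ (half_pos hε)
  · filter_upwards [hmain, hm.eventually_gt_atTop 0,
      (hPη.comp hm).eventually (gt_mem_nhds (half_pos hε))] with n h1 h2 h3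
    have hsub : {ω | windowPval ν T X b (m n) 1 (δ n) (T F) ω ∈ B} ⊆
        G n ∪ {ω | η (m n) < Z (m n) ω} := by
      intro ω hω
      rcases le_or_gt (Z (m n) ω) (η (m n)) with h | h
      · exact Or.inl ⟨h2, h, hω⟩
      · exact Or.inr h
    have h4 := (measureReal_mono hsub).trans (measureReal_union_le (μ := P) _ _)
    simp only [Function.comp] at h3
    linarith
  · filter_upwards [hW.continuous_bmPath S, hW.ae_crossFree hk hS hν hb0 hb1,
      ae_limitG_eq hW hk hS hν hb0 hb1, hW.ae_levelFrac_ne hk hS hν hb0 hb1 y] with ω' h1 h2 h3 h4 h5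
    rw [h3]
    exact levelFrac_mem_of_exceedSet ν hb0 hb1 hm hηδ h1 h2
      (fun hI hfr => h4 hI (hB hfr)) h5

/-- **Limit law of the p-value.** The centred p-value of a window of length `m n → ∞`, with a
vanishing relaxation `δ n`, converges to `limitG` on every set `B` with at most one frontier
point; the law of `limitG` may have atoms at `0` and `1`. -/
theorem tendsto_windowPval {m : ℕ → ℕ} (hm : Tendsto m atTop atTop) {δ : ℕ → ℝ}
    (hδ : Tendsto δ atTop (𝓝 0)) {B : Set ℝ} (hBm : MeasurableSet B) {y : ℝ}
    (hB : frontier B ⊆ {y}) :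
    Tendsto (fun n => P.real {ω | windowPval ν T X b (m n) 1 (δ n) (T F) ω ∈ B}) atTop
      (𝓝 (P'.real {ω' | limitG ν S W b ω' ∈ B})) := by
  have hG : NullMeasurableSet {ω' | limitG ν S W b ω' ∈ B} P' :=
    (aemeasurable_limitG hW hk hS hν hb0 hb1).nullMeasurableSet_preimage hBm
  have hcompl : P'.real {ω' | limitG ν S W b ω' ∈ Bᶜ} =
      1 - P'.real {ω' | limitG ν S W b ω' ∈ B} := probReal_compl_eq_one_sub₀ hG
  rw [Metric.tendsto_nhds]
  intro ε hε
  filter_upwards [eventually_windowPval_le hk hν hb0 hb1 hφX hS hW hFCLT hRfull hRblock hm hδ hB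
      (half_pos hε),
    eventually_windowPval_le hk hν hb0 hb1 hφX hS hW hFCLT hRfull hRblock hm hδ
      (B := Bᶜ) (by rwa [frontier_compl]) (half_pos hε)] with n h1 h2
  have h3 : (1 : ℝ) ≤ P.real {ω | windowPval ν T X b (m n) 1 (δ n) (T F) ω ∈ B} +
      P.real {ω | windowPval ν T X b (m n) 1 (δ n) (T F) ω ∈ Bᶜ} := by
    rw [← probReal_univ (μ := P)]
    refine (measureReal_mono ?_).trans (measureReal_union_le _ _)
    intro ω _
    exact Classical.em _
  rw [Real.dist_eq, abs_lt]
  constructor <;> linarith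

omit hk hν hb0 hb1 hS hRblock in
/-- The estimator from the full sample converges faster than `1 / √n'`. -/
lemma tendsto_sqrt_smul_blockEst_sub {n' : ℕ → ℕ}
    (hn'n : Tendsto (fun n : ℕ => (n' n : ℝ) / (n : ℝ)) atTop (𝓝 0)) {ε : ℝ} (hε : 0 < ε) :
    Tendsto (fun n => P.real {ω | ε < ν (√(n' n : ℝ) • (blockEst T X 1 n ω - T F))}) atTop
      (𝓝 0) := by
  obtain ⟨K, hK0, hK⟩ := seminorm_bound ν
  let C : ℕ → Set (unitInterval → Fin k → ℝ) := fun n =>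
    {s | ε < √((n' n : ℝ) / n) * (ν (s 1) + 1)}
  let G : ℕ → Set Ω := fun n => {ω | 0 < n ∧ √(n : ℝ) * ν (remainder T F φ X 1 n ω) ≤ 1 ∧
    ε < ν (√(n' n : ℝ) • (blockEst T X 1 n ω - T F))}
  have hC : ∀ n, ∀ ω ∈ G n, partialSumProcess φ X n ω ∈ C n := by
    rintro n ω ⟨hn, hR, hlt⟩
    have hn0 : (0 : ℝ) < n := by exact_mod_cast hn
    have hsn : 0 < √(n : ℝ) := Real.sqrt_pos.2 hn0
    have e : √(n' n : ℝ) • (blockEst T X 1 n ω - T F) =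
        √((n' n : ℝ) / n) • (√(n : ℝ) • (blockEst T X 1 n ω - T F)) := by
      rw [smul_smul, Real.sqrt_div (Nat.cast_nonneg _), div_mul_cancel₀ _ hsn.ne']
    rw [e, map_smul_eq_mul, Real.norm_of_nonneg (Real.sqrt_nonneg _),
      sqrt_smul_blockEst_sub (φ := φ) hn] at hlt
    refine hlt.trans_le (mul_le_mul_of_nonneg_left ?_ (Real.sqrt_nonneg _))
    refine (map_add_le_add ν _ _).trans (add_le_add le_rfl ?_)
    rwa [map_smul_eq_mul, Real.norm_of_nonneg (Real.sqrt_nonneg _)]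
  have hmain : ∀ ε' > 0, ∀ᶠ n in atTop, P.real (G n) ≤ P'.real (∅ : Set Ω') + ε' := by
    intro ε' hε'
    refine eventually_measureReal_le hFCLT
      (fun Ψ hΨ n => aemeasurable_functional_partialSumProcess hφX hΨ n)
      (hW.aemeasurable_bmPath S) (hW.continuous_bmPath S) tendsto_id hC
      (Eventually.of_forall fun ω' h => ?_) hε'
    have hlim : Tendsto (fun n => √((n' n : ℝ) / n) * (ν (bmPath S W ω' 1) + K + 1)) atTop
        (𝓝 0) := by
      simpa using hn'n.sqrt.mul_const (ν (bmPath S W ω' 1) + K + 1)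
    obtain ⟨n₀, hn₀⟩ := eventually_atTop.1 (hlim.eventually (gt_mem_nhds hε))
    obtain ⟨n, hn, s, hs, hd⟩ := h 1 one_pos n₀
    have hs : ε < √((n' n : ℝ) / n) * (ν (s 1) + 1) := hs
    have h1 := (abs_le.1 (abs_seminorm_sub_le ν hK (s 1) (bmPath S W ω' 1))).2
    have h2 : K * ‖s 1 - bmPath S W ω' 1‖ ≤ K * 1 := by
      refine mul_le_mul_of_nonneg_left ?_ hK0.le
      rw [← dist_eq_norm]
      exact hd 1
    have h3 : √((n' n : ℝ) / n) * (ν (s 1) + 1) ≤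
        √((n' n : ℝ) / n) * (ν (bmPath S W ω' 1) + K + 1) :=
      mul_le_mul_of_nonneg_left (by linarith) (Real.sqrt_nonneg _)
    linarith [hn₀ n hn]
  have hR := TendstoInMeasure.tendsto_measureReal_lt hRfull one_pos
  refine tendsto_order.2 ⟨fun a ha => Eventually.of_forall fun n => ha.trans_le measureReal_nonneg,
    fun a ha => ?_⟩
  filter_upwards [hmain (a / 2) (half_pos ha), hR.eventually (gt_mem_nhds (half_pos ha)),
    eventually_gt_atTop 0] with n h1 h2 h3
  have hsub : {ω | ε < ν (√(n' n : ℝ) • (blockEst T X 1 n ω - T F))} ⊆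
      G n ∪ {ω | 1 < √(n : ℝ) * ν (remainder T F φ X 1 n ω)} := by
    intro ω hω
    rcases le_or_gt (√(n : ℝ) * ν (remainder T F φ X 1 n ω)) 1 with h | h
    · exact Or.inl ⟨h3, h, hω⟩
    · exact Or.inr h
  have h4 := (measureReal_mono hsub).trans (measureReal_union_le (μ := P) _ _)
  simp only [measureReal_empty, zero_add] at h1
  linarith

end limitLaw

/-! ### A weak law of large numbers under strong mixing -/

section weakLaw

variable {Ω : Type*}

/-- The relative frequency of the events `A 1, …, A M`. -/
def freq (A : ℕ → Set Ω) (M : ℕ) (ω : Ω) : ℝ :=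
  (M : ℝ)⁻¹ * ∑ t ∈ Finset.Icc 1 M, (A t).indicator (fun _ => (1 : ℝ)) ω

lemma freq_mono {A A' : ℕ → Set Ω} {M : ℕ} {ω : Ω} (h : ∀ t, ω ∈ A t → ω ∈ A' t) :
    freq A M ω ≤ freq A' M ω := by
  classical
  refine mul_le_mul_of_nonneg_left (Finset.sum_le_sum fun t _ => ?_) (by positivity)
  by_cases h1 : ω ∈ A t
  · simp [h1, h t h1]
  · rw [Set.indicator_of_notMem h1]
    exact Set.indicator_nonneg (fun _ _ => zero_le_one) _

variable [MeasurableSpace Ω] {P : Measure Ω} [IsProbabilityMeasure P]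

/-- Chebyshev's inequality for events that are almost uncorrelated at distance at least `L`. -/
lemma measureReal_freq_sub_le {A : ℕ → Set Ω} (hA : ∀ t, MeasurableSet (A t)) {p : ℝ}
    (hp : ∀ t, P.real (A t) = p) {M L : ℕ} (hM : 0 < M) {ε : ℝ} (hε : 0 ≤ ε)
    (hcov : ∀ s t, s + L ≤ t → |P.real (A s ∩ A t) - p * p| ≤ ε) {η : ℝ} (hη : 0 < η) :
    P.real {ω | η ≤ |freq A M ω - p|} ≤ (2 * L / M + ε) / η ^ 2 := by
  classical
  have hM' : (0 : ℝ) < M := by exact_mod_cast hM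
  have hp0 : 0 ≤ p := hp 0 ▸ measureReal_nonneg
  have hp1 : p ≤ 1 := hp 0 ▸ measureReal_le_one
  let f : ℕ → Ω → ℝ := fun t ω => (A t).indicator (fun _ => (1 : ℝ)) ω - p
  have hind : ∀ t, Integrable ((A t).indicator fun _ => (1 : ℝ)) P := fun t =>
    (integrable_const 1).indicator (hA t)
  have hprod : ∀ s t ω, f s ω * f t ω = (A s ∩ A t).indicator (fun _ => (1 : ℝ)) ω -
      p * (A s).indicator (fun _ => (1 : ℝ)) ω - p * (A t).indicator (fun _ => (1 : ℝ)) ω +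
      p * p := by
    intro s t ω
    by_cases hs : ω ∈ A s <;> by_cases ht : ω ∈ A t <;> simp [f, hs, ht] <;> ring
  have hintST : ∀ s t, Integrable ((A s ∩ A t).indicator fun _ => (1 : ℝ)) P := fun s t =>
    (integrable_const 1).indicator ((hA s).inter (hA t))
  have hpi : ∀ s t, Integrable (fun ω => f s ω * f t ω) P := by
    intro s t
    simp only [hprod]
    exact (((hintST s t).sub ((hind s).const_mul p)).sub ((hind t).const_mul p)).add
      (integrable_const _)
  have hpint : ∀ s t, ∫ ω, f s ω * f t ω ∂P = P.real (A s ∩ A t) - p * p := by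
    intro s t
    simp only [hprod]
    have hI : ∀ S, MeasurableSet S → ∫ ω, S.indicator (fun _ => (1 : ℝ)) ω ∂P = P.real S := by
      intro S hS
      rw [integral_indicator hS]
      simp
    have i1 : Integrable (fun ω => (A s ∩ A t).indicator (fun _ => (1 : ℝ)) ω -
        p * (A s).indicator (fun _ => (1 : ℝ)) ω) P := (hintST s t).sub ((hind s).const_mul p)
    have i2 : Integrable (fun ω => (A s ∩ A t).indicator (fun _ => (1 : ℝ)) ω -
        p * (A s).indicator (fun _ => (1 : ℝ)) ω - p * (A t).indicator (fun _ => (1 : ℝ)) ω) P :=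
      i1.sub ((hind t).const_mul p)
    rw [integral_add i2 (integrable_const _), integral_sub i1 ((hind t).const_mul p),
      integral_sub (hintST s t) ((hind s).const_mul p), integral_const_mul, integral_const_mul,
      hI _ ((hA s).inter (hA t)), hI _ (hA s), hI _ (hA t), hp, hp]
    simp
  have hcov1 : ∀ s t, |P.real (A s ∩ A t) - p * p| ≤ 1 := by
    intro s t
    have h1 : P.real (A s ∩ A t) ≤ 1 := measureReal_le_one
    have h2 : 0 ≤ P.real (A s ∩ A t) := measureReal_nonneg
    rw [abs_le]
    constructor <;> nlinarith
  have hbound : ∀ s t, P.real (A s ∩ A t) - p * p ≤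
      (if t ∈ Finset.Ico (s - L) (s + L) then (1 : ℝ) else 0) + ε := by
    intro s t
    split_ifs with h
    · linarith [le_abs_self (P.real (A s ∩ A t) - p * p), hcov1 s t]
    · rw [zero_add]
      refine (le_abs_self _).trans ?_
      rw [Finset.mem_Ico, not_and_or, not_le, not_lt] at h
      rcases h with h | h
      · rw [Set.inter_comm]
        exact hcov t s (by omega)
      · exact hcov s t h
  have hfreq : ∀ ω, freq A M ω - p = (M : ℝ)⁻¹ * ∑ t ∈ Finset.Icc 1 M, f t ω := by
    intro ω
    simp only [f, Finset.sum_sub_distrib, mul_sub, freq]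
    simp [hM'.ne']
  have hsq : ∀ ω, (freq A M ω - p) ^ 2 = ((M : ℝ)⁻¹) ^ 2 *
      ∑ s ∈ Finset.Icc 1 M, ∑ t ∈ Finset.Icc 1 M, f s ω * f t ω := by
    intro ω
    rw [hfreq, mul_pow, sq (∑ t ∈ Finset.Icc 1 M, f t ω), Finset.sum_mul_sum]
  have hintsq : Integrable (fun ω => (freq A M ω - p) ^ 2) P := by
    simp only [hsq]
    exact (integrable_finsetSum _ fun s _ => integrable_finsetSum _ fun t _ => hpi s t).const_mul _
  have hvar : ∫ ω, (freq A M ω - p) ^ 2 ∂P ≤ 2 * L / M + ε := by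
    simp only [hsq]
    rw [integral_const_mul, integral_finsetSum _ fun s _ =>
      integrable_finsetSum _ fun t _ => hpi s t]
    have h1 : ∀ s ∈ Finset.Icc 1 M, ∫ ω, ∑ t ∈ Finset.Icc 1 M, f s ω * f t ω ∂P ≤
        2 * L + M * ε := by
      intro s _
      rw [integral_finsetSum _ fun t _ => hpi s t]
      simp only [hpint]
      refine (Finset.sum_le_sum fun t _ => hbound s t).trans ?_
      rw [Finset.sum_add_distrib, Finset.sum_boole]
      have hcard : ((Finset.Icc 1 M).filter fun t => t ∈ Finset.Ico (s - L) (s + L)).card ≤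
          2 * L := by
        refine (Finset.card_le_card (t := Finset.Ico (s - L) (s + L)) fun t ht =>
          (Finset.mem_filter.1 ht).2).trans ?_
        rw [Nat.card_Ico]
        omega
      have hcard' : (((Finset.Icc 1 M).filter fun t => t ∈ Finset.Ico (s - L) (s + L)).card : ℝ) ≤
          2 * L := by exact_mod_cast hcard
      simpa using hcard'
    calc ((M : ℝ)⁻¹) ^ 2 * ∑ s ∈ Finset.Icc 1 M, ∫ ω, ∑ t ∈ Finset.Icc 1 M, f s ω * f t ω ∂P
        ≤ ((M : ℝ)⁻¹) ^ 2 * ∑ _s ∈ Finset.Icc 1 M, (2 * L + M * ε) :=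
          mul_le_mul_of_nonneg_left (Finset.sum_le_sum h1) (by positivity)
      _ = 2 * L / M + ε := by
          rw [Finset.sum_const, Nat.card_Icc, nsmul_eq_mul, Nat.add_sub_cancel]
          field_simp
  have hcheb := mul_meas_ge_le_integral_of_nonneg
    (Eventually.of_forall fun ω => sq_nonneg (freq A M ω - p)) hintsq (η ^ 2)
  rw [le_div_iff₀ (by positivity), mul_comm]
  refine le_trans ?_ (hcheb.trans hvar)
  refine mul_le_mul_of_nonneg_left (measureReal_mono fun ω hω => ?_) (by positivity)
  have hω : η ≤ |freq A M ω - p| := hω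
  change η ^ 2 ≤ (freq A M ω - p) ^ 2
  rw [← sq_abs (freq A M ω - p)]
  exact pow_le_pow_left₀ hη.le hω 2

end weakLaw

/-! ### Window p-values along a stationary mixing sequence -/

section window

variable {E : Type*} [MeasurableSpace E] {k : ℕ} {ν : Seminorm ℝ (Fin k → ℝ)}
  {T : Measure E → Fin k → ℝ} {b : ℝ}

/-- The p-value of a window is measurable for every `σ`-algebra for which the window is. -/
lemma measurable_windowPval {Ω : Type*} {mΩ : MeasurableSpace Ω} {X : ℤ → Ω → E}
    (hT : ∀ m : ℕ, Measurable fun x : Fin m → E => T (empirical x)) (hb1 : b ≤ 1) {m : ℕ} {t : ℤ}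
    (hX : ∀ s, t ≤ s → s < t + m → Measurable (X s)) (δ : ℝ) (θ : Fin k → ℝ) :
    Measurable (windowPval ν T X b m t δ θ) := by
  classical
  have hblock : ∀ (j l : ℕ), j + l ≤ m → Measurable (blockEst T X (t + (j : ℤ)) l) := by
    intro j l hjl
    refine (hT l).comp (measurable_pi_lambda _ fun i => hX _ (by omega) ?_)
    have := i.2
    omega
  have h1 : Measurable (blockEst T X t m) := by simpa using hblock 0 m (by omega)
  have hν := (seminorm_continuous ν).measurable
  unfold windowPval exceed
  refine Measurable.const_mul (Finset.measurable_fun_sum _ fun j hj => ?_) _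
  refine Measurable.ite (measurableSet_le ?_ ?_) measurable_const measurable_const
  · exact (hν.comp ((h1.sub_const θ).const_smul (√(m : ℝ)))).sub_const δ
  · have hjl : j + blockLen b m ≤ m := by
      have h2 := blockLen_le hb1 m
      have h3 := Finset.mem_range.1 hj
      unfold numBlocks at h3
      omega
    exact hν.comp (((hblock j _ hjl).sub h1).const_smul (√(blockLen b m : ℝ)))

variable {Ω : Type*} {X : ℤ → Ω → E}

lemma windowPval_shift (m : ℕ) (t : ℤ) (δ : ℝ) (θ : Fin k → ℝ) (ω : Ω) :
    windowPval ν T X b m t δ θ ω =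
      windowPval ν T (fun s (x : ℤ → E) => x s) b m 1 δ θ (fun s => X (s + (t - 1)) ω) := by
  have h : ∀ (j : ℤ) (l : ℕ), blockEst T X (t + j) l ω =
      blockEst T (fun s (x : ℤ → E) => x s) (1 + j) l (fun s => X (s + (t - 1)) ω) := by
    intro j l
    unfold blockEst
    congr 2
    ext i
    congr 1
    ring
  have h0 := h 0 m
  rw [add_zero, add_zero] at h0
  unfold windowPval
  simp only [h, h0]

lemma measurable_sigmaOf {s : ℤ} {I : Set ℤ} (hs : s ∈ I) : Measurable[sigmaOf X I] (X s) :=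
  (comap_measurable (X s)).mono (le_iSup₂_of_le s hs le_rfl) le_rfl

variable [MeasurableSpace Ω] {P : Measure Ω}

/-- By stationarity, all windows of the same length have the same law. -/
lemma measureReal_windowPval_eq (hT : ∀ m : ℕ, Measurable fun x : Fin m → E => T (empirical x))
    (hb1 : b ≤ 1) (hX : ∀ t, Measurable (X t)) (hstat : IsStrictlyStationary P X) (m : ℕ) (t : ℤ)
    (δ : ℝ) (θ : Fin k → ℝ) {B : Set ℝ} (hB : MeasurableSet B) :
    P.real {ω | windowPval ν T X b m t δ θ ω ∈ B} =
      P.real {ω | windowPval ν T X b m 1 δ θ ω ∈ B} := by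
  have hm : MeasurableSet {x : ℤ → E |
      windowPval ν T (fun s (x : ℤ → E) => x s) b m 1 δ θ x ∈ B} :=
    measurable_windowPval hT hb1 (fun s _ _ => measurable_pi_apply s) δ θ hB
  have key : ∀ t : ℤ, P {ω | windowPval ν T X b m t δ θ ω ∈ B} =
      P.map (fun ω (s : ℤ) => X s ω) {x : ℤ → E |
        windowPval ν T (fun s (x : ℤ → E) => x s) b m 1 δ θ x ∈ B} := by
    intro t
    rw [← hstat (t - 1), Measure.map_apply (measurable_pi_lambda _ fun s => hX _) hm]
    congr 1
    ext ω
    simp only [Set.mem_ofPred_eq, Set.mem_preimage]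
    rw [windowPval_shift]
  rw [measureReal_def, measureReal_def, key, key]

lemma abs_sub_le_alphaCoeff [IsProbabilityMeasure P] {m : ℕ} {s : ℤ} {A B : Set Ω}
    (hA : MeasurableSet[sigmaOf X (Set.Iic s)] A)
    (hB : MeasurableSet[sigmaOf X (Set.Ici (s + m))] B) :
    |P.real (A ∩ B) - P.real A * P.real B| ≤ alphaCoeff P X m := by
  refine le_csSup ⟨1, ?_⟩ ⟨s, A, B, hA, hB, rfl⟩
  rintro r ⟨s, A, B, -, -, rfl⟩
  have h1 : P.real (A ∩ B) ≤ 1 := measureReal_le_one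
  have h2 : 0 ≤ P.real (A ∩ B) := measureReal_nonneg
  have h3 : P.real A ≤ 1 := measureReal_le_one
  have h4 : 0 ≤ P.real A := measureReal_nonneg
  have h5 : P.real B ≤ 1 := measureReal_le_one
  have h6 : 0 ≤ P.real B := measureReal_nonneg
  rw [abs_le]
  constructor <;> nlinarith

lemma abs_windowPval_sub_le [IsProbabilityMeasure P]
    (hT : ∀ m : ℕ, Measurable fun x : Fin m → E => T (empirical x)) (hb1 : b ≤ 1)
    {m j : ℕ} {s t : ℤ} (hst : s + m + j ≤ t + 1) (δ : ℝ) (θ : Fin k → ℝ)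
    {B : Set ℝ} (hB : MeasurableSet B) :
    |P.real ({ω | windowPval ν T X b m s δ θ ω ∈ B} ∩ {ω | windowPval ν T X b m t δ θ ω ∈ B}) -
      P.real {ω | windowPval ν T X b m s δ θ ω ∈ B} *
      P.real {ω | windowPval ν T X b m t δ θ ω ∈ B}| ≤ alphaCoeff P X j := by
  refine abs_sub_le_alphaCoeff (s := s + m - 1) ?_ ?_
  · exact measurable_windowPval hT hb1
      (fun r _ hr => measurable_sigmaOf (Set.mem_Iic.2 (by omega))) δ θ hB
  · exact measurable_windowPval hT hb1
      (fun r hr _ => measurable_sigmaOf (Set.mem_Ici.2 (by omega))) δ θ hB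

end window

/-! ### Convergence of the second stage frequencies -/

section frequencies

variable {Ω E : Type*} [MeasurableSpace Ω] [MeasurableSpace E] {P : Measure Ω}
  [IsProbabilityMeasure P] {k : ℕ} {X : ℤ → Ω → E} {ν : Seminorm ℝ (Fin k → ℝ)} {b : ℝ}
  {T : Measure E → Fin k → ℝ}

lemma eventually_le_numWindows {n' : ℕ → ℕ}
    (hn'n : Tendsto (fun n : ℕ => (n' n : ℝ) / (n : ℝ)) atTop (𝓝 0)) :
    ∀ᶠ n : ℕ in atTop, (n : ℝ) / 2 ≤ ((n - n' n + 1 : ℕ) : ℝ) := by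
  filter_upwards [hn'n.eventually (gt_mem_nhds (show (0 : ℝ) < 1 / 2 by norm_num)),
    eventually_gt_atTop 0] with n h1 h2
  have h2' : (0 : ℝ) < n := by exact_mod_cast h2
  rw [div_lt_iff₀ h2'] at h1
  have h3 : n' n ≤ n := by
    have : (n' n : ℝ) ≤ n := by linarith
    exact_mod_cast this
  rw [Nat.cast_add, Nat.cast_sub h3, Nat.cast_one]
  linarith

lemma tendsto_div_numWindows {n' : ℕ → ℕ}
    (hn'n : Tendsto (fun n : ℕ => (n' n : ℝ) / (n : ℝ)) atTop (𝓝 0)) (j : ℕ) :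
    Tendsto (fun n => (2 * ((n' n + j : ℕ) : ℝ)) / ((n - n' n + 1 : ℕ) : ℝ)) atTop (𝓝 0) := by
  have h1 : Tendsto (fun n : ℕ => 4 * ((n' n : ℝ) / n + (j : ℝ) / n)) atTop (𝓝 0) := by
    simpa using (hn'n.add (tendsto_const_div_atTop_nhds_zero_nat (j : ℝ))).const_mul 4
  refine squeeze_zero' (Eventually.of_forall fun n => by positivity) ?_ h1
  filter_upwards [eventually_le_numWindows hn'n, eventually_gt_atTop 0] with n h2 h3
  have h3' : (0 : ℝ) < n := by exact_mod_cast h3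
  calc (2 * ((n' n + j : ℕ) : ℝ)) / ((n - n' n + 1 : ℕ) : ℝ)
      ≤ (2 * ((n' n + j : ℕ) : ℝ)) / ((n : ℝ) / 2) := by gcongr
    _ = 4 * ((n' n : ℝ) / n + (j : ℝ) / n) := by
        push_cast
        field_simp
        ring

/-- The frequency of the windows with p-value in `B` concentrates at its limiting expectation. -/
lemma tendsto_freq_windowPval
    (hT : ∀ m : ℕ, Measurable fun x : Fin m → E => T (empirical x)) (hb1 : b ≤ 1)
    (hX : ∀ t, Measurable (X t)) (hstat : IsStrictlyStationary P X) (hmix : IsAlphaMixing P X)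
    {n' : ℕ → ℕ} (hn'n : Tendsto (fun n : ℕ => (n' n : ℝ) / (n : ℝ)) atTop (𝓝 0))
    {δ : ℕ → ℝ} {θ : Fin k → ℝ} {B : Set ℝ} (hB : MeasurableSet B) {p : ℝ}
    (hp : Tendsto (fun n => P.real {ω | windowPval ν T X b (n' n) 1 (δ n) θ ω ∈ B}) atTop (𝓝 p))
    {η : ℝ} (hη : 0 < η) :
    Tendsto (fun n => P.real {ω | η ≤ |freq (fun t =>
      {ω | windowPval ν T X b (n' n) t (δ n) θ ω ∈ B}) (n - n' n + 1) ω - p|}) atTop (𝓝 0) := by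
  refine tendsto_order.2 ⟨fun a ha => Eventually.of_forall fun n => ha.trans_le measureReal_nonneg,
    fun a ha => ?_⟩
  set ε := a * (η / 2) ^ 2 / 2 with hε
  have hε0 : 0 < ε := by positivity
  obtain ⟨j, hj⟩ := eventually_atTop.1 (hmix.eventually (gt_mem_nhds hε0))
  filter_upwards [(tendsto_div_numWindows hn'n j).eventually (gt_mem_nhds hε0),
    hp.eventually (Metric.ball_mem_nhds p (half_pos hη))] with n h1 h2
  set pn := P.real {ω | windowPval ν T X b (n' n) 1 (δ n) θ ω ∈ B}
  have h3 := measureReal_freq_sub_le (P := P)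
    (A := fun t : ℕ => {ω | windowPval ν T X b (n' n) t (δ n) θ ω ∈ B})
    (fun t => measurable_windowPval hT hb1 (fun s _ _ => hX s) _ _ hB) (p := pn)
    (fun t => measureReal_windowPval_eq hT hb1 hX hstat _ _ _ _ hB)
    (M := n - n' n + 1) (L := n' n + j) (Nat.succ_pos _) hε0.le ?_ (half_pos hη)
  · refine lt_of_le_of_lt (measureReal_mono fun ω hω => ?_) (h3.trans_lt ?_)
    · have h2' : |pn - p| < η / 2 := by rw [← Real.dist_eq]; exact h2
      have hω : η ≤ |freq (fun t : ℕ => {ω | windowPval ν T X b (n' n) t (δ n) θ ω ∈ B})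
        (n - n' n + 1) ω - p| := hω
      change η / 2 ≤ |_ - pn|
      have := abs_sub_le (freq (fun t : ℕ => {ω | windowPval ν T X b (n' n) t (δ n) θ ω ∈ B})
        (n - n' n + 1) ω) pn p
      linarith
    · rw [div_lt_iff₀ (by positivity)]
      linarith
  · intro s t hst
    have h4 := abs_windowPval_sub_le (P := P) (X := X) (ν := ν) hT hb1 (m := n' n) (j := t - s - n' n)
      (s := s) (t := t) (by omega) (δ n) θ hB
    rw [measureReal_windowPval_eq hT hb1 hX hstat _ s _ _ hB,
      measureReal_windowPval_eq hT hb1 hX hstat _ t _ _ hB] at h4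
    exact h4.trans (hj _ (by omega)).le

/-- The second stage p-values, centred at the full sample estimator, have the same limiting
frequencies as the window p-values, centred at the parameter. -/
lemma tendsto_freq_subPval
    (hT : ∀ m : ℕ, Measurable fun x : Fin m → E => T (empirical x)) (hb1 : b ≤ 1)
    (hX : ∀ t, Measurable (X t)) (hstat : IsStrictlyStationary P X) (hmix : IsAlphaMixing P X)
    {n' : ℕ → ℕ} (hn'n : Tendsto (fun n : ℕ => (n' n : ℝ) / (n : ℝ)) atTop (𝓝 0))
    {θ : Fin k → ℝ} {B : Set ℝ} (hB : MeasurableSet B) (hlow : IsLowerSet B) {p : ℝ}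
    (hp : ∀ δ : ℕ → ℝ, Tendsto δ atTop (𝓝 0) → Tendsto (fun n =>
      P.real {ω | windowPval ν T X b (n' n) 1 (δ n) θ ω ∈ B}) atTop (𝓝 p))
    (hcenter : ∀ ε > 0, Tendsto (fun n =>
      P.real {ω | ε < ν (√(n' n : ℝ) • (blockEst T X 1 n ω - θ))}) atTop (𝓝 0))
    {η : ℝ} (hη : 0 < η) :
    Tendsto (fun n => P.real {ω | η ≤ |freq (fun t =>
      {ω | subPval ν T X b n (n' n) t ω ∈ B}) (n - n' n + 1) ω - p|}) atTop (𝓝 0) := by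
  obtain ⟨δ, hδ0, hδ, hPδ⟩ := exists_tolerance hcenter
  have hδ' : Tendsto (fun n => -δ n) atTop (𝓝 0) := by simpa using hδ.neg
  have h1 := tendsto_freq_windowPval hT hb1 hX hstat hmix hn'n hB (hp δ hδ) hη
  have h2 := tendsto_freq_windowPval hT hb1 hX hstat hmix hn'n hB (hp _ hδ') hη
  refine squeeze_zero (fun n => measureReal_nonneg) (fun n => ?_)
    (by simpa using (h1.add h2).add hPδ)
  refine (measureReal_mono ?_).trans ((measureReal_union_le _ _).trans
    (add_le_add (measureReal_union_le _ _) le_rfl))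
  intro ω hω
  have hω : η ≤ |freq (fun t => {ω | subPval ν T X b n (n' n) t ω ∈ B}) (n - n' n + 1) ω - p| := hω
  by_contra hcon
  simp only [Set.mem_union, not_or, Set.mem_ofPred_eq, not_le, not_lt] at hcon
  obtain ⟨⟨c1, c2⟩, c3⟩ := hcon
  have c3' : ν (√(n' n : ℝ) • (θ - blockEst T X 1 n ω)) ≤ δ n := by
    rw [← neg_sub, smul_neg, map_neg_eq_map]
    exact c3
  have lo : freq (fun t : ℕ => {ω | windowPval ν T X b (n' n) t (δ n) θ ω ∈ B}) (n - n' n + 1) ω ≤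
      freq (fun t => {ω | subPval ν T X b n (n' n) t ω ∈ B}) (n - n' n + 1) ω := by
    refine freq_mono fun t ht => ?_
    change subPval ν T X b n (n' n) t ω ∈ B
    rw [subPval_eq_windowPval]
    exact hlow (windowPval_le_of_center c3 (by simp)) ht
  have hi : freq (fun t => {ω | subPval ν T X b n (n' n) t ω ∈ B}) (n - n' n + 1) ω ≤
      freq (fun t : ℕ => {ω | windowPval ν T X b (n' n) t (-δ n) θ ω ∈ B}) (n - n' n + 1) ω := by
    refine freq_mono fun t ht => ?_
    have ht : subPval ν T X b n (n' n) t ω ∈ B := ht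
    rw [subPval_eq_windowPval] at ht
    exact hlow (windowPval_le_of_center c3' (by simp)) ht
  rw [abs_lt] at c1 c2
  refine absurd hω (not_le.2 (abs_lt.2 ⟨by linarith, by linarith⟩))

end frequencies

/-! ### Quantiles -/

section quantile

/-- The quantile function is the lower adjoint of a right continuous distribution function. -/
lemma quantile_le_iff {H : ℝ → ℝ} (hmono : Monotone H)
    (hcont : ∀ y, ContinuousWithinAt H (Set.Ioi y) y) {a : ℝ} (hne : ∃ x, a ≤ H x)
    (hbdd : BddBelow {x | a ≤ H x}) {y : ℝ} : quantile H a ≤ y ↔ a ≤ H y := by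
  refine ⟨fun h => ?_, fun h => csInf_le hbdd h⟩
  refine ge_of_tendsto (hcont y) ?_
  filter_upwards [self_mem_nhdsWithin] with x hx
  obtain ⟨z, hz, hzx⟩ := exists_lt_of_csInf_lt hne (h.trans_lt hx)
  exact le_trans hz (hmono hzx.le)

variable {μ : Measure ℝ} {a : ℝ}

lemma quantile_cdf_le_iff (h0 : 0 < a) (h1 : a < 1) {y : ℝ} :
    quantile (cdf μ) a ≤ y ↔ a ≤ cdf μ y := by
  obtain ⟨x, hx⟩ := ((tendsto_cdf_atTop μ).eventually (lt_mem_nhds h1)).exists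
  obtain ⟨z, hz⟩ := ((tendsto_cdf_atBot μ).eventually (gt_mem_nhds h0)).exists
  refine quantile_le_iff (monotone_cdf μ)
    (fun y => ((cdf μ).right_continuous y).mono Set.Ioi_subset_Ici_self) ⟨x, hx.le⟩ ⟨z, fun w hw => ?_⟩
  by_contra! hwz
  exact absurd (hw.trans (monotone_cdf μ hwz.le)) (not_le.2 hz)

variable [IsProbabilityMeasure μ]

lemma tendsto_cdf_nhdsLT (y : ℝ) : Tendsto (cdf μ) (𝓝[<] y) (𝓝 (μ.real (Set.Iio y))) := by
  have h1 : μ.real (Set.Iio y) = Function.leftLim (cdf μ) y := by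
    rw [measureReal_def]
    conv_lhs => rw [← measure_cdf μ]
    rw [StieltjesFunction.measure_Iio _ (tendsto_cdf_atBot μ), sub_zero, ENNReal.toReal_ofReal]
    exact (monotone_cdf μ).le_leftLim (sub_one_lt y) |>.trans' (cdf_nonneg μ _)
  rw [h1]
  exact (monotone_cdf μ).tendsto_leftLim y

lemma measureReal_Iio_quantile_le (h0 : 0 < a) (h1 : a < 1) :
    μ.real (Set.Iio (quantile (cdf μ) a)) ≤ a := by
  refine le_of_tendsto (tendsto_cdf_nhdsLT _) ?_
  filter_upwards [self_mem_nhdsWithin] with x hx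
  exact (not_le.1 fun h => not_le.2 hx ((quantile_cdf_le_iff h0 h1).2 h)).le

/-- **Pólya's argument.** A distribution function that is close to `cdf μ`, and whose left limits
are close to those of `cdf μ`, at finitely many quantiles of `μ`, is uniformly close to `cdf μ`. -/
lemma exists_finset_forall_abs_sub_cdf_le (μ : Measure ℝ) [IsProbabilityMeasure μ] {ε : ℝ}
    (hε : 0 < ε) : ∃ s : Finset ℝ, ∀ H H' : ℝ → ℝ, (∀ x, 0 ≤ H x) → (∀ x, H x ≤ 1) → Monotone H →
      (∀ x y, x < y → H x ≤ H' y) →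
      (∀ y ∈ s, |H y - cdf μ y| ≤ ε ∧ |H' y - μ.real (Set.Iio y)| ≤ ε) →
      ∀ x, |H x - cdf μ x| ≤ 2 * ε := by
  obtain ⟨K, hK⟩ := exists_nat_one_div_lt hε
  set M : ℕ := K + 1 with hM
  have hM0 : (0 : ℝ) < M := by rw [hM]; positivity
  have hMε : 1 / (M : ℝ) < ε := by rw [hM]; exact_mod_cast hK
  refine ⟨(Finset.Ico 1 M).image fun i : ℕ => quantile (cdf μ) ((i : ℝ) / M),
    fun H H' hH0 hH1 hmono hHH' hs x => ?_⟩
  have hs' : ∀ i : ℕ, 1 ≤ i → i < M → 0 < (i : ℝ) / M ∧ (i : ℝ) / M < 1 ∧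
      |H (quantile (cdf μ) ((i : ℝ) / M)) - cdf μ (quantile (cdf μ) ((i : ℝ) / M))| ≤ ε ∧
      |H' (quantile (cdf μ) ((i : ℝ) / M)) - μ.real (Set.Iio (quantile (cdf μ) ((i : ℝ) / M)))| ≤
        ε := by
    intro i h1 h2
    have h1' : (0 : ℝ) < i := by exact_mod_cast h1
    have h2' : (i : ℝ) < M := by exact_mod_cast h2
    exact ⟨by positivity, (div_lt_one hM0).2 h2',
      hs _ (Finset.mem_image_of_mem _ (Finset.mem_Ico.2 ⟨h1, h2⟩))⟩
  have hc0 : 0 ≤ cdf μ x := cdf_nonneg μ x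
  have hc1 : cdf μ x ≤ 1 := cdf_le_one μ x
  have hMx : 0 ≤ (M : ℝ) * cdf μ x := by positivity
  set i := ⌊(M : ℝ) * cdf μ x⌋₊ with hi
  have hi1 : (i : ℝ) ≤ M * cdf μ x := Nat.floor_le hMx
  have hi2 : (M : ℝ) * cdf μ x < i + 1 := Nat.lt_floor_add_one _
  rw [abs_le]
  constructor
  · -- the largest quantile `i / M` not above `x`, `i < M`
    obtain ⟨j, hjM, hji, hj⟩ : ∃ j : ℕ, j < M ∧ (j : ℝ) / M ≤ cdf μ x ∧
        cdf μ x ≤ (j : ℝ) / M + 1 / M := by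
      by_cases hiM : i < M
      · refine ⟨i, hiM, ?_, ?_⟩
        · rwa [div_le_iff₀' hM0]
        · rw [← add_div, le_div_iff₀' hM0]
          exact hi2.le
      · refine ⟨K, by omega, ?_, ?_⟩
        · have : (M : ℝ) ≤ i := by exact_mod_cast not_lt.1 hiM
          rw [div_le_iff₀' hM0]
          refine le_trans ?_ (this.trans hi1)
          rw [hM]; push_cast; linarith
        · refine hc1.trans (le_of_eq ?_)
          rw [← add_div, eq_comm, div_eq_one_iff_eq hM0.ne', hM]
          push_cast; ring
    rcases Nat.eq_zero_or_pos j with rfl | hj0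
    · simp only [Nat.cast_zero, zero_div, zero_add] at hj
      linarith [hH0 x]
    · obtain ⟨p0, p1, p2, -⟩ := hs' j hj0 hjM
      have h1 : quantile (cdf μ) ((j : ℝ) / M) ≤ x := (quantile_cdf_le_iff p0 p1).2 hji
      have h2 : (j : ℝ) / M ≤ cdf μ (quantile (cdf μ) ((j : ℝ) / M)) :=
        (quantile_cdf_le_iff p0 p1).1 le_rfl
      linarith [(abs_le.1 p2).1, hmono h1]
  · have hnext : ((i + 1 : ℕ) : ℝ) / M ≤ cdf μ x + 1 / M := by
      rw [← sub_le_iff_le_add, ← sub_div, div_le_iff₀' hM0]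
      push_cast
      linarith
    by_cases hiM : i + 1 < M
    · obtain ⟨p0, p1, -, p3⟩ := hs' (i + 1) (by omega) hiM
      have h1 : x < quantile (cdf μ) (((i + 1 : ℕ) : ℝ) / M) := by
        rw [← not_le, quantile_cdf_le_iff p0 p1, not_le, lt_div_iff₀' hM0]
        push_cast
        exact hi2
      linarith [(abs_le.1 p3).2, hHH' _ _ h1, measureReal_Iio_quantile_le (μ := μ) p0 p1]
    · have h1 : (1 : ℝ) ≤ ((i + 1 : ℕ) : ℝ) / M := by
        rw [one_le_div₀ hM0]
        exact_mod_cast not_lt.1 hiM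
      linarith [hH1 x]

end quantile

/-! ### The empirical distribution of the second stage p-values -/

section subDist

variable {Ω E : Type*} [MeasurableSpace E] {k : ℕ} {X : ℤ → Ω → E} {ν : Seminorm ℝ (Fin k → ℝ)}
  {b : ℝ} {T : Measure E → Fin k → ℝ}

lemma subDist_eq_freq (n m : ℕ) (ω : Ω) (x : ℝ) : subDist ν T X b n m ω x =
    freq (fun t => {ω | subPval ν T X b n m t ω ∈ Set.Iic x}) (n - m + 1) ω := by
  classical
  unfold subDist freq
  congr 1

lemma freq_nonneg (A : ℕ → Set Ω) (M : ℕ) (ω : Ω) : 0 ≤ freq A M ω :=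
  mul_nonneg (by positivity) (Finset.sum_nonneg fun t _ =>
    Set.indicator_nonneg (fun _ _ => zero_le_one) _)

lemma freq_univ {M : ℕ} (hM : 0 < M) (ω : Ω) : freq (fun _ => Set.univ) M ω = 1 := by
  have : (M : ℝ) ≠ 0 := by positivity
  simp [freq, this]

lemma freq_le_one {M : ℕ} (hM : 0 < M) (A : ℕ → Set Ω) (ω : Ω) : freq A M ω ≤ 1 := by
  rw [← freq_univ hM ω]
  exact freq_mono fun t _ => Set.mem_univ ω

lemma subDist_mono (n m : ℕ) (ω : Ω) : Monotone (subDist ν T X b n m ω) := by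
  intro x y hxy
  rw [subDist_eq_freq, subDist_eq_freq]
  exact freq_mono fun t ht => le_trans (b := x) ht hxy

lemma subDist_nonneg (n m : ℕ) (ω : Ω) (x : ℝ) : 0 ≤ subDist ν T X b n m ω x := by
  rw [subDist_eq_freq]
  exact freq_nonneg _ _ _

lemma subDist_le_one (n m : ℕ) (ω : Ω) (x : ℝ) : subDist ν T X b n m ω x ≤ 1 := by
  rw [subDist_eq_freq]
  exact freq_le_one (Nat.succ_pos _) _ _

lemma subPval_mem_Icc (n m t : ℕ) (ω : Ω) : subPval ν T X b n m t ω ∈ Set.Icc (0 : ℝ) 1 := by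
  rw [subPval_eq_windowPval]
  exact ⟨exceed_nonneg _ _ _, exceed_le_one _ _ _⟩

lemma subDist_one (n m : ℕ) (ω : Ω) : subDist ν T X b n m ω 1 = 1 := by
  refine le_antisymm (subDist_le_one _ _ _ _) ?_
  rw [subDist_eq_freq]
  refine (freq_univ (Nat.succ_pos (n - m)) ω).symm.le.trans (freq_mono fun t _ => ?_)
  exact (subPval_mem_Icc n m t ω).2

lemma subDist_of_neg (n m : ℕ) (ω : Ω) {x : ℝ} (hx : x < 0) : subDist ν T X b n m ω x = 0 := by
  unfold subDist
  rw [Finset.sum_eq_zero, mul_zero]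
  intro t _
  exact if_neg (not_le.2 (hx.trans_le (subPval_mem_Icc n m t ω).1))

lemma subDist_continuousWithinAt (n m : ℕ) (ω : Ω) (y : ℝ) :
    ContinuousWithinAt (subDist ν T X b n m ω) (Set.Ioi y) y := by
  classical
  refine ContinuousWithinAt.mul continuousWithinAt_const (tendsto_finsetSum _ fun t _ => ?_)
  by_cases h : subPval ν T X b n m t ω ≤ y
  · rw [if_pos h]
    refine tendsto_const_nhds.congr' ?_
    filter_upwards [self_mem_nhdsWithin] with x hx
    rw [if_pos (h.trans (le_of_lt hx))]
  · rw [if_neg h]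
    refine tendsto_const_nhds.congr' ?_
    filter_upwards [mem_nhdsWithin_of_mem_nhds (gt_mem_nhds (not_le.1 h))] with x hx
    exact (if_neg (not_le.2 hx)).symm

lemma quantile_subDist_le_iff {n m : ℕ} {ω : Ω} {a : ℝ} (h0 : 0 < a) (h1 : a < 1) {y : ℝ} :
    quantile (subDist ν T X b n m ω) a ≤ y ↔ a ≤ subDist ν T X b n m ω y := by
  refine quantile_le_iff (subDist_mono n m ω) (subDist_continuousWithinAt n m ω)
    ⟨1, by rw [subDist_one]; exact h1.le⟩ ⟨0, fun x hx => ?_⟩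
  by_contra! hx0
  have hx : a ≤ subDist ν T X b n m ω x := hx
  rw [subDist_of_neg n m ω hx0] at hx
  linarith

variable [MeasurableSpace Ω] {P : Measure Ω} [IsProbabilityMeasure P]

/-- Uniform convergence in probability of the second stage distribution function. -/
lemma tendsto_measureReal_exists_lt {μ : Measure ℝ} [IsProbabilityMeasure μ] {n' : ℕ → ℕ}
    (hIic : ∀ y, ∀ η > 0, Tendsto (fun n => P.real {ω | η ≤ |freq (fun t =>
      {ω | subPval ν T X b n (n' n) t ω ∈ Set.Iic y}) (n - n' n + 1) ω - μ.real (Set.Iic y)|})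
      atTop (𝓝 0))
    (hIio : ∀ y, ∀ η > 0, Tendsto (fun n => P.real {ω | η ≤ |freq (fun t =>
      {ω | subPval ν T X b n (n' n) t ω ∈ Set.Iio y}) (n - n' n + 1) ω - μ.real (Set.Iio y)|})
      atTop (𝓝 0)) {ε : ℝ} (hε : 0 < ε) :
    Tendsto (fun n => P.real {ω | ∃ x, ε < |subDist ν T X b n (n' n) ω x - cdf μ x|}) atTop
      (𝓝 0) := by
  obtain ⟨s, hs⟩ := exists_finset_forall_abs_sub_cdf_le μ (half_pos hε)
  have hsum := tendsto_finsetSum s fun y _ =>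
    (hIic y (ε / 2) (half_pos hε)).add (hIio y (ε / 2) (half_pos hε))
  simp only [add_zero, Finset.sum_const_zero] at hsum
  refine squeeze_zero (fun n => measureReal_nonneg) (fun n => ?_) hsum
  have hsub : {ω | ∃ x, ε < |subDist ν T X b n (n' n) ω x - cdf μ x|} ⊆
      ⋃ y ∈ s, ({ω | ε / 2 ≤ |freq (fun t => {ω | subPval ν T X b n (n' n) t ω ∈ Set.Iic y})
          (n - n' n + 1) ω - μ.real (Set.Iic y)|} ∪
        {ω | ε / 2 ≤ |freq (fun t => {ω | subPval ν T X b n (n' n) t ω ∈ Set.Iio y})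
          (n - n' n + 1) ω - μ.real (Set.Iio y)|}) := by
    intro ω hω
    by_contra hcon
    simp only [Set.mem_iUnion, Set.mem_union, Set.mem_ofPred_eq, not_exists, not_or, not_le] at hcon
    obtain ⟨x, hx⟩ := hω
    have := hs (subDist ν T X b n (n' n) ω)
      (fun y => freq (fun t => {ω | subPval ν T X b n (n' n) t ω ∈ Set.Iio y}) (n - n' n + 1) ω)
      (subDist_nonneg _ _ _) (subDist_le_one _ _ _) (subDist_mono _ _ _)
      (fun x y hxy => by
        rw [subDist_eq_freq]
        exact freq_mono fun t ht => lt_of_le_of_lt (b := x) ht hxy)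
      (fun y hy => by
        rw [subDist_eq_freq, cdf_eq_real]
        exact ⟨(hcon y hy).1.le, (hcon y hy).2.le⟩) x
    linarith
  refine (measureReal_mono hsub (measure_ne_top _ _)).trans ((measureReal_biUnion_finset_le s _).trans ?_)
  exact Finset.sum_le_sum fun y _ => measureReal_union_le _ _

/-- **Coverage.** If the p-values converge in law to `μ`, including the masses of half lines, and
the second stage distribution functions converge uniformly, then the calibrated region covers with
probability tending to `1 - a`, provided that the `a`-quantile of `μ` is not an atom. -/
lemma tendsto_coverage {μ : Measure ℝ} [IsProbabilityMeasure μ] {n' : ℕ → ℕ} {p : ℕ → Ω → ℝ}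
    (hIci : ∀ y, Tendsto (fun n => P.real {ω | p n ω ∈ Set.Ici y}) atTop (𝓝 (μ.real (Set.Ici y))))
    (hIoi : ∀ y, Tendsto (fun n => P.real {ω | p n ω ∈ Set.Ioi y}) atTop (𝓝 (μ.real (Set.Ioi y))))
    (hunif : ∀ ε > 0, Tendsto (fun n =>
      P.real {ω | ∃ x, ε < |subDist ν T X b n (n' n) ω x - cdf μ x|}) atTop (𝓝 0))
    {a : ℝ} (h0 : 0 < a) (h1 : a < 1) (hatom : μ {quantile (cdf μ) a} = 0) :
    Tendsto (fun n => P.real {ω | quantile (subDist ν T X b n (n' n) ω) a ≤ p n ω}) atTop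
      (𝓝 (1 - a)) := by
  simp only [quantile_subDist_le_iff h0 h1]
  refine tendsto_order.2 ⟨fun c hc => ?_, fun c hc => ?_⟩
  · -- a quantile at a level slightly above `a`
    obtain ⟨ε, hε, hεc, hε1⟩ : ∃ ε > 0, c + ε < 1 - a - ε ∧ a + ε < 1 := by
      refine ⟨min ((1 - a - c) / 3) ((1 - a) / 2),
        lt_min (by linarith) (by linarith), ?_, ?_⟩
      · linarith [min_le_left ((1 - a - c) / 3) ((1 - a) / 2)]
      · linarith [min_le_right ((1 - a - c) / 3) ((1 - a) / 2)]
    set y := quantile (cdf μ) (a + ε)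
    have hy1 : a + ε ≤ cdf μ y := (quantile_cdf_le_iff (by linarith) hε1).1 le_rfl
    have hy2 : μ.real (Set.Iio y) ≤ a + ε := measureReal_Iio_quantile_le (by linarith) hε1
    have hy3 : 1 - a - ε ≤ μ.real (Set.Ici y) := by
      have : μ.real (Set.Iio y)ᶜ = 1 - μ.real (Set.Iio y) := probReal_compl_eq_one_sub measurableSet_Iio
      rw [Set.compl_Iio] at this
      linarith
    filter_upwards [(hIci y).eventually (lt_mem_nhds (show c + ε < _ by linarith)),
      (hunif ε hε).eventually (gt_mem_nhds hε)] with n e1 e2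
    have hsub : {ω | p n ω ∈ Set.Ici y} ⊆ {ω | a ≤ subDist ν T X b n (n' n) ω (p n ω)} ∪
        {ω | ∃ x, ε < |subDist ν T X b n (n' n) ω x - cdf μ x|} := by
      intro ω hω
      by_cases h : ∃ x, ε < |subDist ν T X b n (n' n) ω x - cdf μ x|
      · exact Or.inr h
      · left
        push Not at h
        have hω : y ≤ p n ω := hω
        have h3 := (abs_le.1 (h (p n ω))).1
        have h4 := monotone_cdf μ hω
        change a ≤ subDist ν T X b n (n' n) ω (p n ω)
        linarith
    have h5 := (measureReal_mono hsub).trans (measureReal_union_le (μ := P) _ _)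
    linarith
  · -- a point just below the `a`-quantile, where `cdf μ` is still close to `a`
    have hq : a ≤ cdf μ (quantile (cdf μ) a) := (quantile_cdf_le_iff h0 h1).1 le_rfl
    have hleft : a ≤ μ.real (Set.Iio (quantile (cdf μ) a)) := by
      rw [cdf_eq_real, ← Set.Iio_union_right] at hq
      have h2 := measureReal_union_le (μ := μ) (Set.Iio (quantile (cdf μ) a)) {quantile (cdf μ) a}
      rw [measureReal_def μ {_}, hatom] at h2
      simpa using hq.trans h2
    obtain ⟨x, hx1, hx2⟩ := (((tendsto_cdf_nhdsLT (μ := μ) (quantile (cdf μ) a)).eventually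
      (lt_mem_nhds (show 1 - c < _ by linarith))).and self_mem_nhdsWithin).exists
    have hx2 : x < quantile (cdf μ) a := hx2
    rw [← not_le, quantile_cdf_le_iff h0 h1, not_le] at hx2
    have hx3 : μ.real (Set.Ioi x) = 1 - cdf μ x := by
      rw [cdf_eq_real, ← probReal_compl_eq_one_sub measurableSet_Iic, Set.compl_Iic]
    set ε := min ((a - cdf μ x) / 2) ((c - (1 - cdf μ x)) / 2) with hε
    have hε0 : 0 < ε := lt_min (by linarith) (by linarith)
    have hε1 : ε ≤ (a - cdf μ x) / 2 := min_le_left _ _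
    have hε2 : ε ≤ (c - (1 - cdf μ x)) / 2 := min_le_right _ _
    filter_upwards [(hIoi x).eventually (gt_mem_nhds (show _ < 1 - cdf μ x + ε by linarith)),
      (hunif ε hε0).eventually (gt_mem_nhds hε0)] with n e1 e2
    have hsub : {ω | a ≤ subDist ν T X b n (n' n) ω (p n ω)} ⊆ {ω | p n ω ∈ Set.Ioi x} ∪
        {ω | ∃ x, ε < |subDist ν T X b n (n' n) ω x - cdf μ x|} := by
      intro ω hω
      by_cases h : ∃ x, ε < |subDist ν T X b n (n' n) ω x - cdf μ x|
      · exact Or.inr h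
      · left
        push Not at h
        have hω : a ≤ subDist ν T X b n (n' n) ω (p n ω) := hω
        have h3 := (abs_le.1 (h (p n ω))).2
        change x < p n ω
        by_contra! hle
        have h4 := monotone_cdf μ hle
        linarith
    have h5 := (measureReal_mono hsub).trans (measureReal_union_le (μ := P) _ _)
    linarith

end subDist

end

end DoubleSubsampling

open DoubleSubsampling

theorem theorem2 {Ω Ω' : Type*} [MeasurableSpace Ω] [MeasurableSpace Ω']
    (P : Measure Ω) [IsProbabilityMeasure P] (P' : Measure Ω') [IsProbabilityMeasure P']
    {p k : ℕ} (hk : 1 ≤ k)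
    -- the norm on `ℝ^k`
    (ν : Seminorm ℝ (Fin k → ℝ)) (hν : ∀ v, ν v = 0 → v = 0)
    -- the stationary, strongly mixing process, with marginal distribution `F`
    (X : ℤ → Ω → Fin p → ℝ) (hXmeas : ∀ t, Measurable (X t))
    (hstat : IsStrictlyStationary P X) (hmix : IsAlphaMixing P X)
    (F : Measure (Fin p → ℝ)) (hF : F = P.map (X 0))
    -- the functional `T`, whose values at empirical distributions are statistics
    (T : Measure (Fin p → ℝ) → Fin k → ℝ)
    (hT : ∀ m : ℕ, Measurable fun x : Fin m → Fin p → ℝ => T (empirical x))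
    -- its influence function
    (φ : (Fin p → ℝ) → Fin k → ℝ) (hφ : IsInfluenceFunction T F φ)
    -- the fixed bandwidth ratio
    (b : ℝ) (hb0 : 0 < b) (hb1 : b ≤ 1)
    -- the functional central limit theorem for the influence function
    (S : Matrix (Fin k) (Fin k) ℝ) (hS : S.PosDef)
    (W : Fin k → ℝ≥0 → Ω' → ℝ) (hW : IsVectorBrownian P' W)
    (hφint : Integrable φ F) (hφmean : ∫ x, φ x ∂F = 0)
    (hFCLT : SkorokhodWeakConv P (fun n ω => partialSumProcess φ X n ω)
      P' (fun ω' (r : unitInterval) => scaledBM S W ω' (r : ℝ)))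
    -- negligibility of the remainders
    (hRfull : TendstoInMeasure P
      (fun (n : ℕ) ω => √(n : ℝ) * ν (remainder T F φ X 1 n ω)) atTop (fun _ => 0))
    (hRblock : TendstoInMeasure P
      (fun (n : ℕ) ω => √(blockLen b n : ℝ) *
        ⨆ j : Fin (numBlocks b n), ν (remainder T F φ X (1 + (j : ℕ)) (blockLen b n) ω))
      atTop (fun _ => 0))
    -- the second stage window width
    (n' : ℕ → ℕ) (hn' : Tendsto n' atTop atTop)
    (hn'n : Tendsto (fun n : ℕ => (n' n : ℝ) / (n : ℝ)) atTop (𝓝 0)) :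
    TendstoInMeasure P
      (fun (n : ℕ) ω => ⨆ x : ℝ,
        |subDist ν T X b n (n' n) ω x - distFun P' (limitG ν S W b) x|)
      atTop (fun _ => 0) ∧
    ∀ a : ℝ, 0 < a → a < 1 →
      P' {ω' | limitG ν S W b ω' = quantile (distFun P' (limitG ν S W b)) a} = 0 →
      Tendsto (fun n : ℕ => P.real {ω | T F ∈ confRegion ν T X b n (n' n) a ω})
        atTop (𝓝 (1 - a)) := by
  have hφX : ∀ t, AEMeasurable (fun ω => φ (X t ω)) P := fun t => by
    have h1 : AEMeasurable φ (P.map (X t)) := by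
      rw [hstat.map_eq hXmeas t, ← hF]
      exact hφint.aestronglyMeasurable.aemeasurable
    exact h1.comp_measurable (hXmeas t)
  have hGm := aemeasurable_limitG hW hk hS hν hb0 hb1
  set G := limitG ν S W b with hG
  let μ : Measure ℝ := P'.map G
  have : IsProbabilityMeasure μ := Measure.isProbabilityMeasure_map hGm
  have hμ : ∀ B, MeasurableSet B → μ.real B = P'.real {ω' | G ω' ∈ B} := fun B hB =>
    map_measureReal_apply_of_aemeasurable hGm hB
  have hdist : distFun P' G = cdf μ := by
    ext x
    rw [cdf_eq_real, hμ _ measurableSet_Iic]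
    rfl
  have hlaw : ∀ (m : ℕ → ℕ) (_ : Tendsto m atTop atTop) (δ : ℕ → ℝ) (_ : Tendsto δ atTop (𝓝 0))
      (B : Set ℝ) (_ : MeasurableSet B) (y : ℝ) (_ : frontier B ⊆ {y}),
      Tendsto (fun n => P.real {ω | windowPval ν T X b (m n) 1 (δ n) (T F) ω ∈ B}) atTop
        (𝓝 (μ.real B)) := by
    intro m hm δ hδ B hB y hy
    rw [hμ B hB]
    exact tendsto_windowPval hk hν hb0 hb1 hφX hS hW hFCLT hRfull hRblock hm hδ hB hy
  have hcenter : ∀ ε > 0, Tendsto (fun n =>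
      P.real {ω | ε < ν (√(n' n : ℝ) • (blockEst T X 1 n ω - T F))}) atTop (𝓝 0) :=
    fun ε hε => tendsto_sqrt_smul_blockEst_sub hφX hW hFCLT hRfull hn'n hε
  have hunif : ∀ ε > 0, Tendsto (fun n =>
      P.real {ω | ∃ x, ε < |subDist ν T X b n (n' n) ω x - cdf μ x|}) atTop (𝓝 0) :=
    fun ε hε => tendsto_measureReal_exists_lt
      (fun y η hη => tendsto_freq_subPval hT hb1 hXmeas hstat hmix hn'n measurableSet_Iic
        (isLowerSet_Iic y) (fun δ hδ => hlaw n' hn' δ hδ _ measurableSet_Iic y (by simp))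
        hcenter hη)
      (fun y η hη => tendsto_freq_subPval hT hb1 hXmeas hstat hmix hn'n measurableSet_Iio
        (isLowerSet_Iio y) (fun δ hδ => hlaw n' hn' δ hδ _ measurableSet_Iio y (by simp))
        hcenter hη) hε
  rw [hdist]
  refine ⟨?_, fun a ha0 ha1 hatom => ?_⟩
  · rw [tendstoInMeasure_iff_measureReal_norm]
    intro ε hε
    refine squeeze_zero (fun n => measureReal_nonneg)
      (fun n => measureReal_mono fun ω hω => ?_) (hunif (ε / 2) (half_pos hε))
    have hω : ε ≤ ‖(⨆ x : ℝ, |subDist ν T X b n (n' n) ω x - cdf μ x|) - 0‖ := hω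
    rw [sub_zero, Real.norm_of_nonneg (Real.iSup_nonneg fun x => abs_nonneg _)] at hω
    by_contra hcon
    have hle : ∀ x, |subDist ν T X b n (n' n) ω x - cdf μ x| ≤ ε / 2 := fun x =>
      not_lt.1 fun h => hcon ⟨x, h⟩
    linarith [ciSup_le hle]
  · refine tendsto_coverage (p := fun n ω => pval ν T X b n (T F) ω) (fun y => ?_) (fun y => ?_)
      hunif ha0 ha1 ?_
    · simp only [pval_eq_windowPval]
      exact hlaw id tendsto_id (fun _ => 0) tendsto_const_nhds _ measurableSet_Ici y (by simp)
    · simp only [pval_eq_windowPval]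
      exact hlaw id tendsto_id (fun _ => 0) tendsto_const_nhds _ measurableSet_Ioi y (by simp)
    · rw [Measure.map_apply_of_aemeasurable hGm (measurableSet_singleton _)]
      exact hatom
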